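/- Let $f:[0,2\pi]\to\mathbb C$ be continuous with $f(0)=f(2\pi)$, let $\hat f(\omega)=\frac1{2\pi}\int_0^{2\pi}e^{-i\omega x}f(x)\,dx$, and suppose $\hat f\in\ell^1(\mathbb Z)$. Let $N,k,\epsilon^{-1}\ge 2$ be integers with $k/\epsilon<N$, and let $\sigma\in[2/3,1)$. Put $B=(-\lceil N/2\rceil,\lfloor N/2\rfloor]\cap\mathbb Z$, $\vec{\hat f}=(\hat f(\omega))_{\omega\in B}$, let $\bar{\hat f}$ equal $\hat f$ on $B$ and $0$ off $B$, and let $\vec{\hat f}{}^{\,\rm opt}_n$ be a best $n$-term approximation of $\vec{\hat f}$ ($n$ entries of largest magnitude kept). **Moduli.** Call integers $2\le s_1<\dots<s_K$ and $t_1<\dots<t_\lambda<s_1$ admissible if $K=14\,(k/\epsilon)\lfloor\log_{s_1}N\rfloor+1$, the set $\{t_1,\dots,t_\lambda,s_1,\dots,s_K\}$ is pairwise relatively prime, and $\prod_i t_i\ge N/s_1$. Let $\tilde S$ be the multiset of $l=\lceil 21\ln(N/(1-\sigma))\rceil$ moduli $s_j$ chosen independently and uniformly at random, with replacement. The rows of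 $\mathcal R=\mathcal M_{\tilde S}\circledast\mathcal N_{\lambda,s_1}$ are the indicators of all residue classes modulo $\tau s$, where $s\in\tilde S$ and $\tau\in\{1,t_1,\dots,t_\lambda\}$. **Algorithm (Fourier Approximate 2, with $\mathcal R$).** (a) For each distinct $s\in\tilde S$ and each $\tau\in\{1,t_1,\dots,t_\lambda\}$, sample $f$ at $2\pi p/(\tau s)$, $0\le p<\tau s$, and set $G_{\tau s,h}=\frac1{\tau s}\sum_{p<\tau s}f(2\pi p/(\tau s))\,e^{-2\pi i hp/(\tau s)}$. (b) For each $s\in\tilde S$ and $0\le h<s$: for each $i$ let $b_{\min}$ minimize $|G_{s,h}-G_{t_is,\,h+bs}|$ over $0\le b<t_i$, and set $a_i=(h+b_{\min}s)\bmod t_i$; then reconstruct the $\omega\in B$ (if any) with $\omega\equiv h \bmod s$ and $\omega\equiv a_i\bmod t_i$ for all $i$. (c) For each $\omega$ reconstructed more than $l/2$ times (counted with the multiplicities of $\tilde S$), let ${\rm Re}\,x_\omega$ and ${\rm Im}\,x_\omega$ be the medians of the real and of the imaginary parts of the $l(\lambda+1)$ numbers $G_{\tau s,\ \omega\bmod \tau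 s}$, counted with multiplicity. (d) Let $S$ hold the indices of the $2k$ largest magnitude nonzero $x_\omega$ (all of them if there are fewer), and output $\vec x_S$, which is $x_\omega$ for $\omega\in S$ and $0$ elsewhere. **Error.** For every admissible choice of moduli, with probability at least $\sigma$ the output satisfies $$\left\|\vec{\hat f}-\vec x_S\right\|_2\le\left\|\vec{\hat f}-\vec{\hat f}{}^{\,\rm opt}_k\right\|_2+\frac{22\,\epsilon\left\|\vec{\hat f}-\vec{\hat f}{}^{\,\rm opt}_{(k/\epsilon)}\right\|_1}{\sqrt k}+22\sqrt k\,\left\|\hat f-\bar{\hat f}\right\|_1 .$$ **Resources.** Let $s_1$ be the least prime $p\ge k/\epsilon$ for which $p\prod_{r<p,\ r\ {\rm prime}}r\ge N$, let $s_1<s_2<\dots<s_K$ be consecutive primes, and let $t_1,\dots,t_\lambda$ be the first $\lambda$ primes with $\lambda$ least such that $\prod_{i\le\lambda}t_i\ge N/s_1$. This choice is admissible. For it, the number of evaluations of $f$, and the number of steps of parts (b)–(d) on a random access machine with unit cost integer and real operations, are, for every outcome of the random selection, $$O\!\left(\frac k\epsilon\cdot\log^3N\cdot\log\!\left(\frac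 N{1-\sigma}\right)\right)$$ with an absolute implied constant. -/

import Mathlib

open scoped BigOperators

noncomputable section

namespace SparseFourier

/-! ## Fourier coefficients and best approximations -/

/-- The Fourier coefficient `f̂(ω) = (1/2π) ∫₀^{2π} e^{-iωx} f(x) dx`. -/
def fhat (f : ℝ → ℂ) (ω : ℤ) : ℂ :=
  (1 / (2 * (Real.pi : ℂ))) *
    ∫ x in (0 : ℝ)..(2 * Real.pi), Complex.exp (-Complex.I * (ω : ℂ) * (x : ℂ)) * f x

/-- The band `(-⌈N/2⌉, ⌊N/2⌋] ∩ ℤ`, which has `N` elements. -/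
def band (N : ℕ) : Finset ℤ :=
  Finset.Ioc (-(((N + 1) / 2 : ℕ) : ℤ)) ((N / 2 : ℕ) : ℤ)

/-- The vector that equals `x` on `S` and vanishes elsewhere. -/
def restrict (S : Finset ℤ) (x : ℤ → ℂ) (ω : ℤ) : ℂ := if ω ∈ S then x ω else 0

/-- The `ℓ¹` norm over the band. -/
def norm1 (N : ℕ) (x : ℤ → ℂ) : ℝ := ∑ ω ∈ band N, ‖x ω‖

/-- The `ℓ²` norm over the band. -/
def norm2 (N : ℕ) (x : ℤ → ℂ) : ℝ := Real.sqrt (∑ ω ∈ band N, ‖x ω‖ ^ 2)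

/-- `‖f̂ - f̂ restricted to the band‖₁`, the `ℓ¹` mass of `f̂` outside of the band. -/
def outOfBand (N : ℕ) (f : ℝ → ℂ) : ℝ := ∑' ω : ℤ, ‖fhat f ω - restrict (band N) (fhat f) ω‖

/-- `S` is a set of `n` indices of the band that carry `n` largest magnitude entries of `x`;
then `restrict S x` is a best `n`-term approximation of `x` on the band. -/
def IsOptSupport (N n : ℕ) (x : ℤ → ℂ) (S : Finset ℤ) : Prop :=
  S ⊆ band N ∧ S.card = n ∧ ∀ a ∈ S, ∀ b ∈ band N \ S, ‖x b‖ ≤ ‖x a‖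

/-! ## Evaluations of `f` and elementary steps -/

/-- A computation with access to `f`: its result and the list of all points at which
`f` was evaluated (repetitions are recorded). -/
structure Sampled (α : Type) where
  val : α
  points : List ℝ

instance : Monad Sampled where
  pure a := ⟨a, []⟩
  bind x g := ⟨(g x.val).val, x.points ++ (g x.val).points⟩

/-- Evaluate `f` at the point `x`. -/
def evalAt (f : ℝ → ℂ) (x : ℝ) : Sampled ℂ := ⟨f x, [x]⟩

/-- A computation on a real random access machine: its result and its number of steps. -/
structure Timed (α : Type) where
  val : α
  steps : ℕ

instance : Monad Timed where
  pure a := ⟨a, 0⟩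
  bind x g := ⟨(g x.val).val, x.steps + (g x.val).steps⟩

/-- One elementary step of the machine. It is only ever applied to a single arithmetic operation
or comparison of integers, real or complex numbers, a single read or write of a memory cell,
or the insertion of one element at the head of a list. -/
def op {α : Type} (a : α) : Timed α := ⟨a, 1⟩

/-- `for a in xs do st ← body st a`; one further step per iteration is charged for loop control. -/
def loop {α σ : Type} : List α → σ → (σ → α → Timed σ) → Timed σ
  | [], st, _ => pure st
  | a :: xs, st, body => do
      let st' ← body st a
      let _ ← op ()
      loop xs st' body

/-- `|z|²`; magnitudes are compared through their squares. -/
def absSq (z : ℂ) : Timed ℝ := do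
  let a ← op (z.re * z.re)
  let b ← op (z.im * z.im)
  op (a + b)

/-! ### Merge sort, with respect to a timed comparison `le` -/

/-- Merge two sorted lists. -/
def merge {α : Type} (le : α → α → Timed Bool) : List α → List α → Timed (List α)
  | [], ys => op ys
  | x :: xs, [] => op (x :: xs)
  | x :: xs, y :: ys => do
      let c ← le x y
      if c then
        let r ← merge le xs (y :: ys)
        op (x :: r)
      else
        let r ← merge le (x :: xs) ys
        op (y :: r)
termination_by xs ys => xs.length + ys.length

/-- Merge neighbouring lists of a list of sorted lists. -/
def mergePairs {α : Type} (le : α → α → Timed Bool) : List (List α) → Timed (List (List α))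
  | [] => op []
  | [a] => op [a]
  | a :: b :: rest => do
      let m ← merge le a b
      let r ← mergePairs le rest
      op (m :: r)

/-- Repeat `mergePairs` until one list is left. The first argument only bounds the number of
rounds; the number of lists is large enough. -/
def mergeRounds {α : Type} (le : α → α → Timed Bool) : ℕ → List (List α) → Timed (List α)
  | 0, _ => op []
  | _ + 1, [] => op []
  | _ + 1, [a] => op a
  | n + 1, a :: b :: rest => do
      let r ← mergePairs le (a :: b :: rest)
      mergeRounds le n r

/-- Bottom-up merge sort. -/
def mergeSort {α : Type} (le : α → α → Timed Bool) (xs : List α) : Timed (List α) := do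
  let singles ← loop xs [] (fun st x => op ([x] :: st))
  mergeRounds le singles.length singles

/-- The first `n` elements of a list (all of them if there are fewer). -/
def takeFirst {α : Type} : ℕ → List α → Timed (List α)
  | 0, _ => op []
  | _ + 1, [] => op []
  | n + 1, a :: xs => do
      let r ← takeFirst n xs
      op (a :: r)

/-! ## Fast multiply

The rows of `M_S̃ ⊛ N_{λ,s₁}` are the indicators of the residue classes `h mod τ * s`, where
`s` is a selected modulus and `τ` is `1` (for the all-ones row of `N_{λ,s₁}`) or one of the `tᵢ`.
The entry for this row of the approximation to `(M_S̃ ⊛ N_{λ,s₁}) f̂` is entry `h` of the discrete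
Fourier transform of `τ * s` equispaced samples of `f`. It is stored in `G (τ * s) h`. -/

/-- The normalized discrete Fourier transform of the array `A` of length `m`. -/
def dft (m : ℕ) (A : List ℂ) (h : ℕ) : ℂ :=
  (1 / (m : ℂ)) * ∑ p ∈ Finset.range m,
    A.getD p 0 * Complex.exp (-2 * (Real.pi : ℂ) * Complex.I * (h : ℂ) * (p : ℂ) / (m : ℂ))

/-- The array `f(0), f(2π/m), …, f(2π(m-1)/m)`. -/
def sampleArray (f : ℝ → ℂ) (m : ℕ) : Sampled (List ℂ) :=
  (List.range m).mapM (fun p => evalAt f (2 * Real.pi * (p : ℝ) / (m : ℝ)))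

/-- Sample `f` and transform, for each array length in a given list. -/
def fastMultiply (f : ℝ → ℂ) : List ℕ → Sampled (ℕ → ℕ → ℂ)
  | [] => pure (fun _ _ => 0)
  | m :: ms => do
      let A ← sampleArray f m
      let G ← fastMultiply f ms
      pure (Function.update G m (dft m A))

/-! ## Identification of frequencies -/

/-- `argmin` over `b ∈ [0, τ)` of `|G s h - G (τ * s) (h + b * s)|`. -/
def argMin (G : ℕ → ℕ → ℂ) (s h τ : ℕ) : Timed ℕ := do
  let e ← op (G s h)
  let m ← op (τ * s)
  let g0 ← op (G m h)
  let d0 ← op (e - g0)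
  let v0 ← absSq d0
  let r ← loop (List.range τ) ((0, v0) : ℕ × ℝ) (fun st b => do
    let p ← op (b * s)
    let q ← op (h + p)
    let g ← op (G m q)
    let d ← op (e - g)
    let v ← absSq d
    let c ← op (decide (v < st.2))
    if c then op (b, v) else pure st)
  pure r.1

/-- The residues `a_i = (h + b_min * s) mod tᵢ`, as a list of pairs `(tᵢ, a_i)`. -/
def residues (G : ℕ → ℕ → ℂ) (t : List ℕ) (s h : ℕ) : Timed (List (ℕ × ℕ)) :=
  loop t [] (fun st τ => do
    let b ← argMin G s h τ
    let p ← op (b * s)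
    let q ← op (h + p)
    let a ← op (q % τ)
    op ((τ, a) :: st))

/-- Chinese remaindering, one congruence at a time: `(x, M)` stands for the class `x mod M`, and
the congruence `a mod τ` is added by a search for `y ∈ [0, τ)` with `x + y * M ≡ a mod τ`. -/
def chinese (h s : ℕ) (cs : List (ℕ × ℕ)) : Timed (ℕ × ℕ) :=
  loop cs (h, s) (fun st c => do
    let z ← loop (List.range c.1) st.1 (fun z y => do
      let p ← op (y * st.2)
      let q ← op (st.1 + p)
      let r ← op (q % c.1)
      let e ← op (decide (r = c.2))
      if e then op q else pure z)
    let M ← op (st.2 * c.1)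
    op (z, M))

/-- The representative in the band of the class `x mod M` (where `x < M` and `N ≤ M`),
if there is one. -/
def toBand (N x M : ℕ) : Timed (Option ℤ) := do
  let u ← op (N / 2)
  let c ← op (decide (x ≤ u))
  if c then op (some (x : ℤ))
  else
    let y ← op ((x : ℤ) - (M : ℤ))
    let v ← op (N - u)
    let w ← op (-(v : ℤ))
    let d ← op (decide (w < y))
    if d then op (some y) else op none

/-- The frequency `ω` of the band with `ω ≡ h mod s` and `ω ≡ a_i mod tᵢ` for all `i`, if any. -/
def reconstruct (G : ℕ → ℕ → ℂ) (N : ℕ) (t : List ℕ) (s h : ℕ) : Timed (Option ℤ) := do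
  let cs ← residues G t s h
  let xM ← chinese h s cs
  toBand N xM.1 xM.2

/-- The identification loop. The list `S` holds the distinct selected moduli, each with its
multiplicity. The state is an array of counters, initially zero, that tells how often (counted with
multiplicity) each frequency was reconstructed, and the list of all reconstructed frequencies. -/
def identify (G : ℕ → ℕ → ℂ) (N : ℕ) (t : List ℕ) (S : List (ℕ × ℕ)) :
    Timed ((ℤ → ℕ) × List ℤ) :=
  loop S ((fun _ => 0), []) (fun st sw =>
    loop (List.range sw.1) st (fun st h => do
      let o ← reconstruct G N t sw.1 h
      match o with
      | none => pure st
      | some ω => do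
          let c ← op (st.1 ω)
          let c' ← op (c + sw.2)
          let cnt ← op (Function.update st.1 ω c')
          let rs ← op (ω :: st.2)
          pure (cnt, rs)))

/-! ## Estimation of coefficients -/

/-- The entries of the table for all rows whose residue class contains `ω`, each with its
multiplicity. -/
def entriesAt (G : ℕ → ℕ → ℂ) (t : List ℕ) (S : List (ℕ × ℕ)) (ω : ℤ) : Timed (List (ℂ × ℕ)) :=
  loop S [] (fun st sw =>
    loop (1 :: t) st (fun st τ => do
      let m ← op (τ * sw.1)
      let h ← op (ω % (m : ℤ)).toNat
      let g ← op (G m h)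
      op ((g, sw.2) :: st)))

/-- The (lower) median of the multiset of the numbers `proj z`, where `(z, w)` runs through `xs`
and is counted `w` times; `total` is the sum of all multiplicities `w`. -/
def median (proj : ℂ → ℝ) (total : ℕ) (xs : List (ℂ × ℕ)) : Timed ℝ := do
  let ys ← mergeSort (fun a b => op (decide (proj a.1 ≤ proj b.1))) xs
  let r ← loop ys ((0, none) : ℕ × Option ℝ) (fun st zw => do
    let acc ← op (st.1 + zw.2)
    let dbl ← op (2 * acc)
    let c ← op (decide (total ≤ dbl))
    let u ← op st.2.isNone
    if c && u then op (acc, some (proj zw.1)) else pure (acc, st.2))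
  pure (r.2.getD 0)

/-- The estimate of the coefficient at `ω`; `l` is the number of selected moduli, counted with
multiplicity. -/
def estimate (G : ℕ → ℕ → ℂ) (l : ℕ) (t : List ℕ) (S : List (ℕ × ℕ)) (ω : ℤ) : Timed ℂ := do
  let xs ← entriesAt G t S ω
  let n ← loop t 1 (fun n _ => op (n + 1))
  let total ← op (l * n)
  let a ← median Complex.re total xs
  let b ← median Complex.im total xs
  op ⟨a, b⟩

/-- Estimate, once for each, the coefficients of all frequencies that were reconstructed more
than `l / 2` times. The counter of a frequency is cleared as soon as it has been dealt with. -/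
def estimateAll (G : ℕ → ℕ → ℂ) (l : ℕ) (t : List ℕ) (S : List (ℕ × ℕ))
    (cr : (ℤ → ℕ) × List ℤ) : Timed (List (ℤ × ℂ)) := do
  let r ← loop cr.2 (cr.1, ([] : List (ℤ × ℂ))) (fun st ω => do
    let c ← op (st.1 ω)
    let d ← op (2 * c)
    let b ← op (decide (l < d))
    if b then do
      let x ← estimate G l t S ω
      let cnt ← op (Function.update st.1 ω 0)
      let xs ← op ((ω, x) :: st.2)
      pure (cnt, xs)
    else pure st)
  pure r.2

/-- Sort the nonzero entries by magnitude and keep the `2k` largest (all, if there are fewer). -/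
def largest (k : ℕ) (xs : List (ℤ × ℂ)) : Timed (List (ℤ × ℂ)) := do
  let nz ← loop xs ([] : List (ℤ × ℂ)) (fun st a => do
    let b ← op (decide (a.2 = 0))
    if b then pure st else op (a :: st))
  let sorted ← mergeSort (fun a b => do
    let u ← absSq a.2
    let v ← absSq b.2
    op (decide (v ≤ u))) nz
  let n ← op (2 * k)
  takeFirst n sorted

/-- Identification, estimation and selection: everything after the table `G` has been computed.
The result is the list of the pairs `(ω, x_ω)`, `ω ∈ S`. -/
def recover (N k l : ℕ) (t : List ℕ) (S : List (ℕ × ℕ)) (G : ℕ → ℕ → ℂ) :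
    Timed (List (ℤ × ℂ)) := do
  let cr ← identify G N t S
  let xs ← estimateAll G l t S cr
  largest k xs

/-- The whole algorithm: sample `f`, compute the table, recover. -/
def fourierApprox (N k l : ℕ) (t : List ℕ) (S : List (ℕ × ℕ)) (f : ℝ → ℂ) :
    Sampled (Timed (List (ℤ × ℂ))) := do
  let G ← fastMultiply f (S.flatMap (fun sw => (1 :: t).map (fun τ => τ * sw.1)))
  pure (recover N k l t S G)

/-- The vector with the entries in a given list of pairs `(ω, x_ω)`, and zero elsewhere. -/
def toVector (xs : List (ℤ × ℂ)) (ω : ℤ) : ℂ := (xs.lookup ω).getD 0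

/-! ## Moduli and random selection -/

/-- The number `K = 14 (k/ε) ⌊log_{s₁} N⌋ + 1` of moduli; `X` is `k/ε`. -/
def numModuli (N X s₁ : ℕ) : ℕ := 14 * X * Nat.log s₁ N + 1

/-- `s 0 < … < s (K-1)` are moduli for `M_{s₁,K}` with `s₁ = s 0`, and the list `t` holds
integers `t₁ < … < t_λ < s₁` that are valid for `N_{λ,s₁}`. -/
structure Admissible (N X : ℕ) (s : ℕ → ℕ) (t : List ℕ) : Prop where
  two_le : 2 ≤ s 0
  s_lt : ∀ i j, i < j → j < numModuli N X (s 0) → s i < s j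
  s_coprime : ∀ i j, i < j → j < numModuli N X (s 0) → Nat.Coprime (s i) (s j)
  t_lt : t.Pairwise (· < ·)
  t_lt_s : ∀ τ ∈ t, τ < s 0
  t_coprime : t.Pairwise Nat.Coprime
  t_s_coprime : ∀ τ ∈ t, ∀ j, j < numModuli N X (s 0) → Nat.Coprime τ (s j)
  le_prod : (N : ℝ) / (s 0 : ℝ) ≤ (t.prod : ℝ)

/-- The number `l = ⌈21 ln (N / (1 - σ))⌉` of random selections. -/
def numDraws (N : ℕ) (σ : ℝ) : ℕ := ⌈21 * Real.log ((N : ℝ) / (1 - σ))⌉₊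

/-- The multiset `S̃` of the moduli `s (J 0), …, s (J (l-1))`: the list of its distinct members,
each with its multiplicity. -/
def selection {l K : ℕ} (s : ℕ → ℕ) (J : Fin l → Fin K) : List (ℕ × ℕ) :=
  ((List.finRange K).filter (fun j => decide (∃ a, J a = j))).map
    (fun j => (s j, (Finset.univ.filter (fun a => J a = j)).card))

/-- The run of the algorithm for the outcome `J` of the random selection. -/
def randomRun (N k : ℕ) {l K : ℕ} (s : ℕ → ℕ) (t : List ℕ) (J : Fin l → Fin K) (f : ℝ → ℂ) :
    Sampled (Timed (List (ℤ × ℂ))) :=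
  fourierApprox N k l t (selection s J) f

/-! ## Moduli built from primes -/

/-- The least prime `p ≥ X` such that `p` times the product of all primes below `p` is at least
`N`. It is the least prime `≥ X` unless the primes below that one have too small a product. -/
def firstModulus (N X : ℕ) : ℕ :=
  sInf {p : ℕ | p.Prime ∧ X ≤ p ∧ N ≤ p * ∏ r ∈ p.primesBelow, r}

/-- The consecutive primes from `firstModulus N X` on. -/
def primeModuli (N X j : ℕ) : ℕ :=
  Nat.nth Nat.Prime (Nat.primeCounting' (firstModulus N X) + j)

/-- The least number `n` of first primes whose product is at least `N / s₁`. -/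
def numPrimes (N X : ℕ) : ℕ :=
  sInf {n : ℕ | N ≤ firstModulus N X * ∏ i ∈ Finset.range n, Nat.nth Nat.Prime i}

/-- The first primes `2, 3, 5, …`, as many as are needed. -/
def smallPrimes (N X : ℕ) : List ℕ := (List.range (numPrimes N X)).map (Nat.nth Nat.Prime)

end SparseFourier

end

/-! Entry h of the transform of m equispaced samples is the sum of f̂ over the residue class h mod m
(`hasSum_dft_sampleArray`). Read at a class containing ω, for a modulus that is a multiple of s, it
differs from f̂(ω) by at most `tail`, the mass of the other frequencies congruent to ω mod s. Write
X = k/ε and let δ be 1/X times the ℓ¹ error of the best X-term approximation, plus the mass outside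
the band. Two distinct frequencies of the band collide modulo at most log_{s₁} N of the moduli,
because coprime divisors of their difference multiply up to less than N. The X largest entries
therefore spoil at most X log_{s₁} N moduli for ω, and averaging shows that the remaining entries
bring more than their share of δ for at most as many. So `tail` exceeds δ for less than a seventh of
the K moduli (`card_not_isolated_le`). An exponential moment bound (`card_half_hit_le`) and a union
bound over the N frequencies show that, with probability at least σ, more than half of the draws are
good for every ω simultaneously (`error_bound`).

On that event everything is deterministic (`norm2_sub_recover_le`). A good modulus identifies every
ω with |f̂(ω)| > 2δ, since the correct residue mod t_i leaves a discrepancy of at most `tail` and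
every wrong one leaves more (`reconstruct_eq`). The medians are within δ in each coordinate
(`norm_estimate_sub_le`). An entry of the optimal support that is missing from the output is either
at most 2δ, or is exchanged, up to 4δ, for an entry that was kept; this yields an excess of 5√k δ
(`sqrt_sum_sub_le`).

For the resources, Chebyshev bounds show that with prime moduli all s_j are O(X log N), that λ =
O(log N), and that the t_i sum to O(log² N) (`exists_primeModuli_le`, `exists_smallPrimes_le`). Only
O(max s_j) frequencies can be reconstructed more than l/2 times, so few estimates are made
(`estimateAll_length`). The step counts of the loops and sorts then combine in `recoverCost_le` and
`exists_cost_le`. -/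

namespace SparseFourier

/-! ### Values and step counts of timed computations and loops -/

section Timed

variable {α β σ : Type}

@[simp] lemma timed_bind_val (x : Timed α) (g : α → Timed β) : (x >>= g).val = (g x.val).val := rfl
@[simp] lemma timed_bind_steps (x : Timed α) (g : α → Timed β) :
    (x >>= g).steps = x.steps + (g x.val).steps := rfl
@[simp] lemma timed_pure_val (a : α) : (pure a : Timed α).val = a := rfl
@[simp] lemma timed_pure_steps (a : α) : (pure a : Timed α).steps = 0 := rfl
@[simp] lemma op_val (a : α) : (op a).val = a := rfl
@[simp] lemma op_steps (a : α) : (op a).steps = 1 := rfl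
@[simp] lemma absSq_val (z : ℂ) : (absSq z).val = ‖z‖ ^ 2 := by
  rw [← Complex.normSq_eq_norm_sq, Complex.normSq_apply]; rfl
@[simp] lemma absSq_steps (z : ℂ) : (absSq z).steps = 3 := rfl
@[simp high] lemma op_bind_val (a : α) (g : α → Timed β) : (op a >>= g).val = (g a).val := rfl
@[simp high] lemma op_bind_steps (a : α) (g : α → Timed β) :
    (op a >>= g).steps = 1 + (g a).steps := rfl
@[simp high] lemma absSq_bind_steps (z : ℂ) (g : ℝ → Timed β) :
    (absSq z >>= g).steps = 3 + (g (‖z‖ ^ 2)).steps := by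
  rw [timed_bind_steps, absSq_val, absSq_steps]

@[simp] lemma timed_ite_val (c : Prop) [Decidable c] (x y : Timed α) :
    (if c then x else y).val = if c then x.val else y.val := apply_ite _ _ _ _
@[simp] lemma timed_ite_steps (c : Prop) [Decidable c] (x y : Timed α) :
    (if c then x else y).steps = if c then x.steps else y.steps := apply_ite _ _ _ _

@[simp] lemma sampled_bind_val (x : Sampled α) (g : α → Sampled β) :
    (x >>= g).val = (g x.val).val := rfl
@[simp] lemma sampled_bind_points (x : Sampled α) (g : α → Sampled β) :
    (x >>= g).points = x.points ++ (g x.val).points := rfl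
@[simp] lemma sampled_pure_val (a : α) : (pure a : Sampled α).val = a := rfl
@[simp] lemma sampled_pure_points (a : α) : (pure a : Sampled α).points = [] := rfl

@[simp] lemma loop_nil (st : σ) (body : σ → α → Timed σ) : loop [] st body = pure st := rfl
@[simp] lemma loop_cons_val (a : α) (xs : List α) (st : σ) (body : σ → α → Timed σ) :
    (loop (a :: xs) st body).val = (loop xs (body st a).val body).val := rfl
@[simp] lemma loop_cons_steps (a : α) (xs : List α) (st : σ) (body : σ → α → Timed σ) :
    (loop (a :: xs) st body).steps
      = (body st a).steps + (1 + (loop xs (body st a).val body).steps) := rfl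

lemma loop_val (xs : List α) (st : σ) (body : σ → α → Timed σ) :
    (loop xs st body).val = xs.foldl (fun st a => (body st a).val) st := by
  induction xs generalizing st with
  | nil => rfl
  | cons a xs ih => simp [ih]

/-- A loop whose body conses one element onto the state builds the reversed image list. -/
lemma loop_val_of_cons (xs : List α) (st : List β) (body : List β → α → Timed (List β))
    (g : α → β) (h : ∀ st, ∀ a ∈ xs, (body st a).val = g a :: st) :
    (loop xs st body).val = (xs.map g).reverse ++ st := by
  induction xs generalizing st with
  | nil => simp
  | cons a xs ih =>
    rw [loop_cons_val, h st a (by simp), ih _ fun st b hb => h st b (by simp [hb])]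
    simp

lemma loop_steps_le_sum (xs : List α) (st : σ) (body : σ → α → Timed σ) (c : α → ℕ)
    (h : ∀ st, ∀ a ∈ xs, (body st a).steps ≤ c a) :
    (loop xs st body).steps ≤ (xs.map (fun a => c a + 1)).sum := by
  induction xs generalizing st with
  | nil => simp
  | cons a xs ih =>
    have h1 := h st a (by simp)
    have h2 := ih (body st a).val fun st b hb => h st b (by simp [hb])
    simp only [loop_cons_steps, List.map_cons, List.sum_cons]
    omega

lemma loop_steps_le (xs : List α) (st : σ) (body : σ → α → Timed σ) (c : ℕ)
    (h : ∀ st, ∀ a ∈ xs, (body st a).steps ≤ c) :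
    (loop xs st body).steps ≤ xs.length * (c + 1) := by
  have := loop_steps_le_sum xs st body (fun _ => c) h
  simpa using this

/-- Invariant rule for loops. -/
lemma loop_induction (xs : List α) (st : σ) (body : σ → α → Timed σ) (I : σ → Prop)
    (h0 : I st) (h : ∀ st, I st → ∀ a ∈ xs, I (body st a).val) : I (loop xs st body).val := by
  induction xs generalizing st with
  | nil => exact h0
  | cons a xs ih =>
    rw [loop_cons_val]
    exact ih _ (h st h0 a (by simp)) fun st hs b hb => h st hs b (by simp [hb])

/-! ### Merge sort -/

variable (le : α → α → Timed Bool)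

lemma merge_val (xs ys : List α) :
    (merge le xs ys).val = List.merge xs ys (fun a b => (le a b).val) := by
  induction xs generalizing ys with
  | nil => simp [merge]
  | cons x xs ihx =>
    induction ys with
    | nil => simp [merge]
    | cons y ys ihy =>
      rw [merge, List.cons_merge_cons]
      by_cases hc : (le x y).val = true
      · simp [hc, ihx]
      · simp [hc, ihy]

lemma merge_steps (c : ℕ) (hc : ∀ a b, (le a b).steps ≤ c) (xs ys : List α) :
    (merge le xs ys).steps ≤ (c + 1) * (xs.length + ys.length) + 1 := by
  induction xs generalizing ys with
  | nil => simp [merge]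
  | cons x xs ihx =>
    induction ys with
    | nil => simp [merge]
    | cons y ys ihy =>
      rw [merge]
      have h0 := hc x y
      by_cases hb : (le x y).val = true
      · have := ihx (y :: ys)
        simp only [timed_bind_steps, hb, if_true, op_steps, List.length_cons] at *
        nlinarith
      · have := ihy
        simp only [timed_bind_steps, hb, List.length_cons] at *
        simp only [Bool.false_eq_true, if_false, timed_bind_steps, op_steps]
        nlinarith

lemma mergePairs_perm (L : List (List α)) : (mergePairs le L).val.flatten.Perm L.flatten := by
  induction L using mergePairs.induct with
  | case1 => simp [mergePairs]
  | case2 a => simp [mergePairs]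
  | case3 a b rest ih =>
    simp only [mergePairs, timed_bind_val, op_val, List.flatten_cons, merge_val]
    rw [← List.append_assoc]
    exact (List.merge_perm_append _).append ih

lemma mergePairs_length (L : List (List α)) : (mergePairs le L).val.length = (L.length + 1) / 2 := by
  induction L using mergePairs.induct with
  | case1 => simp [mergePairs]
  | case2 a => simp [mergePairs]
  | case3 a b rest ih =>
    simp only [mergePairs, timed_bind_val, op_val, List.length_cons, ih]
    omega

lemma mergePairs_sorted
    (htr : ∀ a b c, (le a b).val = true → (le b c).val = true → (le a c).val = true)
    (htot : ∀ a b, ((le a b).val || (le b a).val) = true) (L : List (List α))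
    (h : ∀ l ∈ L, l.Pairwise fun a b => (le a b).val = true) :
    ∀ l ∈ (mergePairs le L).val, l.Pairwise fun a b => (le a b).val = true := by
  induction L using mergePairs.induct with
  | case1 => simp [mergePairs]
  | case2 a => simpa [mergePairs] using h
  | case3 a b rest ih =>
    simp only [mergePairs, timed_bind_val, op_val, List.mem_cons, merge_val, forall_eq_or_imp]
    simp only [List.mem_cons, forall_eq_or_imp] at h
    exact ⟨List.pairwise_merge htr htot _ _ h.1 h.2.1, ih h.2.2⟩

lemma mergePairs_steps (c : ℕ) (hc : ∀ a b, (le a b).steps ≤ c) (L : List (List α)) :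
    (mergePairs le L).steps ≤ (c + 1) * L.flatten.length + 2 * L.length + 1 := by
  induction L using mergePairs.induct with
  | case1 => simp [mergePairs]
  | case2 a => simp [mergePairs]
  | case3 a b rest ih =>
    have := merge_steps le c hc a b
    simp only [mergePairs, timed_bind_steps, op_steps, List.flatten_cons, List.length_append,
      List.length_cons] at *
    nlinarith

/-- A round on at least two lists strictly lowers their number, so fuel equal to the number of lists
never runs out. -/
lemma mergeRounds_perm (n : ℕ) (L : List (List α)) (h : L.length ≤ n) :
    (mergeRounds le n L).val.Perm L.flatten := by
  induction n generalizing L with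
  | zero =>
    have : L = [] := by simpa using h
    simp [this, mergeRounds]
  | succ n ih =>
    match L with
    | [] => simp [mergeRounds]
    | [a] => simp [mergeRounds]
    | a :: b :: rest =>
      simp only [mergeRounds, timed_bind_val]
      refine (ih _ ?_).trans (mergePairs_perm le _)
      rw [mergePairs_length]
      simp only [List.length_cons] at h ⊢
      omega

lemma mergeRounds_sorted
    (htr : ∀ a b c, (le a b).val = true → (le b c).val = true → (le a c).val = true)
    (htot : ∀ a b, ((le a b).val || (le b a).val) = true) (n : ℕ) (L : List (List α))
    (h : ∀ l ∈ L, l.Pairwise fun a b => (le a b).val = true) :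
    (mergeRounds le n L).val.Pairwise fun a b => (le a b).val = true := by
  induction n generalizing L with
  | zero => simp [mergeRounds]
  | succ n ih =>
    match L with
    | [] => simp [mergeRounds]
    | [a] => simpa [mergeRounds] using h
    | a :: b :: rest =>
      simp only [mergeRounds, timed_bind_val]
      exact ih _ (mergePairs_sorted le htr htot _ h)

/-- Each round halves the number of lists, so there are at most r of them whatever the fuel n is; a
round costs time linear in m. -/
lemma mergeRounds_steps (c : ℕ) (hc : ∀ a b, (le a b).steps ≤ c) (n m r : ℕ) (L : List (List α))
    (hm : L.flatten.length ≤ m) (hm' : L.length ≤ m) (hr : L.length ≤ 2 ^ r) :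
    (mergeRounds le n L).steps ≤ ((c + 3) * m + 1) * r + 1 := by
  induction n generalizing L r with
  | zero => simp [mergeRounds]
  | succ n ih =>
    match L with
    | [] => simp [mergeRounds]
    | [a] => simp [mergeRounds]
    | a :: b :: rest =>
      obtain _ | r := r
      · simp at hr
      have h1 := mergePairs_steps le c hc (a :: b :: rest)
      have h2 := (mergePairs_perm le (a :: b :: rest)).length_eq
      have h3 := mergePairs_length le (a :: b :: rest)
      have h4 := ih r (mergePairs le (a :: b :: rest)).val (h2.trans_le hm) (by omega)
        (by rw [pow_succ] at hr; omega)
      have h5 : (c + 1) * (a :: b :: rest).flatten.length ≤ (c + 1) * m := Nat.mul_le_mul_left _ hm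
      simp only [mergeRounds, timed_bind_steps]
      calc _ ≤ ((c + 1) * m + 2 * m + 1) + (((c + 3) * m + 1) * r + 1) := by omega
        _ = _ := by ring

lemma singles_val (xs : List α) :
    (loop xs [] (fun (st : List (List α)) x => op ([x] :: st))).val
      = (xs.map fun x => [x]).reverse := by
  rw [loop_val_of_cons (g := fun x => [x]) (h := fun _ _ _ => rfl), List.append_nil]

lemma mergeSort_perm (xs : List α) : (mergeSort le xs).val.Perm xs := by
  simp only [mergeSort, timed_bind_val, singles_val]
  refine (mergeRounds_perm le _ _ le_rfl).trans ?_
  rw [← List.map_reverse, ← List.flatMap_def, List.flatMap_singleton']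
  exact List.reverse_perm xs

lemma mergeSort_sorted
    (htr : ∀ a b c, (le a b).val = true → (le b c).val = true → (le a c).val = true)
    (htot : ∀ a b, ((le a b).val || (le b a).val) = true) (xs : List α) :
    (mergeSort le xs).val.Pairwise fun a b => (le a b).val = true := by
  simp only [mergeSort, timed_bind_val, singles_val]
  apply mergeRounds_sorted le htr htot
  simp

lemma mergeSort_steps (c : ℕ) (hc : ∀ a b, (le a b).steps ≤ c) (xs : List α) :
    (mergeSort le xs).steps
      ≤ 2 * xs.length + ((c + 3) * xs.length + 1) * Nat.clog 2 xs.length + 1 := by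
  have h1 : (loop xs [] (fun (st : List (List α)) x => op ([x] :: st))).steps ≤ xs.length * 2 :=
    loop_steps_le _ _ _ 1 fun _ _ _ => le_rfl
  have h2 := mergeRounds_steps le c hc (xs.map fun x => [x]).reverse.length xs.length
    (Nat.clog 2 xs.length) (xs.map fun x => [x]).reverse
    (by rw [← List.map_reverse, ← List.flatMap_def, List.flatMap_singleton']; simp) (by simp)
    (by simpa using Nat.le_pow_clog one_lt_two _)
  simp only [mergeSort, timed_bind_steps, singles_val]
  omega

@[simp] lemma takeFirst_val (n : ℕ) (xs : List α) : (takeFirst n xs).val = xs.take n := by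
  induction n generalizing xs with
  | zero => simp [takeFirst]
  | succ n ih => cases xs <;> simp [takeFirst, ih]

lemma takeFirst_steps (n : ℕ) (xs : List α) : (takeFirst n xs).steps ≤ xs.length + 1 := by
  induction n generalizing xs with
  | zero => simp [takeFirst]
  | succ n ih =>
    cases xs with
    | nil => simp [takeFirst]
    | cons a xs => have := ih xs; simp [takeFirst]; omega

end Timed

/-! ### Sampling -/

lemma mapM_loop_sampled {α β : Type} (g : α → Sampled β) (xs : List α) (acc : List β) :
    (List.mapM.loop g xs acc).val = acc.reverse ++ xs.map (fun a => (g a).val) ∧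
    (List.mapM.loop g xs acc).points = xs.flatMap (fun a => (g a).points) := by
  induction xs generalizing acc with
  | nil => simp [List.mapM.loop]
  | cons a xs ih => simp [List.mapM.loop, ih]

lemma sampleArray_val (f : ℝ → ℂ) (m : ℕ) : (sampleArray f m).val
    = (List.range m).map (fun p : ℕ => f (2 * Real.pi * (p : ℝ) / (m : ℝ))) := by
  unfold sampleArray List.mapM
  simp [mapM_loop_sampled, evalAt, ← List.map_eq_flatMap]

lemma sampleArray_points (f : ℝ → ℂ) (m : ℕ) : (sampleArray f m).points.length = m := by
  unfold sampleArray List.mapM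
  simp [mapM_loop_sampled, evalAt]

lemma fastMultiply_points (f : ℝ → ℂ) (ms : List ℕ) :
    (fastMultiply f ms).points.length = ms.sum := by
  induction ms with
  | nil => simp [fastMultiply]
  | cons m ms ih => simp [fastMultiply, sampleArray_points, ih]

/-- Repeated lengths do no harm: an overwritten row is replaced by an identical one. -/
lemma fastMultiply_val (f : ℝ → ℂ) (ms : List ℕ) {m : ℕ} (hm : m ∈ ms) :
    (fastMultiply f ms).val m = dft m (sampleArray f m).val := by
  induction ms with
  | nil => simp at hm
  | cons m' ms ih =>
    simp only [fastMultiply, sampled_bind_val, sampled_pure_val]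
    by_cases h : m = m'
    · subst h; simp
    · rw [Function.update_of_ne h]
      exact ih (by simpa [h] using hm)

/-! ### Aliasing -/

/-- The periodic lift of `f` is continuous on the circle, and summable Fourier coefficients make its
series converge pointwise. The point is kept in the half-open period because `f` is arbitrary
elsewhere and need not agree with the lift there. -/
lemma hasSum_fhat (f : ℝ → ℂ) (hf : ContinuousOn f (Set.Icc 0 (2 * Real.pi)))
    (hper : f 0 = f (2 * Real.pi)) (hsum : Summable fun ω : ℤ => ‖fhat f ω‖) {x : ℝ}
    (hx : x ∈ Set.Ico 0 (2 * Real.pi)) :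
    HasSum (fun n : ℤ => fhat f n * Complex.exp (Complex.I * n * x)) (f x) := by
  have : Fact (0 < 2 * Real.pi) := ⟨Real.two_pi_pos⟩
  have hpi : (Real.pi : ℂ) ≠ 0 := by exact_mod_cast Real.pi_ne_zero
  have hcont := AddCircle.liftIco_zero_continuous hper hf
  set F : C(AddCircle (2 * Real.pi), ℂ) := ⟨_, hcont⟩ with hF
  have hco : ∀ n : ℤ, fourierCoeff F n = fhat f n := by
    intro n
    have h1 := fourierCoeff_liftIco_eq (T := 2 * Real.pi) (a := 0) f n
    rw [hF]
    simp only [ContinuousMap.coe_mk]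
    rw [h1, fourierCoeffOn_eq_integral, fhat]
    simp only [zero_add, sub_zero]
    rw [Complex.real_smul]
    congr 1
    · push_cast; ring
    · refine intervalIntegral.integral_congr fun y _ => ?_
      simp only [fourier_coe_apply, smul_eq_mul]
      congr 2
      push_cast
      field_simp
      ring
  have hs : Summable (fourierCoeff F) := by
    rw [funext hco]
    exact hsum.of_norm
  have h2 := has_pointwise_sum_fourier_series_of_summable hs (x : AddCircle (2 * Real.pi))
  have h3 : F (x : AddCircle (2 * Real.pi)) = f x := by
    rw [hF]
    exact AddCircle.liftIco_coe_apply (by simpa using hx)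
  rw [h3] at h2
  convert h2 using 2 with n
  rw [hco, smul_eq_mul, fourier_coe_apply]
  congr 2
  push_cast
  field_simp

lemma sum_exp_eq (m : ℕ) (hm : 0 < m) (d : ℤ) :
    ∑ p ∈ Finset.range m, Complex.exp (2 * Real.pi * Complex.I * d / m) ^ p
      = if (m : ℤ) ∣ d then (m : ℂ) else 0 := by
  have hm' : (m : ℂ) ≠ 0 := by exact_mod_cast hm.ne'
  have hpi : (Real.pi : ℂ) ≠ 0 := by exact_mod_cast Real.pi_ne_zero
  have h1 : Complex.exp (2 * Real.pi * Complex.I * d / m) ^ m = 1 := by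
    rw [← Complex.exp_nat_mul, Complex.exp_eq_one_iff]
    exact ⟨d, by field_simp⟩
  have h2 : Complex.exp (2 * Real.pi * Complex.I * d / m) = 1 ↔ (m : ℤ) ∣ d := by
    rw [Complex.exp_eq_one_iff]
    constructor
    · rintro ⟨c, hc⟩
      refine ⟨c, ?_⟩
      have h3 : (d : ℂ) = m * c := by
        have h4 : (2 * Real.pi * Complex.I) * d = (2 * Real.pi * Complex.I) * (m * c) := by
          field_simp at hc
          linear_combination (2 * Real.pi * Complex.I) * hc
        exact mul_left_cancel₀ Complex.two_pi_I_ne_zero h4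
      exact_mod_cast h3
    · rintro ⟨c, rfl⟩
      exact ⟨c, by push_cast; field_simp⟩
  split_ifs with h
  · rw [h2.2 h]; simp
  · rw [geom_sum_eq (mt h2.1 h), h1]; simp

/-- The discrete Fourier transform of equispaced samples sums the Fourier coefficients over
residue classes. -/
lemma hasSum_dft_sampleArray (f : ℝ → ℂ) (hf : ContinuousOn f (Set.Icc 0 (2 * Real.pi)))
    (hper : f 0 = f (2 * Real.pi)) (hsum : Summable fun ω : ℤ => ‖fhat f ω‖) (m : ℕ) (hm : 0 < m)
    (h : ℕ) :
    HasSum (fun n : ℤ => if (m : ℤ) ∣ n - h then fhat f n else 0)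
      (dft m (sampleArray f m).val h) := by
  have hm' : (m : ℂ) ≠ 0 := by exact_mod_cast hm.ne'
  have hmr : (0 : ℝ) < m := by exact_mod_cast hm
  have key : ∀ p ∈ Finset.range m, HasSum (fun n : ℤ => fhat f n *
      Complex.exp (2 * Real.pi * Complex.I * ((n - h : ℤ) : ℂ) / m) ^ p)
      ((sampleArray f m).val.getD p 0 *
        Complex.exp (-2 * (Real.pi : ℂ) * Complex.I * (h : ℂ) * (p : ℂ) / (m : ℂ))) := by
    intro p hp
    have hp' := Finset.mem_range.1 hp
    have hpr : (p : ℝ) < m := by exact_mod_cast hp'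
    have hx : 2 * Real.pi * (p : ℝ) / (m : ℝ) ∈ Set.Ico 0 (2 * Real.pi) := by
      refine ⟨by positivity, ?_⟩
      rw [div_lt_iff₀ hmr]
      exact mul_lt_mul_of_pos_left hpr Real.two_pi_pos
    have h1 := (hasSum_fhat f hf hper hsum hx).mul_right
      (Complex.exp (-2 * (Real.pi : ℂ) * Complex.I * (h : ℂ) * (p : ℂ) / (m : ℂ)))
    have h2 : (sampleArray f m).val.getD p 0 = f (2 * Real.pi * (p : ℝ) / (m : ℝ)) := by
      rw [sampleArray_val]
      simp [List.getD_eq_getElem?_getD, hp']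
    rw [h2]
    refine h1.congr_fun fun n => ?_
    rw [mul_assoc (fhat f n), ← Complex.exp_add, ← Complex.exp_nat_mul]
    congr 2
    push_cast
    field_simp
    ring
  -- Exchanging the finite sum over sample points with the Fourier series leaves, for each n, a
  -- geometric sum of m-th roots of unity, which vanishes unless m divides n - h.
  have h3 := (hasSum_sum key).mul_left (1 / (m : ℂ))
  refine h3.congr_fun fun n => ?_
  rw [← Finset.mul_sum, sum_exp_eq m hm]
  split_ifs <;> simp [field]

/-! ### Reconstruction of a frequency -/

/-- The `ℓ¹` mass that shares the residue class of `ω` modulo `s` with `ω`. -/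
noncomputable def tail (a : ℤ → ℂ) (s : ℕ) (ω : ℤ) : ℝ :=
  ∑' n : ℤ, if (s : ℤ) ∣ n - ω ∧ n ≠ ω then ‖a n‖ else 0

/-- The table `G m` holds the sums of `a` over the residue classes modulo `m`. -/
def IsTable (a : ℤ → ℂ) (G : ℕ → ℕ → ℂ) (m : ℕ) : Prop :=
  ∀ h : ℕ, HasSum (fun n : ℤ => if (m : ℤ) ∣ n - h then a n else 0) (G m h)

lemma summable_tail {a : ℤ → ℂ} (ha : Summable fun n => ‖a n‖) (s : ℕ) (ω : ℤ) :
    Summable fun n : ℤ => if (s : ℤ) ∣ n - ω ∧ n ≠ ω then ‖a n‖ else 0 := by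
  refine ha.of_nonneg_of_le (fun n => ?_) fun n => ?_ <;> split_ifs <;> simp

lemma norm_sub_le_tail {a u : ℤ → ℂ} {U : ℂ} (ha : Summable fun n => ‖a n‖) {s : ℕ} {ω : ℤ}
    (hu : HasSum u U) (h : ∀ n, n ≠ ω → u n ≠ 0 → (s : ℤ) ∣ n - ω ∧ ‖u n‖ ≤ ‖a n‖) :
    ‖U - u ω‖ ≤ tail a s ω := by
  have h1 := hu.update ω 0
  rw [zero_sub, neg_add_eq_sub] at h1
  refine h1.norm_le_of_bounded (summable_tail ha s ω).hasSum fun n => ?_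
  by_cases hn : n = ω
  · subst hn; simp
  · rw [Function.update_of_ne hn]
    by_cases h0 : u n = 0
    · rw [h0, norm_zero]; split_ifs <;> simp
    · rw [if_pos ⟨(h n hn h0).1, hn⟩]
      exact (h n hn h0).2

lemma IsTable.norm_sub_le {a : ℤ → ℂ} {G : ℕ → ℕ → ℂ} {m s h : ℕ} {ω : ℤ}
    (ha : Summable fun n => ‖a n‖) (hG : IsTable a G m) (hs : s ∣ m) (hω : (m : ℤ) ∣ ω - h) :
    ‖G m h - a ω‖ ≤ tail a s ω := by
  have h1 := norm_sub_le_tail (s := s) (ω := ω) ha (hG h) fun n _ hn0 => by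
    have hd : (m : ℤ) ∣ n - h := by
      by_contra hd
      simp [hd] at hn0
    refine ⟨(Int.natCast_dvd_natCast.2 hs).trans ?_, by simp [hd]⟩
    have := dvd_sub hd hω
    simpa using this
  simpa [hω] using h1

/-- The class q mod m lies inside the class h mod s, so the difference of the two entries is the sum
of `a` over the part of the large class outside the small one. Treating it as one sum costs a single
`tail` instead of two; this is why 2 `tail` < |a ω| suffices for identification. -/
lemma IsTable.norm_sub_le_of_dvd {a : ℤ → ℂ} {G : ℕ → ℕ → ℂ} {m s h q : ℕ} {ω : ℤ}
    (ha : Summable fun n => ‖a n‖) (hGs : IsTable a G s) (hG : IsTable a G m)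
    (hs : s ∣ m) (hω : (s : ℤ) ∣ ω - h) (hq : (s : ℤ) ∣ q - h) :
    ‖(G s h - G m q) - (if (m : ℤ) ∣ ω - q then 0 else a ω)‖ ≤ tail a s ω := by
  have hs' := Int.natCast_dvd_natCast.2 hs
  have h2 : ∀ n : ℤ, (m : ℤ) ∣ n - q → (s : ℤ) ∣ n - h := fun n hn => by
    have := dvd_add (hs'.trans hn) hq
    simpa using this
  have h1 := norm_sub_le_tail (s := s) (ω := ω) ha ((hGs h).sub (hG q)) fun n _ hn0 => by
    have hd : (s : ℤ) ∣ n - h := by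
      by_contra hd
      have : ¬ (m : ℤ) ∣ n - q := mt (h2 n) hd
      simp [hd, this] at hn0
    refine ⟨by simpa using dvd_sub hd hω, ?_⟩
    by_cases h3 : (m : ℤ) ∣ n - q <;> simp [hd, h3]
  by_cases h3 : (m : ℤ) ∣ ω - q <;> simpa [hω, h3] using h1

/-- The body is known only through its value, so the induction does not have to look into the loop
of `argMin`. -/
lemma argMin_loop (d : ℕ → ℝ) (xs : List ℕ) (body : ℕ × ℝ → ℕ → Timed (ℕ × ℝ))
    (hb : ∀ st b, (body st b).val = if d b < st.2 then (b, d b) else st) (st : ℕ × ℝ)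
    (h0 : st.2 = d st.1) :
    ((loop xs st body).val.1 = st.1 ∨ (loop xs st body).val.1 ∈ xs) ∧
    d (loop xs st body).val.1 ≤ d st.1 ∧ ∀ b ∈ xs, d (loop xs st body).val.1 ≤ d b := by
  induction xs generalizing st with
  | nil => simp
  | cons c xs ih =>
    rw [loop_cons_val, hb]
    split_ifs with hc
    · obtain ⟨h1, h2, h3⟩ := ih (c, d c) rfl
      refine ⟨Or.inr ?_, h2.trans (by rw [← h0]; exact hc.le), ?_⟩
      · rcases h1 with h1 | h1
        · rw [h1]; simp
        · simp [h1]
      · simpa using ⟨h2, h3⟩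
    · obtain ⟨h1, h2, h3⟩ := ih st h0
      refine ⟨h1.imp_right fun h => by simp [h], h2, ?_⟩
      simp only [List.mem_cons, forall_eq_or_imp]
      exact ⟨h2.trans (by rw [← h0]; exact not_lt.1 hc), h3⟩

lemma argMin_val_eq (G : ℕ → ℕ → ℂ) {s h τ b₀ : ℕ} (hb₀ : b₀ < τ)
    (hmin : ∀ b < τ, b ≠ b₀ →
      ‖G s h - G (τ * s) (h + b₀ * s)‖ < ‖G s h - G (τ * s) (h + b * s)‖) :
    (argMin G s h τ).val = b₀ := by
  have h1 := argMin_loop (fun b => ‖G s h - G (τ * s) (h + b * s)‖ ^ 2) (List.range τ)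
    (fun st b => do
      let p ← op (b * s)
      let q ← op (h + p)
      let g ← op (G (τ * s) q)
      let d ← op (G s h - g)
      let v ← absSq d
      let c ← op (decide (v < st.2))
      if c then op (b, v) else pure st)
    (fun st b => by
      simp only [timed_bind_val, op_val, absSq_val, decide_eq_true_eq]
      split_ifs <;> rfl) (0, ‖G s h - G (τ * s) h‖ ^ 2) (by simp)
  simp only [argMin, timed_bind_val, op_val, absSq_val, timed_pure_val] at h1 ⊢
  obtain ⟨h1, h2, h3⟩ := h1
  by_contra hne
  have h4 := h3 b₀ (by simpa using hb₀)
  refine absurd h4 (not_le.2 (pow_lt_pow_left₀ (hmin _ ?_ hne) (norm_nonneg _) two_ne_zero))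
  -- The loop may also return its initial index 0, which is a legitimate index because b₀ < τ.
  rcases h1 with h1 | h1
  · rw [h1]; omega
  · simpa using h1

lemma residues_val (G : ℕ → ℕ → ℂ) (t : List ℕ) (s h : ℕ) : (residues G t s h).val
    = (t.map fun τ => (τ, (h + (argMin G s h τ).val * s) % τ)).reverse := by
  unfold residues
  rw [loop_val_of_cons (g := fun τ => (τ, (h + (argMin G s h τ).val * s) % τ)), List.append_nil]
  intro st a _
  rfl

lemma chinese_search (x M τ a : ℕ) (xs : List ℕ) (z : ℕ) (body : ℕ → ℕ → Timed ℕ)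
    (hb : ∀ z y, (body z y).val = if (x + y * M) % τ = a then x + y * M else z) :
    ((loop xs z body).val = z ∧ ∀ y ∈ xs, (x + y * M) % τ ≠ a) ∨
      ∃ y ∈ xs, (x + y * M) % τ = a ∧ (loop xs z body).val = x + y * M := by
  induction xs generalizing z with
  | nil => simp
  | cons c xs ih =>
    rw [loop_cons_val, hb]
    split_ifs with hc
    · rcases ih (x + c * M) with ⟨h1, -⟩ | ⟨y, hy, h1⟩
      · exact Or.inr ⟨c, by simp, hc, h1⟩
      · exact Or.inr ⟨y, by simp [hy], h1⟩
    · rcases ih z with ⟨h1, h2⟩ | ⟨y, hy, h1⟩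
      · exact Or.inl ⟨h1, by simpa using ⟨hc, h2⟩⟩
      · exact Or.inr ⟨y, by simp [hy], h1⟩

lemma chinese_step (st c : ℕ × ℕ) : ∃ z, ((do
      let z ← loop (List.range c.1) st.1 (fun z y => do
        let p ← op (y * st.2)
        let q ← op (st.1 + p)
        let r ← op (q % c.1)
        let e ← op (decide (r = c.2))
        if e then op q else pure z)
      let M ← op (st.2 * c.1)
      op (z, M)) : Timed (ℕ × ℕ)).val = (z, st.2 * c.1) ∧
    ((z = st.1 ∧ ∀ y < c.1, (st.1 + y * st.2) % c.1 ≠ c.2) ∨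
      ∃ y < c.1, (st.1 + y * st.2) % c.1 = c.2 ∧ z = st.1 + y * st.2) := by
  refine ⟨_, rfl, ?_⟩
  have := chinese_search st.1 st.2 c.1 c.2 (List.range c.1) st.1 (fun z y => do
        let p ← op (y * st.2)
        let q ← op (st.1 + p)
        let r ← op (q % c.1)
        let e ← op (decide (r = c.2))
        if e then op q else pure z) (fun z y => by
      simp)
  simpa using this

/-- This needs no compatibility of the residues, so it also covers reconstructions from meaningless
minimizers; it is what keeps their output inside the band. -/
lemma chinese_lt (h s : ℕ) (cs : List (ℕ × ℕ)) (hs : h < s) (hc : ∀ c ∈ cs, 0 < c.1) :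
    (chinese h s cs).val.1 < (chinese h s cs).val.2 := by
  unfold chinese
  refine loop_induction _ _ _ (fun st : ℕ × ℕ => st.1 < st.2) hs fun st hst c hcm => ?_
  obtain ⟨z, h1, h2⟩ := chinese_step st c
  rw [h1]
  have h0 := hc c hcm
  rcases h2 with ⟨rfl, -⟩ | ⟨y, hy, -, rfl⟩
  · exact hst.trans_le (Nat.le_mul_of_pos_right _ h0)
  · calc st.1 + y * st.2 < st.2 + y * st.2 := by omega
      _ = st.2 * (y + 1) := by ring
      _ ≤ _ := Nat.mul_le_mul_left _ hy

/-- The invariant is that the state (x, M) satisfies x = ω mod M. Any successful y gives a number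
below sτ that is congruent to ω mod s and mod τ, hence equals ω mod sτ. -/
lemma chinese_val (ω : ℤ) (h s : ℕ) (cs : List (ℕ × ℕ)) (hs : 0 < s) (hh : (h : ℤ) = ω % s)
    (hc : ∀ c ∈ cs, 0 < c.1 ∧ (c.2 : ℤ) = ω % c.1 ∧ Nat.Coprime c.1 s)
    (hcop : cs.Pairwise fun c c' => Nat.Coprime c.1 c'.1) :
    (chinese h s cs).val.2 = s * (cs.map Prod.fst).prod ∧
    ((chinese h s cs).val.1 : ℤ) = ω % ((chinese h s cs).val.2 : ℤ) := by
  unfold chinese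
  induction cs generalizing h s with
  | nil => simpa using hh
  | cons c cs ih =>
    obtain ⟨z, h1, h2⟩ := chinese_step (h, s) c
    simp only [List.mem_cons, forall_eq_or_imp, List.pairwise_cons] at hc hcop
    obtain ⟨⟨hc0, hc1, hc2⟩, hc'⟩ := hc
    rw [loop_cons_val, h1]
    dsimp only at h2 ⊢
    have hlt : h < s := by
      have := Int.emod_lt_of_pos ω (show (0 : ℤ) < s by exact_mod_cast hs)
      omega
    have hz : (z : ℤ) = ω % ((s * c.1 : ℕ) : ℤ) := by
      have key : ∀ y < c.1, (h + y * s) % c.1 = c.2 →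
          ((h + y * s : ℕ) : ℤ) = ω % ((s * c.1 : ℕ) : ℤ) := by
        intro y hy hy'
        have e1 : (h + y * s : ℕ) ≡ ω [ZMOD s] := by
          unfold Int.ModEq
          push_cast
          rw [Int.add_mul_emod_self_right, hh, Int.emod_emod]
        have e2 : (h + y * s : ℕ) ≡ ω [ZMOD c.1] := by
          unfold Int.ModEq
          rw [← hc1, ← hy', Int.natCast_mod]
        have e3 := (Int.modEq_and_modEq_iff_modEq_mul (by simpa using hc2.symm)).1 ⟨e1, e2⟩
        unfold Int.ModEq at e3
        rw [Nat.cast_mul, ← e3, Int.emod_eq_of_lt (by positivity)]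
        have : h + y * s < s * c.1 := by
          calc h + y * s < s + y * s := by omega
            _ = s * (y + 1) := by ring
            _ ≤ _ := Nat.mul_le_mul_left _ hy
        exact_mod_cast this
      rcases h2 with ⟨-, h2⟩ | ⟨y, hy, hy', rfl⟩
      -- The search cannot fail: for X = ω mod sτ, the quotient X / s is a solution in the searched
      -- range.
      · exfalso
        have hM : (0 : ℤ) < ((s * c.1 : ℕ) : ℤ) := by exact_mod_cast Nat.mul_pos hs hc0
        obtain ⟨X, hX⟩ := Int.eq_ofNat_of_zero_le (Int.emod_nonneg ω hM.ne')
        have hXlt : X < s * c.1 := by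
          have := Int.emod_lt_of_pos ω hM
          omega
        have hXs : X % s = h := by
          have : ((X % s : ℕ) : ℤ) = h := by
            rw [Int.natCast_mod, ← hX, hh]
            exact Int.emod_emod_of_dvd _ (by push_cast; exact dvd_mul_right _ _)
          exact_mod_cast this
        have hXc : X % c.1 = c.2 := by
          have : ((X % c.1 : ℕ) : ℤ) = c.2 := by
            rw [Int.natCast_mod, ← hX, hc1]
            exact Int.emod_emod_of_dvd _ (by push_cast; exact dvd_mul_left _ _)
          exact_mod_cast this
        refine h2 (X / s) (Nat.div_lt_of_lt_mul hXlt) ?_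
        rw [← hXs, mul_comm, Nat.mod_add_div, hXc]
      · exact key y hy hy'
    obtain ⟨h3, h4⟩ := ih z (s * c.1) (Nat.mul_pos hs hc0) hz
      (fun c' hc'' => ⟨(hc' c' hc'').1, (hc' c' hc'').2.1, Nat.Coprime.mul_right (hc' c' hc'').2.2
        (hcop.1 c' hc'').symm⟩) hcop.2
    refine ⟨?_, h4⟩
    rw [h3, List.map_cons, List.prod_cons, mul_assoc]

lemma toBand_val (N x M : ℕ) : (toBand N x M).val
    = if x ≤ N / 2 then some (x : ℤ) else
      if -((N - N / 2 : ℕ) : ℤ) < (x : ℤ) - M then some ((x : ℤ) - M) else none := by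
  simp only [toBand, op_bind_val, op_val, timed_ite_val, decide_eq_true_eq]

lemma mem_band_of_toBand {N x M : ℕ} (hN : 0 < N) (hx : x < M) {ω : ℤ} (h : (toBand N x M).val = some ω) :
    ω ∈ band N := by
  rw [toBand_val] at h
  unfold band
  rw [Finset.mem_Ioc]
  split_ifs at h with h1 h2
  · simp only [Option.some.injEq] at h; omega
  · simp only [Option.some.injEq] at h; omega

/-- The band has N ≤ M consecutive elements, so it meets a class mod M at most once: at x if ω ≥ 0
and at x - M if ω < 0. -/
lemma toBand_eq {N x M : ℕ} (hN : N ≤ M) {ω : ℤ} (hω : ω ∈ band N) (hx : (x : ℤ) = ω % M) :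
    (toBand N x M).val = some ω := by
  rw [toBand_val]
  unfold band at hω
  rw [Finset.mem_Ioc] at hω
  by_cases h0 : 0 ≤ ω
  · rw [Int.emod_eq_of_lt h0 (by omega)] at hx
    rw [if_pos (by omega), hx]
  · have h1 : ω % M = ω + M := by
      rw [← Int.add_emod_right, Int.emod_eq_of_lt (by omega) (by omega)]
    rw [h1] at hx
    rw [if_neg (by omega), if_pos (by omega)]
    congr 1
    omega

lemma mem_band_of_reconstruct {G : ℕ → ℕ → ℂ} {N s h : ℕ} {t : List ℕ} (hN : 0 < N)
    (ht : ∀ τ ∈ t, 0 < τ)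
    (hs : h < s) {ω : ℤ} (hω : (reconstruct G N t s h).val = some ω) : ω ∈ band N := by
  simp only [reconstruct, timed_bind_val] at hω
  refine mem_band_of_toBand hN (chinese_lt h s _ hs fun c hc => ?_) hω
  rw [residues_val] at hc
  simp only [List.mem_reverse, List.mem_map] at hc
  obtain ⟨τ, hτ, rfl⟩ := hc
  exact ht τ hτ

/-- For the class of ω mod τs the term a ω cancels and the discrepancy is at most `tail`; for any
other candidate a ω survives and the discrepancy is at least |a ω| - `tail`, which is larger. So the
minimizer is unique. -/
lemma argMin_class {a : ℤ → ℂ} {G : ℕ → ℕ → ℂ} {s h τ : ℕ} {ω : ℤ}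
    (ha : Summable fun n => ‖a n‖) (hs : 0 < s) (hτ : 0 < τ) (hGs : IsTable a G s)
    (hG : IsTable a G (τ * s)) (hh : (h : ℤ) = ω % s) (hbig : 2 * tail a s ω < ‖a ω‖) :
    (((h + (argMin G s h τ).val * s) % τ : ℕ) : ℤ) = ω % τ := by
  have hM : (0 : ℤ) < ((τ * s : ℕ) : ℤ) := by exact_mod_cast Nat.mul_pos hτ hs
  obtain ⟨X, hX⟩ := Int.eq_ofNat_of_zero_le (Int.emod_nonneg ω hM.ne')
  have hXlt : X < s * τ := by
    have := Int.emod_lt_of_pos ω hM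
    rw [mul_comm s τ]
    omega
  have hXs : X % s = h := by
    have : ((X % s : ℕ) : ℤ) = h := by
      rw [Int.natCast_mod, ← hX, hh]
      exact Int.emod_emod_of_dvd _ (by push_cast; exact dvd_mul_left _ _)
    exact_mod_cast this
  have hXe : h + X / s * s = X := by rw [← hXs, mul_comm, Nat.mod_add_div]
  have hωh : (s : ℤ) ∣ ω - h := by rw [hh]; exact Int.dvd_self_sub_emod
  have hωX : ((τ * s : ℕ) : ℤ) ∣ ω - X := by rw [← hX]; exact Int.dvd_self_sub_emod
  have hcl : ∀ b : ℕ, (s : ℤ) ∣ ((h + b * s : ℕ) : ℤ) - h := fun b => by simp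
  rw [argMin_val_eq G (b₀ := X / s) (Nat.div_lt_of_lt_mul hXlt), hXe, Int.natCast_mod, ← hX]
  · exact Int.emod_emod_of_dvd _ (by push_cast; exact dvd_mul_right _ _)
  · intro b hb hne
    have h1 := hGs.norm_sub_le_of_dvd ha hG (dvd_mul_left s τ) hωh (hcl (X / s))
    have h2 := hGs.norm_sub_le_of_dvd ha hG (dvd_mul_left s τ) hωh (hcl b)
    rw [if_pos (by rw [hXe]; exact hωX), sub_zero] at h1
    rw [if_neg] at h2
    · have h3 := norm_sub_norm_le (a ω) (a ω - (G s h - G (τ * s) (h + b * s)))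
      rw [norm_sub_rev (a ω) (G s h - _), sub_sub_cancel] at h3
      linarith
    -- A second b in the class of ω would make τ divide b - X / s, although both numbers lie in [0,
    -- τ).
    · intro hd
      apply hne
      have h4 := dvd_sub hωX hd
      have h5 : ((h + b * s : ℕ) : ℤ) - X = ((b : ℤ) - (X / s : ℕ)) * s := by
        conv_lhs => rw [← hXe]
        push_cast
        ring
      rw [sub_sub_sub_cancel_left, h5, Nat.cast_mul] at h4
      have h6 := Int.dvd_of_mul_dvd_mul_right (by exact_mod_cast hs.ne') h4
      have h7 : X / s < τ := Nat.div_lt_of_lt_mul hXlt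
      have h9 : (0 : ℤ) ≤ (X : ℤ) / s := by positivity
      have h8 := Int.eq_zero_of_abs_lt_dvd h6 (by rw [abs_lt]; constructor <;> omega)
      omega

/-- A frequency with a large coefficient is reconstructed from its residue class modulo `s`. -/
lemma reconstruct_eq {a : ℤ → ℂ} {G : ℕ → ℕ → ℂ} {N s h : ℕ} {t : List ℕ} {ω : ℤ}
    (ha : Summable fun n => ‖a n‖) (hs : 0 < s) (hGs : IsTable a G s)
    (ht : ∀ τ ∈ t, 0 < τ ∧ Nat.Coprime τ s ∧ IsTable a G (τ * s)) (hcop : t.Pairwise Nat.Coprime)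
    (hN : N ≤ s * t.prod) (hω : ω ∈ band N) (hh : (h : ℤ) = ω % s)
    (hbig : 2 * tail a s ω < ‖a ω‖) : (reconstruct G N t s h).val = some ω := by
  simp only [reconstruct, timed_bind_val, residues_val]
  obtain ⟨h1, h2⟩ := chinese_val ω h s
    (t.map fun τ => (τ, (h + (argMin G s h τ).val * s) % τ)).reverse hs hh (fun c hc => by
      simp only [List.mem_reverse, List.mem_map] at hc
      obtain ⟨τ, hτ, rfl⟩ := hc
      exact ⟨(ht τ hτ).1, argMin_class ha hs (ht τ hτ).1 hGs (ht τ hτ).2.2 hh hbig,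
        (ht τ hτ).2.1⟩) (by
      rw [List.pairwise_reverse, List.pairwise_map]
      exact hcop.imp fun h => h.symm)
  refine toBand_eq ?_ hω h2
  rw [h1, List.map_reverse, List.prod_reverse, List.map_map]
  simpa [Function.comp_def] using hN

lemma list_sum_flatMap {α : Type} (xs : List α) (g : α → List ℕ) :
    (xs.flatMap g).sum = (xs.map fun a => (g a).sum).sum := by
  induction xs with
  | nil => rfl
  | cons a xs ih => simp [ih]

/-! ### Identification -/

/-- Record the outcome of one reconstruction, with multiplicity `w`. -/
def record (st : (ℤ → ℕ) × List ℤ) (p : ℕ × Option ℤ) : (ℤ → ℕ) × List ℤ :=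
  match p.2 with
  | none => st
  | some ω => (Function.update st.1 ω (st.1 ω + p.1), ω :: st.2)

/-- The outcomes of all reconstructions, with their multiplicities. -/
noncomputable def outcomes (G : ℕ → ℕ → ℂ) (N : ℕ) (t : List ℕ) (S : List (ℕ × ℕ)) : List (ℕ × Option ℤ) :=
  S.flatMap fun sw => (List.range sw.1).map fun h => (sw.2, (reconstruct G N t sw.1 h).val)

lemma identify_val (G : ℕ → ℕ → ℂ) (N : ℕ) (t : List ℕ) (S : List (ℕ × ℕ)) :
    (identify G N t S).val = (outcomes G N t S).foldl record (fun _ => 0, []) := by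
  unfold identify outcomes
  rw [loop_val, List.foldl_flatMap]
  congr 1
  funext st sw
  rw [loop_val, List.foldl_map]
  congr 1
  funext st h
  rw [timed_bind_val]
  cases (reconstruct G N t sw.1 h).val <;> rfl

lemma foldl_record (L : List (ℕ × Option ℤ)) (st : (ℤ → ℕ) × List ℤ) :
    (∀ ω, (L.foldl record st).1 ω
      = st.1 ω + (L.map fun p => if p.2 = some ω then p.1 else 0).sum) ∧
    (L.foldl record st).2 = (L.filterMap Prod.snd).reverse ++ st.2 := by
  induction L generalizing st with
  | nil => simp
  | cons p L ih =>
    obtain ⟨h1, h2⟩ := ih (record st p)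
    rw [List.foldl_cons]
    refine ⟨fun ω => ?_, ?_⟩
    · rw [h1, List.map_cons, List.sum_cons, ← add_assoc]
      congr 1
      obtain ⟨w, _ | ω'⟩ := p
      · simp [record]
      · by_cases h : ω' = ω
        · subst h; simp [record]
        · simp [record, h, Function.update_of_ne (Ne.symm h)]
    · rw [h2]
      obtain ⟨w, _ | ω'⟩ := p <;> simp [record]

lemma identify_count (G : ℕ → ℕ → ℂ) (N : ℕ) (t : List ℕ) (S : List (ℕ × ℕ)) (ω : ℤ) :
    (identify G N t S).val.1 ω
      = ((outcomes G N t S).map fun p => if p.2 = some ω then p.1 else 0).sum := by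
  rw [identify_val, (foldl_record _ _).1, zero_add]

lemma identify_list (G : ℕ → ℕ → ℂ) (N : ℕ) (t : List ℕ) (S : List (ℕ × ℕ)) :
    (identify G N t S).val.2 = ((outcomes G N t S).filterMap Prod.snd).reverse := by
  rw [identify_val, (foldl_record _ _).2, List.append_nil]

lemma mem_band_of_identify {G : ℕ → ℕ → ℂ} {N : ℕ} {t : List ℕ} {S : List (ℕ × ℕ)} (hN : 0 < N)
    (ht : ∀ τ ∈ t, 0 < τ) {ω : ℤ} (hω : ω ∈ (identify G N t S).val.2) : ω ∈ band N := by
  rw [identify_list] at hω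
  simp only [List.mem_reverse, List.mem_filterMap, outcomes, List.mem_flatMap, List.mem_map,
    List.mem_range] at hω
  obtain ⟨p, ⟨sw, -, h, hh, rfl⟩, hp⟩ := hω
  exact mem_band_of_reconstruct hN ht hh hp

lemma mem_identify_of_count {G : ℕ → ℕ → ℂ} {N : ℕ} {t : List ℕ} {S : List (ℕ × ℕ)} {ω : ℤ}
    (hω : (identify G N t S).val.1 ω ≠ 0) : ω ∈ (identify G N t S).val.2 := by
  rw [identify_count] at hω
  rw [identify_list, List.mem_reverse, List.mem_filterMap]
  by_contra hcon
  refine hω (List.sum_eq_zero fun x hx => ?_)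
  obtain ⟨p, hp, rfl⟩ := List.mem_map.1 hx
  rw [if_neg fun h => hcon ⟨p, hp, h⟩]

/-- Turns "modulus s is good for ω" into votes: each modulus satisfying `P` contributes its
multiplicity through at least one residue class. -/
lemma le_identify_count {G : ℕ → ℕ → ℂ} {N : ℕ} {t : List ℕ} {S : List (ℕ × ℕ)} {ω : ℤ}
    (P : ℕ → Prop) [DecidablePred P]
    (hP : ∀ sw ∈ S, P sw.1 → ∃ h < sw.1, (reconstruct G N t sw.1 h).val = some ω) :
    (S.map fun sw => if P sw.1 then sw.2 else 0).sum ≤ (identify G N t S).val.1 ω := by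
  rw [identify_count, outcomes, List.map_flatMap, list_sum_flatMap]
  refine List.sum_le_sum fun sw hsw => ?_
  split_ifs with h
  · obtain ⟨b, hb, hb'⟩ := hP sw hsw h
    rw [List.map_map]
    refine List.single_le_sum (by simp) _ (List.mem_map.2 ⟨b, by simpa using hb, ?_⟩)
    simp [hb']
  · exact Nat.zero_le _

lemma identify_list_length (G : ℕ → ℕ → ℂ) (N : ℕ) (t : List ℕ) (S : List (ℕ × ℕ)) :
    (identify G N t S).val.2.length ≤ (S.map Prod.fst).sum := by
  rw [identify_list, List.length_reverse]
  refine (List.length_filterMap_le _ _).trans ?_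
  rw [outcomes, List.length_flatMap]
  simp

/-- Each reconstruction votes for at most one frequency. This bound on the total vote limits how
many frequencies can pass the majority test. -/
lemma sum_identify_count (G : ℕ → ℕ → ℂ) (N : ℕ) (t : List ℕ) (S : List (ℕ × ℕ)) (B : Finset ℤ) :
    ∑ ω ∈ B, (identify G N t S).val.1 ω ≤ (S.map fun sw => sw.1 * sw.2).sum := by
  have h1 : ∀ L : List (ℕ × Option ℤ),
      ∑ ω ∈ B, (L.map fun p => if p.2 = some ω then p.1 else 0).sum ≤ (L.map Prod.fst).sum := by
    intro L
    induction L with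
    | nil => simp
    | cons p L ih =>
      simp only [List.map_cons, List.sum_cons, Finset.sum_add_distrib]
      refine add_le_add ?_ ih
      obtain ⟨w, _ | ω'⟩ := p
      · simp
      · simp only [Option.some.injEq, Finset.sum_ite_eq]
        split_ifs <;> simp
  simp only [identify_count]
  refine (h1 _).trans ?_
  rw [outcomes, List.map_flatMap, list_sum_flatMap]
  refine List.sum_le_sum fun sw _ => ?_
  simp [Function.comp_def]

/-! ### Medians -/

/-- The value is fixed at the first element `z` where the accumulated weight reaches half of the
total, and never changes afterwards. The strict inequality for `pre` and the weak one including `z`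
are what locates the median. -/
lemma median_loop (proj : ℂ → ℝ) (total : ℕ) (body : ℕ × Option ℝ → ℂ × ℕ → Timed (ℕ × Option ℝ))
    (hb : ∀ st z, (body st z).val = if total ≤ 2 * (st.1 + z.2) ∧ st.2 = none
      then (st.1 + z.2, some (proj z.1)) else (st.1 + z.2, st.2))
    (ys : List (ℂ × ℕ)) (acc : ℕ) (h0 : 2 * acc < total)
    (h1 : total ≤ 2 * (acc + (ys.map Prod.snd).sum)) :
    ∃ pre z post, ys = pre ++ z :: post ∧ total ≤ 2 * (acc + (pre.map Prod.snd).sum + z.2) ∧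
      2 * (acc + (pre.map Prod.snd).sum) < total ∧
      (loop ys (acc, none) body).val.2 = some (proj z.1) := by
  induction ys generalizing acc with
  | nil => simp at h1; omega
  | cons y ys ih =>
    rw [loop_cons_val, hb]
    by_cases hc : total ≤ 2 * (acc + y.2)
    · refine ⟨[], y, ys, rfl, by simpa using hc, by simpa using h0, ?_⟩
      rw [if_pos ⟨hc, rfl⟩]
      refine loop_induction _ _ _ (fun st : ℕ × Option ℝ => st.2 = some (proj y.1)) rfl ?_
      intro st hst a _
      rw [hb, if_neg (by simp [hst])]
      exact hst
    · rw [if_neg (by simp [hc])]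
      obtain ⟨pre, z, post, e, e1, e2, e3⟩ := ih (acc + y.2) (by omega) (by
        simp only [List.map_cons, List.sum_cons] at h1
        omega)
      refine ⟨y :: pre, z, post, by simp [e], ?_, ?_, e3⟩ <;>
      · simp only [List.map_cons, List.sum_cons]
        omega

/-- A weighted median lies in every interval that carries more than half of the weight. -/
lemma median_mem_Icc (proj : ℂ → ℝ) (total : ℕ) (xs : List (ℂ × ℕ)) (lo hi : ℝ)
    (htot : (xs.map Prod.snd).sum = total)
    (hbad : 2 * (xs.map fun z => if proj z.1 ∈ Set.Icc lo hi then 0 else z.2).sum < total) :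
    (median proj total xs).val ∈ Set.Icc lo hi := by
  set le : ℂ × ℕ → ℂ × ℕ → Timed Bool := fun a b => op (decide (proj a.1 ≤ proj b.1)) with hle
  have hperm := mergeSort_perm le xs
  have hsort := mergeSort_sorted le
    (fun a b c h1 h2 => by
      simp only [hle, op_val, decide_eq_true_eq] at h1 h2 ⊢
      exact h1.trans h2)
    (fun a b => by
      simp only [hle, op_val, Bool.or_eq_true, decide_eq_true_eq]
      exact le_total _ _) xs
  simp only [hle, op_val, decide_eq_true_eq] at hsort
  simp only [median, timed_bind_val, timed_pure_val]
  generalize (mergeSort le xs).val = ys at hperm hsort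
  have hw := (hperm.map Prod.snd).sum_eq
  have hw' := (hperm.map fun z => if proj z.1 ∈ Set.Icc lo hi then 0 else z.2).sum_eq
  rw [← hw'] at hbad
  rw [htot] at hw
  obtain ⟨pre, z, post, e, e1, e2, e3⟩ := median_loop proj total (fun st zw => do
      let acc ← op (st.1 + zw.2)
      let dbl ← op (2 * acc)
      let c ← op (decide (total ≤ dbl))
      let u ← op st.2.isNone
      if c && u then op (acc, some (proj zw.1)) else pure (acc, st.2))
    (fun st z => by simp) ys 0 (by omega) (by omega)
  rw [e3, Option.getD_some]
  subst e
  rw [List.pairwise_append, List.pairwise_cons] at hsort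
  obtain ⟨-, ⟨hpost, -⟩, hpre⟩ := hsort
  simp only [List.map_append, List.map_cons, List.sum_append, List.sum_cons] at hbad hw
  rw [zero_add] at e1 e2
  by_contra hz
  rw [if_neg hz] at hbad
  -- If the median is below the interval, so is everything sorted before it, and this already
  -- carries half of the weight; if it is above, so is everything after it, and what lies before `z`
  -- has less than half.
  by_cases hlo : proj z.1 < lo
  · have : (pre.map fun z => if proj z.1 ∈ Set.Icc lo hi then 0 else z.2) = pre.map Prod.snd := by
      refine List.map_congr_left fun y hy => ?_
      have := hpre y hy z (by simp)
      rw [if_neg fun h => absurd h.1 (by linarith)]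
    rw [this] at hbad
    omega
  · have : (post.map fun z => if proj z.1 ∈ Set.Icc lo hi then 0 else z.2)
        = post.map Prod.snd := by
      refine List.map_congr_left fun y hy => ?_
      have h1 := hpost y hy
      have h2 : hi < proj z.1 := by
        by_contra h3
        exact hz ⟨not_lt.1 hlo, not_lt.1 h3⟩
      rw [if_neg fun h => absurd h.2 (by linarith)]
    rw [this] at hbad
    omega

/-! ### Estimation -/

lemma entriesAt_val (G : ℕ → ℕ → ℂ) (t : List ℕ) (S : List (ℕ × ℕ)) (ω : ℤ) :
    (entriesAt G t S ω).val = (S.flatMap fun sw => (1 :: t).map fun τ =>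
      (G (τ * sw.1) (ω % ((τ * sw.1 : ℕ) : ℤ)).toNat, sw.2)).reverse := by
  have h1 : ∀ (S : List (ℕ × ℕ)) (st : List (ℂ × ℕ)),
      (loop S st (fun st sw =>
        loop (1 :: t) st (fun st τ => do
          let m ← op (τ * sw.1)
          let h ← op (ω % (m : ℤ)).toNat
          let g ← op (G m h)
          op ((g, sw.2) :: st)))).val = (S.flatMap fun sw => (1 :: t).map fun τ =>
      (G (τ * sw.1) (ω % ((τ * sw.1 : ℕ) : ℤ)).toNat, sw.2)).reverse ++ st := by
    intro S
    induction S with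
    | nil => simp
    | cons sw S ih =>
      intro st
      rw [loop_cons_val, loop_val_of_cons (g := fun τ =>
        (G (τ * sw.1) (ω % ((τ * sw.1 : ℕ) : ℤ)).toNat, sw.2)) (h := fun _ _ _ => rfl), ih]
      simp
  have h2 := h1 S []
  rw [List.append_nil] at h2
  exact h2

lemma entriesAt_length (G : ℕ → ℕ → ℂ) (t : List ℕ) (S : List (ℕ × ℕ)) (ω : ℤ) :
    (entriesAt G t S ω).val.length = S.length * (t.length + 1) := by
  rw [entriesAt_val, List.length_reverse, List.length_flatMap]
  simp

lemma count_loop_val (t : List ℕ) (n : ℕ) :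
    (loop t n (fun n _ => op (n + 1))).val = n + t.length := by
  induction t generalizing n with
  | nil => simp
  | cons a t ih => rw [loop_cons_val, op_val, ih, List.length_cons]; omega

/-- A good modulus makes all its λ + 1 rows good, so a majority among the draws is a majority among
the l(λ + 1) entries. Each median is then off by at most δ, and the factor 2 comes from adding the
real and imaginary errors. -/
lemma norm_estimate_sub_le {G : ℕ → ℕ → ℂ} {l : ℕ} {t : List ℕ} {S : List (ℕ × ℕ)} {ω : ℤ}
    {c : ℂ} {δ : ℝ} (P : ℕ → Prop) [DecidablePred P] (hl : (S.map Prod.snd).sum = l)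
    (hP : ∀ sw ∈ S, P sw.1 → ∀ τ ∈ 1 :: t,
      ‖G (τ * sw.1) (ω % ((τ * sw.1 : ℕ) : ℤ)).toNat - c‖ ≤ δ)
    (hbad : 2 * (S.map fun sw => if P sw.1 then 0 else sw.2).sum < l) :
    ‖(estimate G l t S ω).val - c‖ ≤ 2 * δ := by
  have hval : (estimate G l t S ω).val
      = ⟨(median Complex.re (l * (1 + t.length)) (entriesAt G t S ω).val).val,
        (median Complex.im (l * (1 + t.length)) (entriesAt G t S ω).val).val⟩ := by
    simp only [estimate, timed_bind_val, op_val, count_loop_val]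
  have hsum : ((entriesAt G t S ω).val.map Prod.snd).sum = l * (1 + t.length) := by
    rw [entriesAt_val, List.map_reverse, List.sum_reverse, List.map_flatMap, list_sum_flatMap,
      ← hl, ← List.sum_map_mul_right]
    congr 1
    refine List.map_congr_left fun sw _ => ?_
    simp [Function.comp_def]
    ring
  have key : ∀ (proj : ℂ → ℝ), (∀ z, |proj z - proj c| ≤ ‖z - c‖) →
      (median proj (l * (1 + t.length)) (entriesAt G t S ω).val).val
        ∈ Set.Icc (proj c - δ) (proj c + δ) := by
    intro proj hproj
    refine median_mem_Icc proj _ _ _ _ hsum ?_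
    rw [entriesAt_val, List.map_reverse, List.sum_reverse, List.map_flatMap, list_sum_flatMap]
    have h1 : (S.map fun sw => (((1 :: t).map fun τ =>
        (G (τ * sw.1) (ω % ((τ * sw.1 : ℕ) : ℤ)).toNat, sw.2)).map fun z =>
          if proj z.1 ∈ Set.Icc (proj c - δ) (proj c + δ) then 0 else z.2).sum).sum
        ≤ (S.map fun sw => (if P sw.1 then 0 else sw.2) * (1 + t.length)).sum := by
      refine List.sum_le_sum fun sw hsw => ?_
      rw [List.map_map]
      split_ifs with hp
      · rw [zero_mul, nonpos_iff_eq_zero]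
        refine List.sum_eq_zero fun x hx => ?_
        obtain ⟨τ, hτ, rfl⟩ := List.mem_map.1 hx
        have h2 := (hproj _).trans (hP sw hsw hp τ hτ)
        rw [abs_le] at h2
        simp only [Function.comp_apply]
        rw [if_pos ⟨by linarith, by linarith⟩]
      · refine (List.sum_le_card_nsmul _ sw.2 fun x hx => ?_).trans (le_of_eq ?_)
        · obtain ⟨τ, hτ, rfl⟩ := List.mem_map.1 hx
          simp only [Function.comp_apply]
          split_ifs <;> simp
        · simp
          ring
    rw [List.sum_map_mul_right] at h1
    calc _ ≤ 2 * ((S.map fun sw => if P sw.1 then 0 else sw.2).sum * (1 + t.length)) := by omega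
      _ = (2 * (S.map fun sw => if P sw.1 then 0 else sw.2).sum) * (1 + t.length) := by ring
      _ < _ := Nat.mul_lt_mul_of_pos_right hbad (by omega)
  have hre := key Complex.re fun z => by
    rw [← Complex.sub_re]; exact Complex.abs_re_le_norm _
  have him := key Complex.im fun z => by
    rw [← Complex.sub_im]; exact Complex.abs_im_le_norm _
  rw [hval]
  refine (Complex.norm_le_abs_re_add_abs_im _).trans ?_
  rw [Complex.sub_re, Complex.sub_im]
  have h1 := abs_le.2 (⟨by linarith [hre.1], by linarith [hre.2]⟩ :
    -δ ≤ (median Complex.re (l * (1 + t.length)) (entriesAt G t S ω).val).val - c.re ∧ _ ≤ δ)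
  have h2 := abs_le.2 (⟨by linarith [him.1], by linarith [him.2]⟩ :
    -δ ≤ (median Complex.im (l * (1 + t.length)) (entriesAt G t S ω).val).val - c.im ∧ _ ≤ δ)
  dsimp only
  linarith

/-! ### Steps of the estimation -/

lemma entriesAt_steps (G : ℕ → ℕ → ℂ) (t : List ℕ) (S : List (ℕ × ℕ)) (ω : ℤ) :
    (entriesAt G t S ω).steps ≤ S.length * ((t.length + 1) * 5 + 1) :=
  loop_steps_le _ _ _ _ fun _ _ _ => loop_steps_le _ _ _ 4 fun _ _ _ => le_rfl

lemma median_steps (proj : ℂ → ℝ) (total : ℕ) (xs : List (ℂ × ℕ)) :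
    (median proj total xs).steps
      ≤ 8 * xs.length + (4 * xs.length + 1) * Nat.clog 2 xs.length + 1 := by
  have h1 := mergeSort_steps (fun a b : ℂ × ℕ => op (decide (proj a.1 ≤ proj b.1))) 1
    (fun _ _ => le_rfl) xs
  have h2 := loop_steps_le
    (mergeSort (fun a b : ℂ × ℕ => op (decide (proj a.1 ≤ proj b.1))) xs).val
    ((0, none) : ℕ × Option ℝ) (fun st zw => do
      let acc ← op (st.1 + zw.2)
      let dbl ← op (2 * acc)
      let c ← op (decide (total ≤ dbl))
      let u ← op st.2.isNone
      if c && u then op (acc, some (proj zw.1)) else pure (acc, st.2)) 5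
    (fun st zw _ => by
      simp only [op_bind_steps, timed_ite_steps, op_steps, timed_pure_steps]
      split_ifs <;> omega)
  rw [(mergeSort_perm _ _).length_eq] at h2
  rw [show 1 + 3 = 4 from rfl] at h1
  simp only [median, timed_bind_steps, timed_pure_steps] at *
  omega

/-- A bound for the number of steps of one estimate, from `d` distinct moduli `s` and `r`
moduli `t`. -/
def estimateCost (d r : ℕ) : ℕ :=
  d * (5 * (r + 1) + 1) + 2 * r + 4 +
    2 * (8 * (d * (r + 1)) + (4 * (d * (r + 1)) + 1) * Nat.clog 2 (d * (r + 1)))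

lemma estimate_steps (G : ℕ → ℕ → ℂ) (l : ℕ) (t : List ℕ) (S : List (ℕ × ℕ)) (ω : ℤ) :
    (estimate G l t S ω).steps ≤ estimateCost S.length t.length := by
  have h1 := entriesAt_steps G t S ω
  have h2 : (loop t 1 (fun n _ => op (n + 1))).steps ≤ t.length * 2 :=
    loop_steps_le _ _ _ 1 fun _ _ _ => le_rfl
  have h3 := fun proj total => median_steps proj total (entriesAt G t S ω).val
  rw [entriesAt_length] at h3
  have h4 := h3 Complex.re (l * (loop t 1 (fun n _ => op (n + 1))).val)
  have h5 := h3 Complex.im (l * (loop t 1 (fun n _ => op (n + 1))).val)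
  simp only [estimate, timed_bind_steps, op_steps, op_val, estimateCost]
  rw [mul_comm (t.length + 1) 5] at h1
  omega

/-- A frequency may occur many times in `rs`, but clearing its counter makes later occurrences fail
the majority test. Hence the keys of `new` are distinct, and the cost E is paid once per estimated
frequency rather than once per occurrence. -/
lemma estimateAll_loop (l E : ℕ) (e : ℤ → ℂ)
    (body : (ℤ → ℕ) × List (ℤ × ℂ) → ℤ → Timed ((ℤ → ℕ) × List (ℤ × ℂ)))
    (hb : ∀ st ω, (body st ω).val
      = if l < 2 * st.1 ω then (Function.update st.1 ω 0, (ω, e ω) :: st.2) else st)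
    (hs : ∀ st ω, (body st ω).steps ≤ 3 + if l < 2 * st.1 ω then E + 2 else 0)
    (rs : List ℤ) (cnt : ℤ → ℕ) (xs : List (ℤ × ℂ)) :
    ∃ new, (loop rs (cnt, xs) body).val.2 = new ++ xs ∧ (new.map Prod.fst).Nodup ∧
      (∀ p, p ∈ new ↔ p.1 ∈ rs ∧ l < 2 * cnt p.1 ∧ p.2 = e p.1) ∧
      (loop rs (cnt, xs) body).steps ≤ 4 * rs.length + (E + 2) * new.length := by
  induction rs generalizing cnt xs with
  | nil => exact ⟨[], by simp⟩
  | cons ω rs ih =>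
    have h1 := hs (cnt, xs) ω
    rw [loop_cons_val, loop_cons_steps, hb]
    dsimp only at h1 ⊢
    by_cases hc : l < 2 * cnt ω
    · rw [if_pos hc] at h1 ⊢
      obtain ⟨new, e1, e2, e3, e4⟩ := ih (Function.update cnt ω 0) ((ω, e ω) :: xs)
      have hω : ∀ p ∈ new, p.1 ≠ ω := by
        rintro p hp rfl
        have := ((e3 p).1 hp).2.1
        simp at this
      refine ⟨new ++ [(ω, e ω)], by simp [e1], ?_, fun p => ?_, ?_⟩
      · rw [List.map_append, List.nodup_append]
        refine ⟨e2, by simp, ?_⟩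
        intro a ha b hb'
        obtain ⟨p, hp, rfl⟩ := List.mem_map.1 ha
        have : b = ω := by simpa using hb'
        rw [this]
        exact hω p hp
      · rw [List.mem_append, e3, List.mem_singleton, List.mem_cons]
        by_cases hp : p.1 = ω
        · constructor
          · rintro (h | rfl)
            · rw [hp] at h; simp at h
            · exact ⟨Or.inl rfl, hc, rfl⟩
          · rintro ⟨-, -, h⟩
            exact Or.inr (Prod.ext hp (by rw [h, hp]))
        · have : p ≠ (ω, e ω) := fun h => hp (by rw [h])
          simp [hp, this]
      · rw [List.length_append, List.length_singleton, List.length_cons]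
        have : (E + 2) * (new.length + 1) = (E + 2) * new.length + (E + 2) := by ring
        omega
    · rw [if_neg hc] at h1 ⊢
      obtain ⟨new, e1, e2, e3, e4⟩ := ih cnt xs
      refine ⟨new, e1, e2, fun p => ?_, ?_⟩
      · rw [e3, List.mem_cons]
        constructor
        · rintro ⟨h, h'⟩; exact ⟨Or.inr h, h'⟩
        · rintro ⟨h | h, h'⟩
          · rw [h] at h'; exact absurd h'.1 hc
          · exact ⟨h, h'⟩
      · rw [List.length_cons]; omega

lemma estimateAll_spec (G : ℕ → ℕ → ℂ) (l : ℕ) (t : List ℕ) (S : List (ℕ × ℕ))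
    (cr : (ℤ → ℕ) × List ℤ) :
    ((estimateAll G l t S cr).val.map Prod.fst).Nodup ∧
    (∀ p, p ∈ (estimateAll G l t S cr).val ↔
      p.1 ∈ cr.2 ∧ l < 2 * cr.1 p.1 ∧ p.2 = (estimate G l t S p.1).val) ∧
    (estimateAll G l t S cr).steps
      ≤ 4 * cr.2.length + (estimateCost S.length t.length + 2) * (estimateAll G l t S cr).val.length := by
  obtain ⟨new, e1, e2, e3, e4⟩ := estimateAll_loop l
    (estimateCost S.length t.length) (fun ω => (estimate G l t S ω).val)
    (fun st ω => do
      let c ← op (st.1 ω)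
      let d ← op (2 * c)
      let b ← op (decide (l < d))
      if b then do
        let x ← estimate G l t S ω
        let cnt ← op (Function.update st.1 ω 0)
        let xs ← op ((ω, x) :: st.2)
        pure (cnt, xs)
      else pure st)
    (fun st ω => by simp)
    (fun st ω => by
      have := estimate_steps G l t S ω
      simp
      split_ifs <;> omega) cr.2 cr.1 []
  rw [List.append_nil] at e1
  have hval : (estimateAll G l t S cr).val = new := e1
  rw [hval]
  exact ⟨e2, e3, e4⟩

/-! ### Selection of the largest entries -/

lemma nonzero_loop_val (xs st : List (ℤ × ℂ)) :
    (loop xs st (fun st a => do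
      let b ← op (decide (a.2 = 0))
      if b then pure st else op (a :: st))).val
      = (xs.filter fun a => decide (a.2 ≠ 0)).reverse ++ st := by
  induction xs generalizing st with
  | nil => simp
  | cons a xs ih =>
    rw [loop_cons_val, ih]
    by_cases h : a.2 = 0 <;> simp [h]

lemma largest_spec (k : ℕ) (xs : List (ℤ × ℂ)) (hxs : (xs.map Prod.fst).Nodup) :
    ((largest k xs).val.map Prod.fst).Nodup ∧ (∀ p ∈ (largest k xs).val, p ∈ xs) ∧
    (largest k xs).val.length ≤ 2 * k ∧
    ∀ p ∈ xs, p.2 ≠ 0 → p ∈ (largest k xs).val ∨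
      ((largest k xs).val.length = 2 * k ∧ ∀ q ∈ (largest k xs).val, ‖p.2‖ ≤ ‖q.2‖) := by
  set le : ℤ × ℂ → ℤ × ℂ → Timed Bool := fun a b => do
    let u ← absSq a.2
    let v ← absSq b.2
    op (decide (v ≤ u)) with hle
  have hlev : ∀ a b, (le a b).val = true ↔ ‖b.2‖ ^ 2 ≤ ‖a.2‖ ^ 2 := fun a b => by simp [hle]
  set nz := (xs.filter fun a => decide (a.2 ≠ 0)).reverse with hnz
  have hval : (largest k xs).val = (mergeSort le nz).val.take (2 * k) := by
    simp only [largest, timed_bind_val, op_val, takeFirst_val]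
    rw [nonzero_loop_val, List.append_nil]
  have hperm := mergeSort_perm le nz
  have hsort := mergeSort_sorted le
    (fun a b c h1 h2 => by rw [hlev] at *; exact h2.trans h1)
    (fun a b => by
      rw [Bool.or_eq_true, hlev, hlev]
      exact le_total _ _) nz
  rw [hval]
  generalize (mergeSort le nz).val = ys at hperm hsort
  have hnd : (ys.map Prod.fst).Nodup := by
    rw [(hperm.map _).nodup_iff, hnz, List.map_reverse, List.nodup_reverse]
    exact hxs.sublist (List.filter_sublist.map _)
  refine ⟨hnd.sublist ((List.take_sublist _ _).map _), fun p hp => ?_, List.length_take_le _ _,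
    fun p hp hp0 => ?_⟩
  · have := hperm.mem_iff.1 (List.mem_of_mem_take hp)
    rw [hnz, List.mem_reverse] at this
    exact List.mem_of_mem_filter this
  · have hpy : p ∈ ys := by
      rw [hperm.mem_iff, hnz, List.mem_reverse, List.mem_filter]
      exact ⟨hp, by simpa using hp0⟩
    rw [← List.take_append_drop (2 * k) ys, List.mem_append] at hpy
    rcases hpy with h | h
    · exact Or.inl h
    · right
      constructor
      · have h1 := List.length_pos_of_mem h
        rw [List.length_drop] at h1
        rw [List.length_take]
        omega
      · intro q hq
        rw [← List.take_append_drop (2 * k) ys, List.pairwise_append] at hsort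
        have := (hlev _ _).1 (hsort.2.2 q hq p h)
        exact (pow_le_pow_iff_left₀ (norm_nonneg _) (norm_nonneg _) two_ne_zero).1 this

lemma toVector_of_mem {ys : List (ℤ × ℂ)} (hnd : (ys.map Prod.fst).Nodup) {p : ℤ × ℂ}
    (hp : p ∈ ys) : toVector ys p.1 = p.2 := by
  unfold toVector
  induction ys with
  | nil => simp at hp
  | cons q ys ih =>
    rw [List.map_cons, List.nodup_cons] at hnd
    obtain ⟨a, b⟩ := q
    rcases List.mem_cons.1 hp with rfl | h
    · simp
    · have hne : p.1 ≠ a := fun h' => hnd.1 (List.mem_map.2 ⟨p, h, h'⟩)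
      rw [List.lookup_cons, beq_eq_false_iff_ne.2 hne]
      exact ih hnd.2 h

lemma toVector_of_notMem {ys : List (ℤ × ℂ)} {ω : ℤ} (h : ω ∉ ys.map Prod.fst) :
    toVector ys ω = 0 := by
  unfold toVector
  induction ys with
  | nil => simp
  | cons q ys ih =>
    obtain ⟨a, b⟩ := q
    simp only [List.map_cons, List.mem_cons, not_or] at h
    rw [List.lookup_cons, beq_eq_false_iff_ne.2 h.1]
    exact ih h.2

/-! ### The `ℓ²` error -/

lemma sqrt_sum_add_sq_le {ι : Type*} (B : Finset ι) (u w : ι → ℝ) :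
    √(∑ i ∈ B, (u i + w i) ^ 2) ≤ √(∑ i ∈ B, u i ^ 2) + √(∑ i ∈ B, w i ^ 2) := by
  rw [Real.sqrt_le_left (by positivity), add_sq,
    Real.sq_sqrt (Finset.sum_nonneg fun _ _ => sq_nonneg _),
    Real.sq_sqrt (Finset.sum_nonneg fun _ _ => sq_nonneg _)]
  have h1 := Real.sum_mul_le_sqrt_mul_sqrt B u w
  have h2 : ∑ i ∈ B, (u i + w i) ^ 2
      = ∑ i ∈ B, u i ^ 2 + 2 * ∑ i ∈ B, u i * w i + ∑ i ∈ B, w i ^ 2 := by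
    rw [Finset.mul_sum, ← Finset.sum_add_distrib, ← Finset.sum_add_distrib]
    exact Finset.sum_congr rfl fun i _ => by ring
  rw [h2]
  linarith

/-- If `S` contains the indices of approximately the `2 k` largest entries of `x`, and `y`
approximates `x` on `S`, then `y` is almost as good as any `k`-term approximation. -/
lemma sqrt_sum_sub_le (B Sk S : Finset ℤ) (k : ℕ) (x y : ℤ → ℂ) (δ : ℝ) (hδ : 0 ≤ δ)
    (hSB : S ⊆ B) (hkB : Sk ⊆ B) (hk : Sk.card = k) (hS : S.card ≤ 2 * k)
    (hy0 : ∀ ω, ω ∉ S → y ω = 0) (hy : ∀ ω ∈ S, ‖y ω - x ω‖ ≤ 2 * δ)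
    (hx : ∀ ω ∈ B, ω ∉ S → ‖x ω‖ ≤ 2 * δ ∨
      (S.card = 2 * k ∧ ∀ ω' ∈ S, ‖x ω‖ ≤ ‖x ω'‖ + 4 * δ)) :
    √(∑ ω ∈ B, ‖x ω - y ω‖ ^ 2)
      ≤ √(∑ ω ∈ B, ‖x ω - restrict Sk x ω‖ ^ 2) + 5 * (√k * δ) := by
  classical
  -- μ is the least magnitude on S \ Sk. If S is full, |S \ Sk| ≥ |Sk \ S|, so the entries lost from
  -- Sk can be charged, up to 4δ each, to entries that S gained. If S is not full, the lost entries
  -- are at most 2δ and μ = 0 works.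
  obtain ⟨μ, hμ0, hμ1, hμ2⟩ : ∃ μ : ℝ, 0 ≤ μ ∧ (∀ ω ∈ Sk \ S, ‖x ω‖ ≤ μ + 4 * δ) ∧
      ∑ _ω ∈ Sk \ S, μ ^ 2 ≤ ∑ ω ∈ S \ Sk, ‖x ω‖ ^ 2 := by
    by_cases hfull : S.card = 2 * k
    · have h1 : (Sk \ S).card ≤ (S \ Sk).card := by
        have e1 := Finset.card_sdiff_add_card_inter Sk S
        have e2 := Finset.card_sdiff_add_card_inter S Sk
        rw [Finset.inter_comm] at e2
        omega
      rcases (S \ Sk).eq_empty_or_nonempty with he | hne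
      · refine ⟨0, le_rfl, ?_, ?_⟩
        · rw [he, Finset.card_empty, nonpos_iff_eq_zero, Finset.card_eq_zero] at h1
          simp [h1]
        · simpa using Finset.sum_nonneg fun ω _ => sq_nonneg ‖x ω‖
      · obtain ⟨ω₀, h0, hmin⟩ := Finset.exists_min_image (S \ Sk) (fun ω => ‖x ω‖) hne
        refine ⟨‖x ω₀‖, norm_nonneg _, fun ω hω => ?_, ?_⟩
        · rw [Finset.mem_sdiff] at hω h0
          rcases hx ω (hkB hω.1) hω.2 with h | h
          · linarith [norm_nonneg (x ω₀)]
          · exact h.2 ω₀ h0.1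
        · calc ∑ _ω ∈ Sk \ S, ‖x ω₀‖ ^ 2 = (Sk \ S).card * ‖x ω₀‖ ^ 2 := by simp
            _ ≤ (S \ Sk).card * ‖x ω₀‖ ^ 2 := by gcongr
            _ = ∑ _ω ∈ S \ Sk, ‖x ω₀‖ ^ 2 := by simp
            _ ≤ _ := Finset.sum_le_sum fun ω hω => by
              have := hmin ω hω
              gcongr
    · refine ⟨0, le_rfl, fun ω hω => ?_, by
        simpa using Finset.sum_nonneg fun ω _ => sq_nonneg ‖x ω‖⟩
      rw [Finset.mem_sdiff] at hω
      rcases hx ω (hkB hω.1) hω.2 with h | h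
      · linarith
      · exact absurd h.1 hfull
  -- The error is dominated by u + w, where u has norm at most the optimal error by the choice of μ,
  -- and w collects the multiples of δ.
  set u : ℤ → ℝ := fun ω => if ω ∈ S then 0 else if ω ∈ Sk then μ else ‖x ω‖ with hu
  set w : ℤ → ℝ := fun ω => (if ω ∈ Sk \ S then 4 * δ else 0) + if ω ∈ S then 2 * δ else 0 with hw
  have h1 : ∑ ω ∈ B, ‖x ω - y ω‖ ^ 2 ≤ ∑ ω ∈ B, (u ω + w ω) ^ 2 := by
    refine Finset.sum_le_sum fun ω hω => ?_
    refine pow_le_pow_left₀ (norm_nonneg _) ?_ 2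
    by_cases h : ω ∈ S
    · simpa [hu, hw, h, norm_sub_rev (x ω)] using hy ω h
    · rw [hy0 ω h, sub_zero]
      by_cases h' : ω ∈ Sk
      · simpa [hu, hw, h, h'] using hμ1 ω (by simp [h, h'])
      · simp [hu, hw, h, h']
  have h2 : ∑ ω ∈ B, u ω ^ 2 ≤ ∑ ω ∈ B, ‖x ω - restrict Sk x ω‖ ^ 2 := by
    have e1 : ∑ ω ∈ B, u ω ^ 2 = ∑ ω ∈ B \ (S ∪ Sk), ‖x ω‖ ^ 2 + ∑ _ω ∈ Sk \ S, μ ^ 2 := by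
      have : ∀ ω ∈ B, u ω ^ 2 = (if ω ∈ B \ (S ∪ Sk) then ‖x ω‖ ^ 2 else 0)
          + if ω ∈ Sk \ S then μ ^ 2 else 0 := by
        intro ω hω
        by_cases h : ω ∈ S <;> by_cases h' : ω ∈ Sk <;> simp [hu, h, h', hω]
      rw [Finset.sum_congr rfl this, Finset.sum_add_distrib, Finset.sum_ite_mem,
        Finset.sum_ite_mem, Finset.inter_eq_right.2 Finset.sdiff_subset,
        Finset.inter_eq_right.2 (Finset.sdiff_subset.trans hkB)]
    have e2 : ∑ ω ∈ B, ‖x ω - restrict Sk x ω‖ ^ 2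
        = ∑ ω ∈ B \ (S ∪ Sk), ‖x ω‖ ^ 2 + ∑ ω ∈ S \ Sk, ‖x ω‖ ^ 2 := by
      have : ∀ ω ∈ B, ‖x ω - restrict Sk x ω‖ ^ 2 = (if ω ∈ B \ (S ∪ Sk) then ‖x ω‖ ^ 2 else 0)
          + if ω ∈ S \ Sk then ‖x ω‖ ^ 2 else 0 := by
        intro ω hω
        by_cases h : ω ∈ S <;> by_cases h' : ω ∈ Sk <;> simp [restrict, h, h', hω]
      rw [Finset.sum_congr rfl this, Finset.sum_add_distrib, Finset.sum_ite_mem,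
        Finset.sum_ite_mem, Finset.inter_eq_right.2 Finset.sdiff_subset,
        Finset.inter_eq_right.2 (Finset.sdiff_subset.trans hSB)]
    rw [e1, e2]
    linarith
  -- At most k entries of size 4δ and 2k entries of size 2δ: 16k + 8k = 24k ≤ 25k.
  have h3 : √(∑ ω ∈ B, w ω ^ 2) ≤ 5 * (√k * δ) := by
    rw [Real.sqrt_le_left (by positivity)]
    have e1 : ∀ ω ∈ B, w ω ^ 2 = (if ω ∈ Sk \ S then (4 * δ) ^ 2 else 0)
        + if ω ∈ S then (2 * δ) ^ 2 else 0 := by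
      intro ω hω
      by_cases h : ω ∈ S <;> by_cases h' : ω ∈ Sk <;> simp [hw, h, h']
    rw [Finset.sum_congr rfl e1, Finset.sum_add_distrib, Finset.sum_ite_mem,
      Finset.sum_ite_mem, Finset.inter_eq_right.2 hSB,
      Finset.inter_eq_right.2 (Finset.sdiff_subset.trans hkB), Finset.sum_const, Finset.sum_const,
      nsmul_eq_mul, nsmul_eq_mul, mul_pow, mul_pow, mul_pow, mul_pow, Real.sq_sqrt (by positivity)]
    have e2 : ((Sk \ S).card : ℝ) ≤ k := by
      rw [← hk]
      exact_mod_cast Finset.card_le_card Finset.sdiff_subset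
    have e3 : (S.card : ℝ) ≤ 2 * k := by exact_mod_cast hS
    nlinarith [mul_le_mul_of_nonneg_right e2 (sq_nonneg δ),
      mul_le_mul_of_nonneg_right e3 (sq_nonneg δ), mul_nonneg (Nat.cast_nonneg (α := ℝ) k) (sq_nonneg δ)]
  calc _ ≤ √(∑ ω ∈ B, (u ω + w ω) ^ 2) := Real.sqrt_le_sqrt h1
    _ ≤ _ := sqrt_sum_add_sq_le B u w
    _ ≤ _ := add_le_add (Real.sqrt_le_sqrt h2) h3

/-- The deterministic error bound: it suffices that for every frequency of the band more than
half of the selected moduli isolate it up to `δ`. -/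
theorem norm2_sub_recover_le {a : ℤ → ℂ} {G : ℕ → ℕ → ℂ} {N k l : ℕ} {t : List ℕ}
    {S : List (ℕ × ℕ)} {Sk : Finset ℤ} {δ : ℝ} (ha : Summable fun n => ‖a n‖) (hN : 0 < N)
    (hδ : 0 ≤ δ) (hkB : Sk ⊆ band N) (hk : Sk.card = k)
    (hS : ∀ sw ∈ S, 0 < sw.1 ∧ N ≤ sw.1 * t.prod ∧ IsTable a G sw.1 ∧
      ∀ τ ∈ t, 0 < τ ∧ Nat.Coprime τ sw.1 ∧ IsTable a G (τ * sw.1))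
    (ht : ∀ τ ∈ t, 0 < τ) (hcop : t.Pairwise Nat.Coprime) (hl : (S.map Prod.snd).sum = l)
    (P : ℤ → ℕ → Prop) [∀ ω, DecidablePred (P ω)] (hP : ∀ ω ∈ band N, ∀ s, P ω s → tail a s ω ≤ δ)
    (hbad : ∀ ω ∈ band N, 2 * (S.map fun sw => if P ω sw.1 then 0 else sw.2).sum < l) :
    norm2 N (fun ω => a ω - toVector (recover N k l t S G).val ω)
      ≤ norm2 N (fun ω => a ω - restrict Sk a ω) + 5 * (√k * δ) := by
  set cr := (identify G N t S).val with hcr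
  obtain ⟨hx1, hx2, -⟩ := estimateAll_spec G l t S cr
  set xs := (estimateAll G l t S cr).val with hxs
  obtain ⟨hy1, hy2, hy3, hy4⟩ := largest_spec k xs hx1
  have hval : (recover N k l t S G).val = (largest k xs).val := rfl
  rw [hval]
  set ys := (largest k xs).val with hys
  have hest : ∀ ω ∈ band N, ‖(estimate G l t S ω).val - a ω‖ ≤ 2 * δ := by
    intro ω hω
    refine norm_estimate_sub_le (P ω) hl (fun sw hsw hp τ hτ => ?_) (hbad ω hω)
    obtain ⟨h0, -, hT, hT'⟩ := hS sw hsw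
    have hτ' : 0 < τ ∧ IsTable a G (τ * sw.1) := by
      rcases List.mem_cons.1 hτ with rfl | h
      · rw [one_mul]; exact ⟨one_pos, hT⟩
      · exact ⟨(hT' τ h).1, (hT' τ h).2.2⟩
    refine (hτ'.2.norm_sub_le ha (dvd_mul_left sw.1 τ) ?_).trans (hP ω hω sw.1 hp)
    have hM : ((τ * sw.1 : ℕ) : ℤ) ≠ 0 := by exact_mod_cast (Nat.mul_pos hτ'.1 h0).ne'
    rw [Int.toNat_of_nonneg (Int.emod_nonneg _ hM)]
    exact Int.dvd_self_sub_emod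
  have hbig : ∀ ω ∈ band N, 2 * δ < ‖a ω‖ → (ω, (estimate G l t S ω).val) ∈ xs := by
    intro ω hω hb
    have h1 := le_identify_count (G := G) (N := N) (t := t) (S := S) (ω := ω) (P ω)
      (fun sw hsw hp => by
        obtain ⟨h0, hN', hT, hT'⟩ := hS sw hsw
        have hpos : (0 : ℤ) < sw.1 := by exact_mod_cast h0
        have hnn := Int.emod_nonneg ω hpos.ne'
        have hlt := Int.emod_lt_of_pos ω hpos
        exact ⟨(ω % sw.1).toNat, by omega, reconstruct_eq ha h0 hT hT' hcop hN' hω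
          (Int.toNat_of_nonneg hnn) (by linarith [hP ω hω sw.1 hp])⟩)
    -- Good and bad multiplicities add up to l, so bad weight below l/2 means more than l/2 correct
    -- reconstructions.
    have h2 : (S.map fun sw => if P ω sw.1 then sw.2 else 0).sum
        + (S.map fun sw => if P ω sw.1 then 0 else sw.2).sum = l := by
      rw [← hl, ← List.sum_map_add]
      congr 1
      refine List.map_congr_left fun sw _ => ?_
      split_ifs <;> simp
    have h3 := hbad ω hω
    rw [← hcr] at h1
    have h4 : cr.1 ω ≠ 0 := by omega
    rw [hx2]
    refine ⟨mem_identify_of_count h4, ?_, rfl⟩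
    dsimp only
    omega
  have hxB : ∀ p ∈ xs, p.1 ∈ band N ∧ p.2 = (estimate G l t S p.1).val := fun p hp => by
    obtain ⟨h1, -, h3⟩ := (hx2 p).1 hp
    exact ⟨mem_band_of_identify hN ht h1, h3⟩
  have hcard : (ys.map Prod.fst).toFinset.card = ys.length := by
    rw [List.toFinset_card_of_nodup hy1, List.length_map]
  refine sqrt_sum_sub_le (band N) Sk (ys.map Prod.fst).toFinset k a _ δ hδ ?_ hkB hk
    (by omega) ?_ ?_ ?_
  · intro ω hω
    simp only [List.mem_toFinset, List.mem_map] at hω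
    obtain ⟨p, hp, rfl⟩ := hω
    exact (hxB p (hy2 p hp)).1
  · intro ω hω
    exact toVector_of_notMem (by simpa using hω)
  · intro ω hω
    simp only [List.mem_toFinset, List.mem_map] at hω
    obtain ⟨p, hp, rfl⟩ := hω
    obtain ⟨h1, h2⟩ := hxB p (hy2 p hp)
    rw [toVector_of_mem hy1 hp, h2]
    exact hest _ h1
  · intro ω hω hωS
    by_cases hb : ‖a ω‖ ≤ 2 * δ
    · exact Or.inl hb
    have hmem := hbig ω hω (not_le.1 hb)
    have he := hest ω hω
    -- A zero estimate would be discarded by `largest`; it is impossible here, being within 2δ of a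
    -- coefficient larger than 2δ.
    have hne : (estimate G l t S ω).val ≠ 0 := by
      intro h0
      rw [h0, zero_sub, norm_neg] at he
      exact hb he
    rcases hy4 _ hmem hne with h | ⟨h1, h2⟩
    · exact absurd (List.mem_toFinset.2 (List.mem_map_of_mem h)) hωS
    · refine Or.inr ⟨by omega, fun ω' hω' => ?_⟩
      simp only [List.mem_toFinset, List.mem_map] at hω'
      obtain ⟨p, hp, rfl⟩ := hω'
      obtain ⟨h3, h4⟩ := hxB p (hy2 p hp)
      have h5 := h2 p hp
      have h6 := hest _ h3
      rw [h4] at h5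
      -- The ranking uses estimates; returning to true magnitudes costs 2δ on each side, hence 4δ.
      have h7 := norm_le_norm_add_norm_sub' (a ω) (estimate G l t S ω).val
      have h8 := norm_le_norm_add_norm_sub' (estimate G l t S p.1).val (a p.1)
      rw [norm_sub_rev] at h7
      linarith

/-! ### Moduli that do not isolate a frequency -/

/-- The moduli dividing d are coprime, so their product, at least s₁ to their number, divides d and
is below N. -/
lemma card_filter_dvd_le {N K : ℕ} {s : ℕ → ℕ} (h2 : 2 ≤ s 0) (hlt : ∀ i j, i < j → j < K → s i < s j)
    (hcop : ∀ i j, i < j → j < K → Nat.Coprime (s i) (s j)) {d : ℤ} (hd : d ≠ 0)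
    (hdN : d.natAbs < N) :
    ((Finset.range K).filter fun j => (s j : ℤ) ∣ d).card ≤ Nat.log (s 0) N := by
  set F := (Finset.range K).filter fun j => (s j : ℤ) ∣ d with hF
  have hprod : ∏ j ∈ F, s j ∣ d.natAbs := by
    refine Finset.prod_dvd_of_isRelPrime (fun i hi j hj hij => ?_) fun j hj => ?_
    · have hi' : i < K := by simpa using (Finset.mem_filter.1 hi).1
      have hj' : j < K := by simpa using (Finset.mem_filter.1 hj).1
      rw [Function.onFun, ← Nat.coprime_iff_isRelPrime]
      rcases lt_or_gt_of_ne hij with h | h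
      · exact hcop i j h hj'
      · exact (hcop j i h hi').symm
    · rw [← Int.natCast_dvd]
      exact (Finset.mem_filter.1 hj).2
  have hpow : s 0 ^ F.card ≤ ∏ j ∈ F, s j := by
    rw [← Finset.prod_const]
    refine Finset.prod_le_prod' fun j hj => ?_
    rcases Nat.eq_zero_or_pos j with rfl | h
    · exact le_rfl
    · exact (hlt 0 j h (by simpa using (Finset.mem_filter.1 hj).1)).le
  refine Nat.le_log_of_pow_le (by omega) (hpow.trans ?_)
  exact (Nat.le_of_dvd (Int.natAbs_pos.2 hd) hprod).trans hdN.le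

lemma natAbs_sub_lt_of_mem_band {N : ℕ} {m n : ℤ} (hm : m ∈ band N) (hn : n ∈ band N) :
    (m - n).natAbs < N := by
  unfold band at hm hn
  rw [Finset.mem_Ioc] at hm hn
  omega

lemma tail_le {a : ℤ → ℂ} (ha : Summable fun n => ‖a n‖) (B : Finset ℤ) (s : ℕ) (ω : ℤ) :
    tail a s ω ≤ ∑ n ∈ B, (if (s : ℤ) ∣ n - ω ∧ n ≠ ω then ‖a n‖ else 0)
      + ∑' n : ℤ, ‖a n - restrict B a n‖ := by
  have h1 : HasSum (fun n : ℤ => if n ∈ B then (if (s : ℤ) ∣ n - ω ∧ n ≠ ω then ‖a n‖ else 0) else 0)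
      (∑ n ∈ B, (if (s : ℤ) ∣ n - ω ∧ n ≠ ω then ‖a n‖ else 0)) := by
    rw [← Finset.sum_congr rfl fun n hn => if_pos hn]
    exact hasSum_sum_of_ne_finset_zero fun n hn => if_neg hn
  have h2 : Summable fun n : ℤ => ‖a n - restrict B a n‖ := by
    refine ha.of_nonneg_of_le (fun n => norm_nonneg _) fun n => ?_
    unfold restrict
    split_ifs <;> simp
  rw [← h1.tsum_eq, ← h1.summable.tsum_add h2]
  refine (summable_tail ha s ω).tsum_le_tsum (fun n => ?_) (h1.summable.add h2)
  unfold restrict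
  by_cases hn : n ∈ B
  · simp [hn]
  · simp only [hn, if_false, sub_zero, zero_add]
    split_ifs <;> simp

/-- With L = ⌊log_{s₁} N⌋, each other n in the band meets ω modulo at most L moduli. So `F1`, the
moduli at which some n in `SX` meets ω, has at most XL elements. The mass `D j` of the rest sums
over j to at most L·X·e, so `D j` > e for at most XL indices (`F2`). Mass outside the band is always
charged in full. -/
lemma card_not_isolated_le {a : ℤ → ℂ} (ha : Summable fun n => ‖a n‖) {N X K : ℕ} {s : ℕ → ℕ}
    (hX : 0 < X) (h2 : 2 ≤ s 0) (hlt : ∀ i j, i < j → j < K → s i < s j)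
    (hcop : ∀ i j, i < j → j < K → Nat.Coprime (s i) (s j)) {SX : Finset ℤ} (hSX : SX ⊆ band N)
    (hcard : SX.card = X) {ω : ℤ} (hω : ω ∈ band N) :
    ((Finset.range K).filter fun j => ¬ tail a (s j) ω ≤
      norm1 N (fun n => a n - restrict SX a n) / X + ∑' n : ℤ, ‖a n - restrict (band N) a n‖).card
      ≤ 2 * (X * Nat.log (s 0) N) := by
  classical
  set L := Nat.log (s 0) N
  set e := norm1 N (fun n => a n - restrict SX a n) / X with he
  set D : ℕ → ℝ := fun j => ∑ n ∈ band N \ SX, if (s j : ℤ) ∣ n - ω ∧ n ≠ ω then ‖a n‖ else 0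
    with hD
  have hn1 : norm1 N (fun n => a n - restrict SX a n) = ∑ n ∈ band N \ SX, ‖a n‖ := by
    unfold norm1
    rw [← Finset.sum_sdiff hSX, add_eq_left.2]
    · refine Finset.sum_congr rfl fun n hn => ?_
      simp [restrict, (Finset.mem_sdiff.1 hn).2]
    · exact Finset.sum_eq_zero fun n hn => by simp [restrict, hn]
  have hXr : (0 : ℝ) < X := by exact_mod_cast hX
  have heX : ∑ n ∈ band N \ SX, ‖a n‖ = X * e := by rw [he, hn1]; field_simp
  have he0 : 0 ≤ e := by
    rw [he, hn1]
    exact div_nonneg (Finset.sum_nonneg fun _ _ => norm_nonneg _) hXr.le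
  have hcoll : ∀ n ∈ band N, ((Finset.range K).filter fun j => (s j : ℤ) ∣ n - ω ∧ n ≠ ω).card
      ≤ L := by
    intro n hn
    by_cases hne : n = ω
    · simp [hne]
    · simp only [ne_eq, hne, not_false_eq_true, and_true]
      exact card_filter_dvd_le h2 hlt hcop (sub_ne_zero.2 hne) (natAbs_sub_lt_of_mem_band hn hω)
  set F1 := SX.biUnion fun n => (Finset.range K).filter fun j => (s j : ℤ) ∣ n - ω ∧ n ≠ ω with hF1
  set F2 := (Finset.range K).filter fun j => e < D j with hF2
  have hc1 : F1.card ≤ X * L := by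
    refine Finset.card_biUnion_le.trans ?_
    rw [← hcard, ← smul_eq_mul]
    exact Finset.sum_le_card_nsmul _ _ _ fun n hn => hcoll n (hSX hn)
  have hsumD : ∑ j ∈ Finset.range K, D j ≤ L * (X * e) := by
    rw [← heX, hD, Finset.sum_comm, Finset.mul_sum]
    refine Finset.sum_le_sum fun n hn => ?_
    rw [← Finset.sum_filter, Finset.sum_const, nsmul_eq_mul]
    have := hcoll n (Finset.mem_sdiff.1 hn).1
    gcongr
  have hD0 : ∀ j, 0 ≤ D j := fun j => Finset.sum_nonneg fun n _ => by split_ifs <;> simp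
  have hc2 : F2.card ≤ X * L := by
    -- Markov's inequality divides by e; if e = 0 there is no mass off `SX` and `F2` is empty.
    rcases he0.eq_or_lt with h0 | h0
    · have : F2 = ∅ := by
        rw [hF2, Finset.filter_eq_empty_iff]
        intro j _
        rw [not_lt]
        calc D j ≤ ∑ n ∈ band N \ SX, ‖a n‖ :=
              Finset.sum_le_sum fun n _ => by split_ifs <;> simp
          _ = e := by rw [heX, ← h0, mul_zero]
      simp [this]
    · have h1 : (F2.card : ℝ) * e ≤ L * (X * e) := by
        rw [← nsmul_eq_mul]
        refine (Finset.card_nsmul_le_sum F2 D e fun j hj => (Finset.mem_filter.1 hj).2.le).trans ?_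
        exact (Finset.sum_le_sum_of_subset_of_nonneg (Finset.filter_subset _ _)
          fun j _ _ => hD0 j).trans hsumD
      rw [← mul_assoc, mul_comm (L : ℝ)] at h1
      exact_mod_cast le_of_mul_le_mul_right h1 h0
  refine (Finset.card_le_card (t := F1 ∪ F2) fun j hj => ?_).trans
    ((Finset.card_union_le _ _).trans (by omega))
  rw [Finset.mem_filter] at hj
  obtain ⟨hjK, hj⟩ := hj
  by_contra hcon
  rw [Finset.mem_union, not_or] at hcon
  refine hj ((tail_le ha (band N) (s j) ω).trans (add_le_add_left ?_ _))
  have hz : ∑ n ∈ SX, (if (s j : ℤ) ∣ n - ω ∧ n ≠ ω then ‖a n‖ else 0) = 0 := by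
    refine Finset.sum_eq_zero fun n hn => if_neg fun h => hcon.1 ?_
    rw [hF1, Finset.mem_biUnion]
    exact ⟨n, hn, Finset.mem_filter.2 ⟨hjK, h⟩⟩
  rw [← Finset.sum_sdiff hSX, hz, add_zero]
  by_contra h
  exact hcon.2 (Finset.mem_filter.2 ⟨hjK, not_le.1 h⟩)

/-! ### Random selection -/

lemma selection_eq {l K : ℕ} (s : ℕ → ℕ) (J : Fin l → Fin K) : selection s J
    = ((List.finRange K).filter fun j => decide (∃ a, J a = j)).map
      fun j : Fin K => (s j, (Finset.univ.filter fun a => J a = j).card) := by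
  unfold selection
  simp [← List.map_eq_flatMap, Function.comp_def, Fin.val_inj]

/-- Indices that were not drawn are absent from the list; φ x 0 = 0 lets them enter the full sum. -/
lemma selection_sum {l K : ℕ} (s : ℕ → ℕ) (J : Fin l → Fin K) (φ : ℕ → ℕ → ℕ)
    (hφ : ∀ x, φ x 0 = 0) :
    ((selection s J).map fun sw => φ sw.1 sw.2).sum
      = ∑ j : Fin K, φ (s j) (Finset.univ.filter fun a => J a = j).card := by
  rw [selection_eq, List.map_map, ← List.sum_toFinset _ ((List.nodup_finRange K).filter _), List.toFinset_filter,
    List.toFinset_finRange, Finset.sum_filter]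
  refine Finset.sum_congr rfl fun j _ => ?_
  by_cases h : ∃ a, J a = j
  · simp [h]
  · rw [if_neg (by simpa using h), Finset.filter_eq_empty_iff.2 fun a _ ha => h ⟨a, ha⟩]
    simp [hφ]

lemma selection_sum_snd {l K : ℕ} (s : ℕ → ℕ) (J : Fin l → Fin K) :
    ((selection s J).map Prod.snd).sum = l := by
  rw [selection_sum s J (fun _ w => w) fun _ => rfl]
  have := Finset.card_eq_sum_card_fiberwise (f := J) (s := Finset.univ) (t := Finset.univ)
    (fun _ _ => by simp)
  rw [← this]
  simp

lemma selection_sum_ite {l K : ℕ} (s : ℕ → ℕ) (J : Fin l → Fin K) (P : ℕ → Prop)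
    [DecidablePred P] : ((selection s J).map fun sw => if P sw.1 then 0 else sw.2).sum
      = (Finset.univ.filter fun a => ¬ P (s (J a))).card := by
  rw [selection_sum s J (fun x w => if P x then 0 else w) fun _ => by simp]
  rw [Finset.card_eq_sum_card_fiberwise (f := J) (s := Finset.univ.filter fun a => ¬ P (s (J a)))
    (t := Finset.univ) (fun _ _ => by simp)]
  refine Finset.sum_congr rfl fun j _ => ?_
  rw [Finset.filter_filter]
  split_ifs with h
  · rw [eq_comm, Finset.card_eq_zero, Finset.filter_eq_empty_iff]
    rintro a - ⟨h1, rfl⟩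
    exact h1 h
  · congr 1
    refine Finset.filter_congr fun a _ => ⟨fun h' => ⟨by rwa [h'], h'⟩, fun h' => h'.2⟩

/-- Among all selections, few hit a set of at most a seventh of the moduli at least half of the
time. -/
lemma card_half_hit_le {l K : ℕ} (T : Finset (Fin K)) (hT : 7 * T.card ≤ K) :
    ((Finset.univ.filter fun J : Fin l → Fin K =>
      l ≤ 2 * (Finset.univ.filter fun a => J a ∈ T).card).card : ℝ) ≤ (5 / 7) ^ l * K ^ l := by
  set A := Finset.univ.filter fun J : Fin l → Fin K =>
      l ≤ 2 * (Finset.univ.filter fun a => J a ∈ T).card with hA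
  -- Exponential moment with base 4, which factors over the independent draws. Half of the draws in
  -- T gives at least 4^(l/2) = 2^l, against a mean of at most (1 + 3/7)^l = (10/7)^l.
  have h1 : ∑ J : Fin l → Fin K, (4 : ℝ) ^ (Finset.univ.filter fun a => J a ∈ T).card
      = (K + 3 * T.card) ^ l := by
    have e1 := Finset.prod_univ_sum (fun _ : Fin l => (Finset.univ : Finset (Fin K)))
      (fun _ j => if j ∈ T then (4 : ℝ) else 1)
    have e2 : ∑ j : Fin K, (if j ∈ T then (4 : ℝ) else 1) = K + 3 * T.card := by
      have : ∀ j : Fin K, (if j ∈ T then (4 : ℝ) else 1) = 1 + if j ∈ T then 3 else 0 := fun j => by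
        split_ifs <;> norm_num
      rw [Finset.sum_congr rfl fun j _ => this j, Finset.sum_add_distrib]
      simp [mul_comm]
    rw [e2, Finset.prod_const, Finset.card_univ, Fintype.card_fin, Fintype.piFinset_univ] at e1
    rw [e1]
    refine Finset.sum_congr rfl fun J _ => ?_
    rw [Finset.prod_ite, Finset.prod_const, Finset.prod_const_one, mul_one]
  have h2 : (A.card : ℝ) * 2 ^ l ≤ (K + 3 * T.card) ^ l := by
    rw [← h1, ← nsmul_eq_mul]
    refine (Finset.card_nsmul_le_sum A _ _ fun J hJ => ?_).trans
      (Finset.sum_le_sum_of_subset_of_nonneg (Finset.filter_subset _ _)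
        fun J _ _ => by positivity)
    have hJ' := (Finset.mem_filter.1 hJ).2
    calc (2 : ℝ) ^ l ≤ 2 ^ (2 * (Finset.univ.filter fun a => J a ∈ T).card) :=
          pow_le_pow_right₀ (by norm_num) hJ'
      _ = _ := by rw [pow_mul]; norm_num
  have h3 : (K + 3 * T.card : ℝ) ≤ 10 / 7 * K := by
    have : (7 * T.card : ℝ) ≤ K := by exact_mod_cast hT
    linarith
  have h4 : (A.card : ℝ) * 2 ^ l ≤ (5 / 7) ^ l * K ^ l * 2 ^ l := by
    refine h2.trans ((pow_le_pow_left₀ (by positivity) h3 l).trans (le_of_eq ?_))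
    rw [← mul_pow, ← mul_pow]
    congr 1
    ring
  exact le_of_mul_le_mul_right h4 (by positivity)

/-- The union bound over the band. Since log (5/7) ≤ -2/7 and 21 · 2/7 = 6 ≥ 1, the power is at most
(1 - σ)/N with room to spare. -/
lemma mul_pow_numDraws_le {N : ℕ} (hN : 0 < N) {σ : ℝ} (h0 : 0 ≤ σ) (h1 : σ < 1) :
    (N : ℝ) * (5 / 7) ^ numDraws N σ ≤ 1 - σ := by
  have hNr : (1 : ℝ) ≤ N := by exact_mod_cast hN
  have hσ : 0 < 1 - σ := by linarith
  set y : ℝ := N / (1 - σ) with hy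
  have hy1 : 1 ≤ y := by rw [hy, one_le_div hσ]; linarith
  have hy0 : 0 < y := by linarith
  have hlog := Real.log_nonneg hy1
  have hl : 21 * Real.log y ≤ numDraws N σ := Nat.le_ceil _
  have h2 : Real.log (5 / 7) ≤ - (2 / 7) := by
    have := Real.log_le_sub_one_of_pos (show (0 : ℝ) < 5 / 7 by norm_num)
    linarith
  have h3 : ((5 : ℝ) / 7) ^ numDraws N σ ≤ y⁻¹ := by
    rw [← Real.exp_log (show (0 : ℝ) < y⁻¹ by positivity), Real.log_inv,
      ← Real.exp_log (show (0 : ℝ) < (5 / 7) ^ numDraws N σ by positivity), Real.log_pow,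
      Real.exp_le_exp]
    nlinarith
  calc (N : ℝ) * (5 / 7) ^ numDraws N σ ≤ N * y⁻¹ := by gcongr
    _ = 1 - σ := by rw [hy]; field_simp

lemma uniformOn_univ_real {Ω : Type*} [Fintype Ω] [MeasurableSpace Ω]
    [MeasurableSingletonClass Ω] (A : Finset Ω) :
    (ProbabilityTheory.uniformOn (Set.univ : Set Ω)).real (A : Set Ω)
      = A.card / Fintype.card Ω := by
  rw [MeasureTheory.measureReal_def, ProbabilityTheory.uniformOn_univ,
    MeasureTheory.Measure.count_apply_finset, ENNReal.toReal_div]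
  simp

lemma card_band (N : ℕ) : (band N).card = N := by
  unfold band
  rw [Int.card_Ioc]
  omega

lemma mem_selection {l K : ℕ} {s : ℕ → ℕ} {J : Fin l → Fin K} {sw : ℕ × ℕ}
    (h : sw ∈ selection s J) : ∃ j : Fin K, sw.1 = s j := by
  rw [selection_eq] at h
  obtain ⟨j, -, rfl⟩ := List.mem_map.1 h
  exact ⟨j, rfl⟩

lemma Admissible.le_mul_prod {N X : ℕ} {s : ℕ → ℕ} {t : List ℕ} (h : Admissible N X s t) :
    N ≤ s 0 * t.prod := by
  have h1 := h.le_prod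
  have h0 : (0 : ℝ) < s 0 := by exact_mod_cast (show 0 < s 0 by have := h.two_le; omega)
  rw [div_le_iff₀ h0, mul_comm] at h1
  exact_mod_cast h1

lemma Admissible.s_zero_le {N X : ℕ} {s : ℕ → ℕ} {t : List ℕ} (h : Admissible N X s t) {j : ℕ}
    (hj : j < numModuli N X (s 0)) : s 0 ≤ s j := by
  rcases Nat.eq_zero_or_pos j with rfl | h0
  · exact le_rfl
  · exact (h.s_lt 0 j h0 hj).le

lemma Admissible.t_pos {N X : ℕ} {s : ℕ → ℕ} {t : List ℕ} (h : Admissible N X s t) (hN : 0 < N) :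
    ∀ τ ∈ t, 0 < τ := by
  intro τ hτ
  rw [Nat.pos_iff_ne_zero]
  rintro rfl
  have := h.le_mul_prod
  rw [List.prod_eq_zero hτ] at this
  omega

/-- The error bound holds with probability at least `σ`. -/
theorem error_bound (N k X : ℕ) (σ : ℝ) (f : ℝ → ℂ) (s : ℕ → ℕ) (t : List ℕ) (Sk SX : Finset ℤ)
    (hN : 0 < N) (hX : 0 < X) (hσ0 : 0 ≤ σ) (hσ1 : σ < 1)
    (hf : ContinuousOn f (Set.Icc 0 (2 * Real.pi))) (hper : f 0 = f (2 * Real.pi))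
    (hsum : Summable fun ω : ℤ => ‖fhat f ω‖) (hadm : Admissible N X s t)
    (hkB : Sk ⊆ band N) (hk : Sk.card = k) (hXB : SX ⊆ band N) (hXc : SX.card = X) :
    σ ≤ (ProbabilityTheory.uniformOn
        (Set.univ : Set (Fin (numDraws N σ) → Fin (numModuli N X (s 0))))).real
      {J | norm2 N (fun ω => fhat f ω - toVector (randomRun N k s t J f).val.val ω)
        ≤ norm2 N (fun ω => fhat f ω - restrict Sk (fhat f) ω)
          + 5 * (√k * (norm1 N (fun ω => fhat f ω - restrict SX (fhat f) ω) / X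
            + outOfBand N f))} := by
  classical
  set K := numModuli N X (s 0) with hK
  set l := numDraws N σ with hl
  set δ := norm1 N (fun ω => fhat f ω - restrict SX (fhat f) ω) / X + outOfBand N f with hδ
  have hδ0 : 0 ≤ δ := by
    refine add_nonneg (div_nonneg (Finset.sum_nonneg fun _ _ => norm_nonneg _) (by positivity))
      (tsum_nonneg fun _ => norm_nonneg _)
  have hKpos : 0 < K := by rw [hK, numModuli]; omega
  have : Nonempty (Fin K) := ⟨⟨0, hKpos⟩⟩
  set T : ℤ → Finset (Fin K) := fun ω => Finset.univ.filter fun j => ¬ tail (fhat f) (s j) ω ≤ δ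
    with hT
  have hTc : ∀ ω ∈ band N, 7 * (T ω).card ≤ K := by
    intro ω hω
    have h1 := card_not_isolated_le hsum hX hadm.two_le hadm.s_lt hadm.s_coprime hXB hXc hω
    have h2 : (T ω).card ≤ ((Finset.range K).filter fun j => ¬ tail (fhat f) (s j) ω ≤ δ).card := by
      refine Finset.card_le_card_of_injOn (fun j => (j : ℕ)) (fun j hj => ?_)
        (Fin.val_injective.injOn)
      simpa using (Finset.mem_filter.1 hj).2
    have h3 := h2.trans h1
    have h4 : K = 14 * X * Nat.log (s 0) N + 1 := rfl
    -- 7 · 2XL = 14XL < K: this is what the factor 14 in `numModuli` is for.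
    nlinarith
  set Bad : Finset (Fin l → Fin K) := (band N).biUnion fun ω => Finset.univ.filter fun J =>
    l ≤ 2 * (Finset.univ.filter fun a => J a ∈ T ω).card with hBad
  have hBadc : (Bad.card : ℝ) ≤ (1 - σ) * K ^ l := by
    calc (Bad.card : ℝ) ≤ ∑ ω ∈ band N, ((Finset.univ.filter fun J : Fin l → Fin K =>
          l ≤ 2 * (Finset.univ.filter fun a => J a ∈ T ω).card).card : ℝ) := by
          exact_mod_cast Finset.card_biUnion_le
      _ ≤ ∑ _ω ∈ band N, (5 / 7 : ℝ) ^ l * K ^ l :=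
          Finset.sum_le_sum fun ω hω => card_half_hit_le (T ω) (hTc ω hω)
      _ = (N * (5 / 7 : ℝ) ^ l) * K ^ l := by
          rw [Finset.sum_const, card_band, nsmul_eq_mul, mul_assoc]
      _ ≤ _ := by
          have := mul_pow_numDraws_le hN hσ0 hσ1
          gcongr
  have hKl : (0 : ℝ) < (K : ℝ) ^ l := by
    have : (0 : ℝ) < K := by exact_mod_cast hKpos
    positivity
  have hprob := ProbabilityTheory.isProbabilityMeasure_uniformOn
    (s := (Set.univ : Set (Fin l → Fin K))) Set.finite_univ Set.univ_nonempty
  have hgood : σ ≤ (ProbabilityTheory.uniformOn (Set.univ : Set (Fin l → Fin K))).real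
      ((Badᶜ : Finset (Fin l → Fin K)) : Set (Fin l → Fin K)) := by
    rw [uniformOn_univ_real, Finset.card_compl, Nat.cast_sub (Finset.card_le_univ _),
      Fintype.card_fun, Fintype.card_fin, Fintype.card_fin, Nat.cast_pow, le_div_iff₀ hKl]
    linarith
  refine hgood.trans (MeasureTheory.measureReal_mono fun J hJ => ?_)
  have hJ' : ∀ ω ∈ band N, 2 * (Finset.univ.filter fun a => J a ∈ T ω).card < l := by
    intro ω hω
    by_contra h
    rw [Finset.mem_coe, Finset.mem_compl] at hJ
    exact hJ (Finset.mem_biUnion.2 ⟨ω, hω, by simpa using h⟩)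
  have hspos : ∀ j : Fin K, 0 < s j := fun j => by
    have h1 := hadm.s_zero_le j.2
    have h2 := hadm.two_le
    omega
  have htab : ∀ sw ∈ selection s J, ∀ τ ∈ 1 :: t, IsTable (fhat f) (fastMultiply f
      ((selection s J).flatMap fun sw => (1 :: t).map fun τ => τ * sw.1)).val (τ * sw.1) := by
    intro sw hsw τ hτ h
    rw [fastMultiply_val f _ (List.mem_flatMap.2 ⟨sw, hsw, List.mem_map_of_mem hτ⟩)]
    refine hasSum_dft_sampleArray f hf hper hsum _ (Nat.mul_pos ?_ ?_) h
    · rcases List.mem_cons.1 hτ with rfl | h'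
      · exact one_pos
      · exact hadm.t_pos hN τ h'
    · obtain ⟨j, hj⟩ := mem_selection hsw
      rw [hj]; exact hspos j
  refine norm2_sub_recover_le hsum hN hδ0 hkB hk (fun sw hsw => ?_) (hadm.t_pos hN)
    hadm.t_coprime (selection_sum_snd s J) (fun ω s => tail (fhat f) s ω ≤ δ)
    (fun _ _ _ h => h) (fun ω hω => ?_)
  · obtain ⟨j, hj⟩ := mem_selection hsw
    refine ⟨hj ▸ hspos j, ?_, ?_, fun τ hτ => ⟨hadm.t_pos hN τ hτ, ?_, ?_⟩⟩
    · rw [hj]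
      exact hadm.le_mul_prod.trans (Nat.mul_le_mul_right _ (hadm.s_zero_le j.2))
    · have := htab sw hsw 1 (by simp)
      rwa [one_mul] at this
    · rw [hj]
      exact hadm.t_s_coprime τ hτ j j.2
    · exact htab sw hsw τ (by simp [hτ])
  · rw [selection_sum_ite s J fun s => tail (fhat f) s ω ≤ δ]
    have := hJ' ω hω
    simpa [hT] using this

/-! ### Step counts -/

lemma argMin_steps (G : ℕ → ℕ → ℂ) (s h τ : ℕ) : (argMin G s h τ).steps ≤ 7 + 10 * τ := by
  have h1 := loop_steps_le (List.range τ) ((0, ‖G s h - G (τ * s) h‖ ^ 2) : ℕ × ℝ)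
    (fun st b => do
      let p ← op (b * s)
      let q ← op (h + p)
      let g ← op (G (τ * s) q)
      let d ← op (G s h - g)
      let v ← absSq d
      let c ← op (decide (v < st.2))
      if c then op (b, v) else pure st) 9
    (fun st b _ => by
      simp only [op_bind_steps, absSq_bind_steps, timed_ite_steps, op_steps, timed_pure_steps]
      split_ifs <;> omega)
  simp only [argMin, op_bind_steps, absSq_bind_steps]
  rw [List.length_range] at h1
  simp only [timed_bind_steps (α := ℕ × ℝ), timed_pure_steps]
  omega

lemma residues_steps (G : ℕ → ℕ → ℂ) (t : List ℕ) (s h : ℕ) :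
    (residues G t s h).steps ≤ 12 * t.length + 10 * t.sum := by
  have h1 : (residues G t s h).steps ≤ (t.map fun τ => (11 + 10 * τ) + 1).sum :=
    loop_steps_le_sum _ _ _ (fun τ => 11 + 10 * τ) fun st τ _ => by
      have := argMin_steps G s h τ
      simp only [timed_bind_steps, op_steps]
      omega
  refine h1.trans (le_of_eq ?_)
  induction t with
  | nil => rfl
  | cons τ t ih =>
    rw [List.map_cons, List.sum_cons, ih (loop_steps_le_sum _ _ _ (fun τ => 11 + 10 * τ)
      fun st τ _ => by
        have := argMin_steps G s h τ
        simp only [timed_bind_steps, op_steps]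
        omega), List.length_cons, List.sum_cons]
    ring

lemma chinese_steps (h s : ℕ) (cs : List (ℕ × ℕ)) :
    (chinese h s cs).steps ≤ 3 * cs.length + 6 * (cs.map Prod.fst).sum := by
  have h1 : (chinese h s cs).steps ≤ (cs.map fun c => (c.1 * (5 + 1) + 2) + 1).sum :=
    loop_steps_le_sum cs (h, s) _ (fun c => c.1 * (5 + 1) + 2) fun st c _ => by
      have := loop_steps_le (List.range c.1) st.1 (fun z y => do
        let p ← op (y * st.2)
        let q ← op (st.1 + p)
        let r ← op (q % c.1)
        let e ← op (decide (r = c.2))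
        if e then op q else pure z) 5 (fun z y _ => by
          simp only [op_bind_steps, timed_ite_steps, op_steps, timed_pure_steps]
          split_ifs <;> omega)
      rw [List.length_range] at this
      simp only [timed_bind_steps (α := ℕ), op_steps]
      omega
  refine h1.trans (le_of_eq ?_)
  clear h1
  induction cs with
  | nil => rfl
  | cons c cs ih =>
    rw [List.map_cons, List.sum_cons, ih, List.length_cons, List.map_cons, List.sum_cons]
    ring

lemma toBand_steps (N x M : ℕ) : (toBand N x M).steps ≤ 7 := by
  simp only [toBand, op_bind_steps, timed_ite_steps, op_steps]
  split_ifs <;> omega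

lemma reconstruct_steps (G : ℕ → ℕ → ℂ) (N : ℕ) (t : List ℕ) (s h : ℕ) :
    (reconstruct G N t s h).steps ≤ 15 * t.length + 16 * t.sum + 7 := by
  have h1 := residues_steps G t s h
  have h2 := chinese_steps h s (residues G t s h).val
  have h3 := toBand_steps N (chinese h s (residues G t s h).val).val.1
    (chinese h s (residues G t s h).val).val.2
  have h4 : ((residues G t s h).val.map Prod.fst).sum = t.sum := by
    rw [residues_val, List.map_reverse, List.sum_reverse, List.map_map]
    simp [Function.comp_def]
  have h5 : (residues G t s h).val.length = t.length := by
    rw [residues_val]; simp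
  rw [h4, h5] at h2
  simp only [reconstruct, timed_bind_steps]
  omega

lemma identify_steps (G : ℕ → ℕ → ℂ) (N : ℕ) (t : List ℕ) (S : List (ℕ × ℕ)) (Q : ℕ)
    (hQ : ∀ sw ∈ S, sw.1 ≤ Q) :
    (identify G N t S).steps ≤ S.length * (Q * (15 * t.length + 16 * t.sum + 12) + 1) := by
  refine loop_steps_le _ _ _ _ fun st sw hsw => ?_
  refine (loop_steps_le _ _ _ (15 * t.length + 16 * t.sum + 11) fun st h _ => ?_).trans ?_
  · have := reconstruct_steps G N t sw.1 h
    rw [timed_bind_steps]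
    cases (reconstruct G N t sw.1 h).val
    · simp only [timed_pure_steps]; omega
    · simp only [op_bind_steps, timed_pure_steps]; omega
  · rw [List.length_range]
    exact Nat.mul_le_mul_right _ (hQ sw hsw)

lemma largest_steps (k : ℕ) (xs : List (ℤ × ℂ)) : (largest k xs).steps
    ≤ 6 * xs.length + 3 + (10 * xs.length + 1) * Nat.clog 2 xs.length := by
  set le : ℤ × ℂ → ℤ × ℂ → Timed Bool := fun a b => do
    let u ← absSq a.2
    let v ← absSq b.2
    op (decide (v ≤ u)) with hle
  set body : List (ℤ × ℂ) → ℤ × ℂ → Timed (List (ℤ × ℂ)) := fun st a => do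
    let b ← op (decide (a.2 = 0))
    if b then pure st else op (a :: st) with hbody
  have h1 : (loop xs [] body).steps ≤ xs.length * 3 := loop_steps_le _ _ _ 2 fun st a _ => by
    simp only [hbody, op_bind_steps, timed_ite_steps, op_steps, timed_pure_steps]
    split_ifs <;> omega
  have h2 := nonzero_loop_val xs []
  rw [← hbody, List.append_nil] at h2
  have h3 : (loop xs [] body).val.length ≤ xs.length := by
    rw [h2, List.length_reverse]; exact List.length_filter_le _ _
  have h4 := mergeSort_steps le 7 (fun a b => le_rfl) (loop xs [] body).val
  have h5 := takeFirst_steps (2 * k) (mergeSort le (loop xs [] body).val).val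
  rw [(mergeSort_perm le _).length_eq] at h5
  have h6 : (7 + 3) * (loop xs [] body).val.length + 1 ≤ 10 * xs.length + 1 := by omega
  have h7 := Nat.mul_le_mul h6 (Nat.clog_mono_right 2 h3)
  have h8 : (largest k xs).steps = (loop xs [] body).steps
      + ((mergeSort le (loop xs [] body).val).steps
        + (1 + (takeFirst (2 * k) (mergeSort le (loop xs [] body).val).val).steps)) := rfl
  omega

/-- A bound for the number of steps of the recovery, from `d` distinct moduli `s`, which are at
most `Q`, and `r` moduli `t`, whose sum is `T`. -/
def recoverCost (d Q r T : ℕ) : ℕ :=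
  d * (Q * (15 * r + 16 * T + 12) + 1) + 4 * (d * Q) + (estimateCost d r + 2) * (2 * Q)
    + (6 * (2 * Q) + 3 + (10 * (2 * Q) + 1) * Nat.clog 2 (2 * Q))

/-- Double counting of votes: at most Ql are cast in all, and every estimated frequency received
more than l/2 of them. -/
lemma estimateAll_length (G : ℕ → ℕ → ℂ) (N l : ℕ) (t : List ℕ) (S : List (ℕ × ℕ)) (Q : ℕ)
    (hQ : ∀ sw ∈ S, sw.1 ≤ Q) (hl : (S.map Prod.snd).sum = l) (hl0 : 0 < l) :
    (estimateAll G l t S (identify G N t S).val).val.length ≤ 2 * Q := by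
  obtain ⟨h1, h2, -⟩ := estimateAll_spec G l t S (identify G N t S).val
  generalize (estimateAll G l t S (identify G N t S).val).val = xs at h1 h2
  have h3 := sum_identify_count G N t S (xs.map Prod.fst).toFinset
  have h4 : (S.map fun sw => sw.1 * sw.2).sum ≤ Q * l := by
    rw [← hl, ← List.sum_map_mul_left]
    exact List.sum_le_sum fun sw hsw => Nat.mul_le_mul_right _ (hQ sw hsw)
  have h5 : (xs.map Prod.fst).toFinset.card • l
      ≤ ∑ ω ∈ (xs.map Prod.fst).toFinset, 2 * (identify G N t S).val.1 ω := by
    refine Finset.card_nsmul_le_sum _ _ _ fun ω hω => ?_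
    simp only [List.mem_toFinset, List.mem_map] at hω
    obtain ⟨p, hp, rfl⟩ := hω
    exact ((h2 p).1 hp).2.1.le
  rw [← Finset.mul_sum, List.toFinset_card_of_nodup h1, List.length_map, smul_eq_mul] at h5
  exact Nat.le_of_mul_le_mul_right (h5.trans (by rw [mul_assoc]; omega)) hl0

lemma recover_steps (G : ℕ → ℕ → ℂ) (N k l : ℕ) (t : List ℕ) (S : List (ℕ × ℕ)) (Q : ℕ)
    (hQ : ∀ sw ∈ S, sw.1 ≤ Q) (hl : (S.map Prod.snd).sum = l) (hl0 : 0 < l) :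
    (recover N k l t S G).steps ≤ recoverCost S.length Q t.length t.sum := by
  have h1 := identify_steps G N t S Q hQ
  have h2 := (estimateAll_spec G l t S (identify G N t S).val).2.2
  have h3 := estimateAll_length G N l t S Q hQ hl hl0
  have h4 := largest_steps k (estimateAll G l t S (identify G N t S).val).val
  have h5 : (identify G N t S).val.2.length ≤ S.length * Q := by
    refine (identify_list_length G N t S).trans ?_
    refine (List.sum_le_card_nsmul _ Q fun x hx => ?_).trans (by simp)
    obtain ⟨sw, hsw, rfl⟩ := List.mem_map.1 hx
    exact hQ sw hsw
  have h6 := Nat.mul_le_mul_left (estimateCost S.length t.length + 2) h3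
  have h7 := Nat.mul_le_mul (show 10 * (estimateAll G l t S (identify G N t S).val).val.length + 1
    ≤ 10 * (2 * Q) + 1 by omega) (Nat.clog_mono_right 2 h3)
  have h8 : (recover N k l t S G).steps = (identify G N t S).steps
    + ((estimateAll G l t S (identify G N t S).val).steps
      + (largest k (estimateAll G l t S (identify G N t S).val).val).steps) := rfl
  rw [h8, recoverCost]
  omega

lemma fourierApprox_points (N k l : ℕ) (t : List ℕ) (S : List (ℕ × ℕ)) (f : ℝ → ℂ) (Q : ℕ)
    (hQ : ∀ sw ∈ S, sw.1 ≤ Q) :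
    (fourierApprox N k l t S f).points.length ≤ S.length * ((1 + t.sum) * Q) := by
  have h1 : (fourierApprox N k l t S f).points
      = (fastMultiply f (S.flatMap fun sw => (1 :: t).map fun τ => τ * sw.1)).points ++ [] := rfl
  rw [h1, List.append_nil, fastMultiply_points, list_sum_flatMap]
  refine (List.sum_le_card_nsmul _ ((1 + t.sum) * Q) fun x hx => ?_).trans (by simp)
  obtain ⟨sw, hsw, rfl⟩ := List.mem_map.1 hx
  rw [List.sum_map_mul_right, List.map_id', List.sum_cons]
  exact Nat.mul_le_mul_left _ (hQ sw hsw)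

/-- Both bounds matter: l gives the factor log (N/(1 - σ)) in the cost, while K is polynomial in N
and keeps the logarithms from sorting independent of σ. -/
lemma selection_length {l K : ℕ} (s : ℕ → ℕ) (J : Fin l → Fin K) :
    (selection s J).length ≤ l ∧ (selection s J).length ≤ K := by
  rw [selection_eq, List.length_map]
  constructor
  · rw [← List.toFinset_card_of_nodup ((List.nodup_finRange K).filter _)]
    calc _ ≤ (Finset.univ.image J).card := Finset.card_le_card fun j hj => by
          simpa using hj
      _ ≤ l := Finset.card_image_le.trans (by simp)
  · exact (List.length_filter_le _ _).trans (by simp)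

/-! ### Moduli built from primes -/

lemma prod_range_nth_prime (m : ℕ) :
    ∏ i ∈ Finset.range (Nat.primeCounting' m), Nat.nth Nat.Prime i = ∏ r ∈ m.primesBelow, r := by
  refine Finset.prod_nbij (Nat.nth Nat.Prime) (fun i hi => ?_) ?_ (fun r hr => ?_) fun _ _ => rfl
  · exact Nat.mem_primesBelow.2 ⟨Nat.nth_lt_of_lt_count (Finset.mem_range.1 hi),
      Nat.prime_nth_prime i⟩
  · exact (Nat.nth_strictMono Nat.infinite_setOfPred_prime).injective.injOn
  · obtain ⟨h1, h2⟩ := Nat.mem_primesBelow.1 hr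
    exact ⟨Nat.primeCounting' r, Finset.mem_coe.2 (Finset.mem_range.2 (Nat.count_strict_mono h2 h1)), Nat.nth_count h2⟩

lemma primorial_eq_mul_prod_primesBelow {p : ℕ} (hp : p.Prime) :
    primorial p = p * ∏ r ∈ p.primesBelow, r := by
  have h1 : primorial p = ∏ r ∈ (p + 1).primesBelow, r := rfl
  rw [h1, Nat.primesBelow_succ, if_pos hp, Finset.prod_insert (Nat.notMem_primesBelow p)]

lemma firstModulus_mem (N X : ℕ) : firstModulus N X ∈
    {p : ℕ | p.Prime ∧ X ≤ p ∧ N ≤ p * ∏ r ∈ p.primesBelow, r} := by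
  refine Nat.sInf_mem ?_
  obtain ⟨p, h1, h2⟩ := Nat.exists_infinite_primes (max X N)
  refine ⟨p, h2, (le_max_left _ _).trans h1, ((le_max_right _ _).trans h1).trans
    (Nat.le_mul_of_pos_right _ (Finset.prod_pos fun r hr => ?_))⟩
  exact (Nat.prime_of_mem_primesBelow hr).pos

lemma firstModulus_prime (N X : ℕ) : (firstModulus N X).Prime := (firstModulus_mem N X).1
lemma le_firstModulus (N X : ℕ) : X ≤ firstModulus N X := (firstModulus_mem N X).2.1
lemma le_primorial_firstModulus (N X : ℕ) : N ≤ primorial (firstModulus N X) := by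
  rw [primorial_eq_mul_prod_primesBelow (firstModulus_prime N X)]
  exact (firstModulus_mem N X).2.2

/-- Bertrand's postulate supplies a prime in (y, 2y], and the primes below it include all primes up
to y. -/
lemma firstModulus_le {N X y : ℕ} (hX : X ≤ y) (hy : 0 < y) (hN : N ≤ primorial y) :
    firstModulus N X ≤ 2 * y := by
  obtain ⟨p, h1, h2, h3⟩ := Nat.exists_prime_lt_and_le_two_mul y hy.ne'
  suffices h : N ≤ p * ∏ r ∈ p.primesBelow, r by
    have hmem : p ∈ {p : ℕ | p.Prime ∧ X ≤ p ∧ N ≤ p * ∏ r ∈ p.primesBelow, r} :=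
      ⟨h1, by omega, h⟩
    exact (Nat.sInf_le hmem).trans h3
  have h4 : primorial y = ∏ r ∈ (y + 1).primesBelow, r := rfl
  refine (hN.trans ?_).trans (Nat.le_mul_of_pos_left _ h1.pos)
  rw [h4]
  exact Finset.prod_le_prod_of_subset_of_one_le' (Nat.primesBelow_mono h2)
    fun r hr _ => (Nat.prime_of_mem_primesBelow hr).one_lt.le

lemma primeModuli_zero (N X : ℕ) : primeModuli N X 0 = firstModulus N X :=
  Nat.nth_count (firstModulus_prime N X)

lemma primeModuli_strictMono (N X : ℕ) : StrictMono (primeModuli N X) := fun _ _ h =>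
  Nat.nth_strictMono Nat.infinite_setOfPred_prime (by omega)

lemma primeModuli_prime (N X j : ℕ) : (primeModuli N X j).Prime := Nat.prime_nth_prime _

/-- All primes below s₁ together are enough by the choice of s₁, so the minimal λ stops before s₁;
this gives t_i < s₁. -/
lemma numPrimes_le (N X : ℕ) : numPrimes N X ≤ Nat.primeCounting' (firstModulus N X) :=
  Nat.sInf_le (by
    rw [Set.mem_ofPred_eq, prod_range_nth_prime]
    exact (firstModulus_mem N X).2.2)

lemma le_mul_prod_smallPrimes (N X : ℕ) : N ≤ firstModulus N X * (smallPrimes N X).prod := by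
  have h : numPrimes N X ∈
      {n : ℕ | N ≤ firstModulus N X * ∏ i ∈ Finset.range n, Nat.nth Nat.Prime i} :=
    Nat.sInf_mem ⟨Nat.primeCounting' (firstModulus N X), by
      rw [Set.mem_ofPred_eq, prod_range_nth_prime]
      exact (firstModulus_mem N X).2.2⟩
  exact h

lemma mem_smallPrimes {N X τ : ℕ} (h : τ ∈ smallPrimes N X) : τ.Prime ∧ τ < firstModulus N X := by
  unfold smallPrimes at h
  obtain ⟨i, hi, rfl⟩ := List.mem_map.1 h
  rw [List.mem_range] at hi
  exact ⟨Nat.prime_nth_prime i, Nat.nth_lt_of_lt_count (hi.trans_le (numPrimes_le N X))⟩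

theorem admissible_primes (N X : ℕ) :
    Admissible N X (primeModuli N X) (smallPrimes N X) := by
  have hmono := primeModuli_strictMono N X
  have hsorted : (smallPrimes N X).Pairwise (· < ·) := by
    unfold smallPrimes
    rw [List.pairwise_map]
    exact (List.pairwise_lt_range).imp fun h => Nat.nth_strictMono Nat.infinite_setOfPred_prime h
  refine ⟨(primeModuli_prime N X 0).two_le, fun i j h _ => hmono h, fun i j h _ => ?_, hsorted,
    fun τ hτ => ?_, ?_, fun τ hτ j _ => ?_, ?_⟩
  · exact (Nat.coprime_primes (primeModuli_prime N X i) (primeModuli_prime N X j)).2 (hmono h).ne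
  · rw [primeModuli_zero]; exact (mem_smallPrimes hτ).2
  · refine hsorted.imp_of_mem fun {a b} ha hb h => ?_
    exact (Nat.coprime_primes (mem_smallPrimes ha).1 (mem_smallPrimes hb).1).2 h.ne
  · have h1 := (mem_smallPrimes hτ).2
    have h2 := hmono.monotone (Nat.zero_le j)
    rw [primeModuli_zero] at h2
    exact (Nat.coprime_primes (mem_smallPrimes hτ).1 (primeModuli_prime N X j)).2 (by omega)
  · have h0 : (0 : ℝ) < primeModuli N X 0 := by exact_mod_cast (primeModuli_prime N X 0).pos
    rw [div_le_iff₀ h0, primeModuli_zero, mul_comm]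
    exact_mod_cast le_mul_prod_smallPrimes N X

/-! ### Size of the moduli -/

lemma exists_theta_ge : ∃ n₀ : ℕ, 0 < n₀ ∧ ∀ n : ℕ, n₀ ≤ n → (n : ℝ) / 4 ≤ Chebyshev.theta n := by
  -- With log n ≤ √n / 100 the error terms are at most a few hundredths of n, well within the gap
  -- between log 2 and 1/4.
  have h1 := (isLittleO_log_rpow_atTop (show (0 : ℝ) < 1 / 2 by norm_num)).bound
    (show (0 : ℝ) < 1 / 100 by norm_num)
  obtain ⟨n₁, hn₁⟩ := Filter.eventually_atTop.1
    ((tendsto_natCast_atTop_atTop (R := ℝ)).eventually h1)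
  refine ⟨max n₁ 100, by simp, fun n hn => ?_⟩
  have hn100 : (100 : ℝ) ≤ n := by exact_mod_cast (le_max_right _ _).trans hn
  have hn1 := hn₁ n ((le_max_left _ _).trans hn)
  have hlog0 : 0 ≤ Real.log n := Real.log_nonneg (by linarith)
  rw [← Real.sqrt_eq_rpow, Real.norm_of_nonneg hlog0, Real.norm_of_nonneg (Real.sqrt_nonneg _)]
    at hn1
  have hs := Real.sq_sqrt (show (0 : ℝ) ≤ n by linarith)
  have hs0 : 1 ≤ √(n : ℝ) := Real.one_le_sqrt.2 (by linarith)
  have h2 : Real.log (n + 1) ≤ Real.log 2 + Real.log n := by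
    rw [← Real.log_mul (by norm_num) (by linarith)]
    exact Real.log_le_log (by linarith) (by linarith)
  have h3 := Chebyshev.theta_ge n
  have h4 := Real.log_two_gt_d9
  have h5 := Real.log_two_lt_d9
  have h6 : 2 * √(n : ℝ) * Real.log n ≤ n / 50 := by nlinarith
  have h7 : Real.log n ≤ n / 100 := by nlinarith
  nlinarith

/-- After multiplication by log p, the main term contributes 2 log 4 ≤ 2.8 times p and the term √p
contributes √p log p ≤ 2p. -/
lemma primeCounting_le_mul_div {p : ℕ} (hp : 2 ≤ p) :
    (Nat.primeCounting p : ℝ) ≤ 5 * p / Real.log p := by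
  have hp' : (2 : ℝ) ≤ p := by exact_mod_cast hp
  have h1 := Chebyshev.pi_le_log4_mul_div (x := p) (by linarith)
  rw [Nat.floor_natCast, Real.log_sqrt (by linarith)] at h1
  have hlog : 0 < Real.log p := Real.log_pos (by linarith)
  have h4 : Real.log 4 ≤ 1.4 := by
    rw [show (4 : ℝ) = 2 ^ 2 by norm_num, Real.log_pow]
    have := Real.log_two_lt_d9
    push_cast
    linarith
  have hs0 : 0 < √(p : ℝ) := Real.sqrt_pos.2 (by linarith)
  have hs := Real.sq_sqrt (show (0 : ℝ) ≤ p by linarith)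
  have h5 : Real.log p ≤ 2 * √(p : ℝ) := by
    have := Real.log_le_sub_one_of_pos hs0
    rw [Real.log_sqrt (by linarith)] at this
    linarith
  refine h1.trans ?_
  rw [le_div_iff₀ hlog, add_mul]
  have e1 : Real.log 4 * p / (Real.log p / 2) * Real.log p = 2 * Real.log 4 * p := by
    field_simp
  rw [e1]
  nlinarith

lemma exists_primeCounting_ge : ∃ n₀ : ℕ, 2 ≤ n₀ ∧ ∀ n : ℕ, n₀ ≤ n →
    (n : ℝ) / (4 * Real.log n) ≤ Nat.primeCounting n := by
  obtain ⟨n₀, -, h⟩ := exists_theta_ge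
  refine ⟨max n₀ 2, le_max_right _ _, fun n hn => ?_⟩
  have h1 := h n ((le_max_left _ _).trans hn)
  have h2 : (2 : ℝ) ≤ n := by exact_mod_cast (le_max_right _ _).trans hn
  have h3 := Chebyshev.theta_le_pi_mul_log n
  have hlog : 0 < Real.log n := Real.log_pos (by linarith)
  rw [div_le_iff₀ (by positivity)]
  linarith

lemma one_le_log {N : ℕ} (hN : 4 < N) : 1 ≤ Real.log N := by
  rw [Real.le_log_iff_exp_le (by exact_mod_cast (by omega : 0 < N))]
  have h1 := Real.exp_one_lt_d9
  have h2 : (5 : ℝ) ≤ N := by exact_mod_cast hN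
  linarith

/-- The primorial of s₁ is at least N and at most 4^{s₁}. This makes X log N at most a multiple of
s₁², so that logarithms of all moduli are comparable to log s₁. -/
lemma log_le_firstModulus_mul (N X : ℕ) (hN : 0 < N) :
    Real.log N ≤ firstModulus N X * 1.4 := by
  have h1 := (le_primorial_firstModulus N X).trans (primorial_le_four_pow _)
  have h2 : Real.log N ≤ Real.log ((4 : ℝ) ^ firstModulus N X) :=
    Real.log_le_log (by exact_mod_cast hN) (by exact_mod_cast h1)
  have h4 : Real.log 4 ≤ 1.4 := by
    rw [show (4 : ℝ) = 2 ^ 2 by norm_num, Real.log_pow]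
    have := Real.log_two_lt_d9
    push_cast
    linarith
  rw [Real.log_pow] at h2
  exact h2.trans (mul_le_mul_of_nonneg_left h4 (Nat.cast_nonneg _))

/-- The first modulus is at most of order `X log N`. -/
lemma exists_firstModulus_le : ∃ C : ℝ, 1 ≤ C ∧ ∀ N X : ℕ, 1 ≤ X → 4 < N →
    (firstModulus N X : ℝ) ≤ C * (X * Real.log N) := by
  obtain ⟨n₀, h0, h⟩ := exists_theta_ge
  refine ⟨2 * (n₀ + 6), by linarith [(Nat.cast_nonneg n₀ : (0 : ℝ) ≤ n₀)], fun N X hX hN => ?_⟩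
  have hl := one_le_log hN
  have hX' : (1 : ℝ) ≤ X := by exact_mod_cast hX
  -- The last summand makes θ(y) ≥ y/4 ≥ log N, that is, the primorial of y reaches N.
  set y := n₀ + X + ⌈4 * Real.log N⌉₊ with hy
  have h1 : 4 * Real.log N ≤ y := by
    rw [hy]; push_cast
    linarith [Nat.le_ceil (4 * Real.log N), (Nat.cast_nonneg n₀ : (0 : ℝ) ≤ n₀)]
  have h2 : (y : ℝ) ≤ n₀ + X + 4 * Real.log N + 1 := by
    rw [hy]; push_cast
    linarith [Nat.ceil_lt_add_one (show 0 ≤ 4 * Real.log N by linarith)]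
  have h3 := h y (by omega)
  rw [Chebyshev.theta_eq_log_primorial, Nat.floor_natCast] at h3
  have h4 : N ≤ primorial y := by
    have : Real.log N ≤ Real.log (primorial y) := by linarith
    rw [Real.log_le_log_iff (by exact_mod_cast (by omega : 0 < N))
      (by exact_mod_cast primorial_pos y)] at this
    exact_mod_cast this
  have h5 : (firstModulus N X : ℝ) ≤ 2 * y := by
    exact_mod_cast firstModulus_le (by omega) (by omega) h4
  have h6 : (n₀ : ℝ) ≤ n₀ * (X * Real.log N) :=
    le_mul_of_one_le_right (Nat.cast_nonneg _) (one_le_mul_of_one_le_of_one_le hX' hl)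
  nlinarith

lemma exists_smallPrimes_le : ∃ C : ℝ, 1 ≤ C ∧ ∀ N X : ℕ, 4 < N →
    ((smallPrimes N X).length : ℝ) ≤ C * Real.log N ∧
    ((smallPrimes N X).sum : ℝ) ≤ C * Real.log N ^ 2 := by
  obtain ⟨n₀, h0, h⟩ := exists_theta_ge
  have hn₀ : (1 : ℝ) ≤ n₀ := by exact_mod_cast h0
  refine ⟨(n₀ + 5) ^ 2, by nlinarith, fun N X hN => ?_⟩
  have hl := one_le_log hN
  set n := numPrimes N X with hn
  have hlen : (smallPrimes N X).length = n := by simp [smallPrimes, hn]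
  rcases Nat.eq_zero_or_pos n with h1 | h1
  · have h2 : smallPrimes N X = [] := List.eq_nil_of_length_eq_zero (hlen.trans h1)
    rw [h2]
    constructor <;> simp <;> positivity
  · set q := Nat.nth Nat.Prime (n - 1) with hq
    have hqp : q.Prime := Nat.prime_nth_prime _
    have hnq : n ≤ q := by
      have := Nat.add_two_le_nth_prime (n - 1)
      omega
    have hcount : Nat.primeCounting' q = n - 1 := Nat.primeCounting'_nth_eq _
    -- Minimality of λ: without the last prime q the product is too small. Hence θ(q - 1) ≤ log N,
    -- which bounds q, and with it λ ≤ q and the sum λq.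
    have h2 : firstModulus N X * ∏ r ∈ q.primesBelow, r < N := by
      rw [← prod_range_nth_prime, hcount]
      by_contra hcon
      have h3 : n ≤ n - 1 := Nat.sInf_le (not_lt.1 hcon)
      omega
    have h3 : primorial (q - 1) ≤ N := by
      have h4 : primorial (q - 1) = ∏ r ∈ q.primesBelow, r := by
        rw [primorial_eq_prod_primesLE, Nat.primesBelow_eq_primesLE_sub_one]
      rw [h4]
      exact (Nat.le_mul_of_pos_left _ (firstModulus_prime N X).pos).trans h2.le
    have h4 : (q : ℝ) ≤ (n₀ + 5) * Real.log N := by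
      have hq1 : ((q - 1 : ℕ) : ℝ) = q - 1 := by
        rw [Nat.cast_sub hqp.one_lt.le, Nat.cast_one]
      by_cases hc : n₀ ≤ q - 1
      · have h5 := h (q - 1) hc
        rw [Chebyshev.theta_eq_log_primorial, Nat.floor_natCast, hq1] at h5
        have h6 : Real.log (primorial (q - 1)) ≤ Real.log N :=
          Real.log_le_log (by exact_mod_cast primorial_pos _) (by exact_mod_cast h3)
        nlinarith
      · have h5 : (q : ℝ) ≤ n₀ := by exact_mod_cast (by omega : q ≤ n₀)
        nlinarith
    have hnr : (n : ℝ) ≤ (n₀ + 5) * Real.log N := le_trans (by exact_mod_cast hnq) h4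
    rw [hlen]
    constructor
    · refine hnr.trans ?_
      have : (n₀ + 5 : ℝ) ≤ (n₀ + 5) ^ 2 := by nlinarith
      gcongr
    · have h5 : (smallPrimes N X).sum ≤ n * q := by
        refine (List.sum_le_card_nsmul _ q fun τ hτ => ?_).trans (by rw [hlen, smul_eq_mul])
        obtain ⟨i, hi, rfl⟩ := List.mem_map.1 hτ
        rw [List.mem_range, ← hn] at hi
        exact (Nat.nth_strictMono Nat.infinite_setOfPred_prime).monotone (by omega)
      calc ((smallPrimes N X).sum : ℝ) ≤ n * q := by exact_mod_cast h5
        _ ≤ ((n₀ + 5) * Real.log N) * ((n₀ + 5) * Real.log N) := by gcongr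
        _ = _ := by ring

/-- All moduli are at most of order `X log N`. -/
lemma exists_primeModuli_le : ∃ C : ℝ, 1 ≤ C ∧ ∀ N X : ℕ, 4 ≤ X → 4 < N →
    ∃ Q : ℕ, 1 ≤ Q ∧ (Q : ℝ) ≤ C * (X * Real.log N) ∧
      ∀ j < numModuli N X (primeModuli N X 0), primeModuli N X j ≤ Q := by
  obtain ⟨Cp, hCp, hp⟩ := exists_firstModulus_le
  obtain ⟨n₀, hn₀, hpi⟩ := exists_primeCounting_ge
  -- 5Cp pays for the primes below s₁, 14 for the bulk of K, another Cp for its final + 1, and n₀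
  -- makes y large enough for the lower bound on π.
  set A : ℝ := 6 * Cp + 14 + n₀ with hA
  have hA1 : 20 ≤ A := by rw [hA]; linarith [(Nat.cast_nonneg n₀ : (0 : ℝ) ≤ n₀)]
  have hAn : (n₀ : ℝ) ≤ A := by rw [hA]; linarith
  refine ⟨576 * A ^ 2 + 1, by nlinarith, fun N X hX hN => ?_⟩
  have hl := one_le_log hN
  have hX' : (4 : ℝ) ≤ X := by exact_mod_cast hX
  set p := firstModulus N X with hpdef
  have hpX : (X : ℝ) ≤ p := by exact_mod_cast le_firstModulus N X
  have hpC := hp N X (by omega) hN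
  rw [← hpdef] at hpC
  have hpl := log_le_firstModulus_mul N X (by omega)
  rw [← hpdef] at hpl
  set M := X * Real.log N with hM
  have hM4 : 4 ≤ M := by rw [hM]; nlinarith
  set lp := Real.log p with hlp
  have hlp1 : 1 ≤ lp := one_le_log (N := p) (by
    have h1 := le_firstModulus N X
    have h2 := firstModulus_prime N X
    rw [← hpdef] at h1 h2
    rcases h1.eq_or_lt with h | h
    · by_contra hcon
      have : p = 4 := by omega
      rw [this] at h2
      exact absurd h2 (by norm_num)
    · omega)
  set y := ⌈576 * A ^ 2 * M⌉₊ with hy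
  have hy1 : 576 * A ^ 2 * M ≤ y := Nat.le_ceil _
  have hy2 : (y : ℝ) ≤ 576 * A ^ 2 * M + 1 := (Nat.ceil_lt_add_one (by positivity)).le
  have hA2 : 20 * A ≤ A ^ 2 := by nlinarith
  have hyn : n₀ ≤ y := by
    have : (n₀ : ℝ) ≤ y := by nlinarith
    exact_mod_cast this
  refine ⟨y, by omega, by nlinarith, fun j hj => ?_⟩
  have hy0 : (0 : ℝ) < y := by nlinarith
  -- the number of primes up to `y`
  have hlogy : Real.log y ≤ 2 * lp + 96 * A := by
    have e1 : (y : ℝ) ≤ (48 * A) ^ 2 * (p : ℝ) ^ 2 := by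
      have : M ≤ p * (p * 1.4) := by
        rw [hM]
        exact mul_le_mul hpX hpl (by linarith) (by linarith)
      nlinarith
    have hp0 : (0 : ℝ) < p := by linarith
    calc Real.log y ≤ Real.log ((48 * A) ^ 2 * (p : ℝ) ^ 2) := Real.log_le_log hy0 e1
      _ = 2 * Real.log (48 * A) + 2 * lp := by
        rw [Real.log_mul (by positivity) (by positivity), Real.log_pow, Real.log_pow]
        push_cast; ring
      _ ≤ _ := by
        have := Real.log_le_sub_one_of_pos (show 0 < 48 * A by linarith)
        linarith
  have hlogy0 : 0 < Real.log y := Real.log_pos (by nlinarith)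
  have hcount : (Nat.primeCounting' p : ℝ) + numModuli N X p ≤ A * M / lp := by
    have e1 : (Nat.primeCounting' p : ℝ) ≤ 5 * p / lp := by
      refine le_trans ?_ (primeCounting_le_mul_div (firstModulus_prime N X).two_le)
      exact_mod_cast Nat.monotone_primeCounting' (Nat.le_succ p)
    have e2 : (numModuli N X p : ℝ) ≤ 14 * M / lp + 1 := by
      have := Real.natLog_le_logb N p
      rw [Real.logb, ← hlp] at this
      unfold numModuli
      push_cast
      have h1 := mul_le_mul_of_nonneg_left this (show (0 : ℝ) ≤ 14 * X by linarith)
      have h2 : 14 * (X : ℝ) * (Real.log N / lp) = 14 * M / lp := by rw [hM]; ring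
      linarith
    have e3 : 1 ≤ Cp * M / lp := by
      rw [le_div_iff₀ (by linarith), one_mul]
      have := Real.log_le_sub_one_of_pos (show (0 : ℝ) < p by linarith)
      linarith
    have e4 : 5 * (p : ℝ) / lp ≤ 5 * (Cp * M) / lp := by gcongr
    have e5 : A * M / lp = 5 * (Cp * M) / lp + 14 * M / lp + Cp * M / lp + n₀ * M / lp := by
      rw [hA]; ring
    have e6 : 0 ≤ n₀ * M / lp := by positivity
    linarith
  -- Since log y ≤ 98 A log p, it suffices that y is at least 4 · 98 A² M = 392 A² M, and 576 A² M
  -- was chosen.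
  have hbig : A * M / lp ≤ y / (4 * Real.log y) := by
    rw [div_le_div_iff₀ (by linarith) (by linarith)]
    have e1 : A * M * (4 * Real.log y) ≤ A * M * (4 * (98 * A * lp)) := by
      have : 2 * lp + 96 * A ≤ 98 * A * lp := by nlinarith
      have hAM : 0 ≤ A * M := by positivity
      gcongr
      linarith
    have e2 : 576 * A ^ 2 * M * lp ≤ y * lp := by gcongr
    nlinarith
  have hfin : Nat.primeCounting' p + numModuli N X p ≤ Nat.primeCounting y := by
    exact_mod_cast (hcount.trans hbig).trans (hpi y hyn)
  rw [primeModuli_zero, ← hpdef] at hj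
  refine Nat.lt_succ_iff.1 (Nat.nth_lt_of_lt_count ?_)
  have : Nat.primeCounting y = Nat.count Nat.Prime y.succ := rfl
  rw [← hpdef]
  omega

/-! ### The total cost -/

lemma clog_two_le {n : ℕ} {x : ℝ} (hx : 1 ≤ x) (hn : (n : ℝ) ≤ x) :
    (Nat.clog 2 n : ℝ) ≤ 2 * Real.log x + 1 := by
  have hlx := Real.log_nonneg hx
  rcases Nat.eq_zero_or_pos n with rfl | h0
  · simp; linarith
  have hn1 : (1 : ℝ) ≤ n := by exact_mod_cast h0
  have hln := Real.log_nonneg hn1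
  rw [← Real.natCeil_logb_natCast]
  have h1 : 0 ≤ Real.logb (2 : ℕ) n := by
    rw [Real.logb]
    have := Real.log_two_gt_d9
    push_cast
    positivity
  have h2 := (Nat.ceil_lt_add_one h1).le
  have h3 : Real.logb (2 : ℕ) n ≤ 2 * Real.log n := by
    rw [Real.logb]
    have := Real.log_two_gt_d9
    push_cast
    rw [div_le_iff₀ (by linarith)]
    nlinarith
  have h4 := Real.log_le_log (by linarith) hn
  linarith

lemma clog_two_le_mul_log {N n : ℕ} {b : ℝ} (hN : 4 < N) (hb : 1 ≤ b)
    (hn : (n : ℝ) ≤ 30 * b * (N : ℝ) ^ 3) : (Nat.clog 2 n : ℝ) ≤ 100 * b * Real.log N := by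
  have hNr : (4 : ℝ) < N := by exact_mod_cast hN
  have hℓ := one_le_log hN
  have h1 : (1 : ℝ) ≤ (N : ℝ) ^ 3 := one_le_pow₀ (by linarith)
  refine (clog_two_le (by nlinarith) hn).trans ?_
  rw [Real.log_mul (by positivity) (by positivity), Real.log_pow]
  have h2 := Real.log_le_sub_one_of_pos (show 0 < 30 * b by linarith)
  push_cast
  nlinarith

lemma estimateCost_le {d r : ℕ} {c ℓ Λ : ℝ} (hc : 1 ≤ c) (hℓ : 1 ≤ ℓ) (hΛ : 1 ≤ Λ)
    (hd : (d : ℝ) ≤ 22 * Λ) (hr : (r : ℝ) ≤ c * ℓ)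
    (hlog : (Nat.clog 2 (d * (r + 1)) : ℝ) ≤ c * ℓ) :
    (estimateCost d r : ℝ) + 2 ≤ 2000 * c ^ 2 * (Λ * ℓ ^ 2) := by
  have h1 : (d : ℝ) * (r + 1) ≤ 44 * c * (Λ * ℓ) := by
    have : (r : ℝ) + 1 ≤ 2 * (c * ℓ) := by nlinarith
    calc (d : ℝ) * (r + 1) ≤ (22 * Λ) * (2 * (c * ℓ)) := by gcongr
      _ = _ := by ring
  have hE : (estimateCost d r : ℝ) + 2 = 21 * (d * (r + 1)) + d + 2 * r + 6
      + (8 * (d * (r + 1)) + 2) * Nat.clog 2 (d * (r + 1)) := by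
    unfold estimateCost; push_cast; ring
  have hcℓ : 1 ≤ c * ℓ := one_le_mul_of_one_le_of_one_le hc hℓ
  have hΛℓ : 1 ≤ Λ * ℓ := one_le_mul_of_one_le_of_one_le hΛ hℓ
  have hcc : c ≤ c ^ 2 := by nlinarith
  set u := Λ * ℓ ^ 2 with hu
  have hu1 : 1 ≤ u := one_le_mul_of_one_le_of_one_le hΛ (one_le_pow₀ hℓ)
  have hΛℓu : Λ * ℓ ≤ u := by rw [hu]; gcongr; nlinarith
  have hΛu : Λ ≤ u := by rw [hu]; exact le_mul_of_one_le_right (by linarith) (one_le_pow₀ hℓ)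
  have hℓu : ℓ ≤ u := by nlinarith
  have h2 : (8 * ((d : ℝ) * (r + 1)) + 2) * Nat.clog 2 (d * (r + 1))
      ≤ (8 * (44 * c * (Λ * ℓ)) + 2 * (c * (Λ * ℓ))) * (c * ℓ) := by
    gcongr
    nlinarith
  have h3 : (8 * (44 * c * (Λ * ℓ)) + 2 * (c * (Λ * ℓ))) * (c * ℓ) = 354 * (c ^ 2 * u) := by
    rw [hu]; ring
  have h4 : c * (Λ * ℓ) ≤ c ^ 2 * u := by gcongr
  have h5 : Λ ≤ c ^ 2 * u := hΛu.trans (le_mul_of_one_le_left (by linarith) (by nlinarith))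
  have h6 : c * ℓ ≤ c ^ 2 * u := by gcongr
  have h7 : 1 ≤ c ^ 2 * u := hcℓ.trans h6
  rw [hE]
  nlinarith

/-- Two terms are of full order x ℓ³ Λ: identification, d · Q · T with factors Λ, xℓ and ℓ², and
estimation, 2Q estimates of cost Λℓ². Building the lists and the final sort are of lower order. -/
lemma recoverCost_le {d Q r T : ℕ} {c ℓ Λ x : ℝ} (hc : 1 ≤ c) (hℓ : 1 ≤ ℓ) (hΛ : 1 ≤ Λ)
    (hx : 1 ≤ x) (hd : (d : ℝ) ≤ 22 * Λ) (hQ : (Q : ℝ) ≤ c * (x * ℓ)) (hr : (r : ℝ) ≤ c * ℓ)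
    (hT : (T : ℝ) ≤ c * ℓ ^ 2) (hlog : (Nat.clog 2 (d * (r + 1)) : ℝ) ≤ c * ℓ)
    (hlog' : (Nat.clog 2 (2 * Q) : ℝ) ≤ c * ℓ) :
    (recoverCost d Q r T : ℝ) ≤ 10000 * c ^ 3 * (x * ℓ ^ 3 * Λ) := by
  have hE := estimateCost_le hc hℓ hΛ hd hr hlog
  have hℓ2 : ℓ ≤ ℓ ^ 2 := by nlinarith
  have hℓ1 : 1 ≤ ℓ ^ 2 := one_le_pow₀ hℓ
  have hc2 : c ≤ c ^ 2 := by nlinarith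
  have hc3 : c ^ 2 ≤ c ^ 3 := pow_le_pow_right₀ hc (by norm_num)
  have hxℓ : 1 ≤ x * ℓ := one_le_mul_of_one_le_of_one_le hx hℓ
  have hcxℓ : 1 ≤ c * (x * ℓ) := one_le_mul_of_one_le_of_one_le hc hxℓ
  have hcℓ2 : 1 ≤ c * ℓ ^ 2 := one_le_mul_of_one_le_of_one_le hc hℓ1
  set M := x * ℓ ^ 3 * Λ with hM
  have hM0 : 0 ≤ M := by positivity
  have h1 : 15 * (r : ℝ) + 16 * T + 12 ≤ 43 * (c * ℓ ^ 2) := by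
    have : c * ℓ ≤ c * ℓ ^ 2 := by gcongr
    linarith
  have h2 : (d : ℝ) * (Q * (15 * r + 16 * T + 12) + 1) ≤ 968 * (c ^ 2 * M) := by
    calc (d : ℝ) * (Q * (15 * r + 16 * T + 12) + 1)
        ≤ (22 * Λ) * ((c * (x * ℓ)) * (43 * (c * ℓ ^ 2)) + (c * (x * ℓ)) * (c * ℓ ^ 2)) := by
          gcongr
          exact one_le_mul_of_one_le_of_one_le hcxℓ hcℓ2
      _ = _ := by rw [hM]; ring
  have h3 : 4 * ((d : ℝ) * Q) ≤ 88 * (c ^ 2 * M) := by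
    calc 4 * ((d : ℝ) * Q) ≤ 4 * ((22 * Λ) * (c * (x * ℓ) * (c * ℓ ^ 2))) := by
          gcongr
          exact hQ.trans (le_mul_of_one_le_right (by linarith) hcℓ2)
      _ = _ := by rw [hM]; ring
  have h4 : ((estimateCost d r : ℝ) + 2) * (2 * Q) ≤ 4000 * (c ^ 3 * M) := by
    calc ((estimateCost d r : ℝ) + 2) * (2 * Q)
        ≤ (2000 * c ^ 2 * (Λ * ℓ ^ 2)) * (2 * (c * (x * ℓ))) := by gcongr
      _ = _ := by rw [hM]; ring
  have h5 : (6 * (2 * (Q : ℝ)) + 3 + (10 * (2 * Q) + 1) * Nat.clog 2 (2 * Q))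
      ≤ 36 * (c ^ 2 * M) := by
    have e1 : (10 * (2 * (Q : ℝ)) + 1) * Nat.clog 2 (2 * Q) ≤ (21 * (c * (x * ℓ))) * (c * ℓ) := by
      gcongr
      linarith
    have e2 : c * (x * ℓ) ≤ c * (x * ℓ) * (c * ℓ) :=
      le_mul_of_one_le_right (by linarith) (one_le_mul_of_one_le_of_one_le hc hℓ)
    have e3 : c * (x * ℓ) * (c * ℓ) ≤ c ^ 2 * M := by
      calc c * (x * ℓ) * (c * ℓ) = c ^ 2 * (x * ℓ ^ 2 * 1) := by ring
        _ ≤ c ^ 2 * (x * ℓ ^ 3 * Λ) := by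
          have : ℓ ^ 2 ≤ ℓ ^ 3 := pow_le_pow_right₀ hℓ (by norm_num)
          gcongr
        _ = _ := rfl
    linarith
  have h6 : c ^ 2 * M ≤ c ^ 3 * M := by gcongr
  have h7 : 0 ≤ c ^ 3 * M := by positivity
  have h8 : (recoverCost d Q r T : ℝ) = d * (Q * (15 * r + 16 * T + 12) + 1) + 4 * (d * Q)
      + ((estimateCost d r : ℝ) + 2) * (2 * Q)
      + (6 * (2 * (Q : ℝ)) + 3 + (10 * (2 * Q) + 1) * Nat.clog 2 (2 * Q)) := by
    unfold recoverCost; push_cast; ring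
  rw [h8]
  linarith

/-- The number of samples and the number of steps, for moduli built from primes. -/
theorem exists_cost_le : ∃ C : ℝ, 0 < C ∧ ∀ N X k : ℕ, 4 ≤ X → X < N → ∀ (σ : ℝ) (f : ℝ → ℂ),
    0 ≤ σ → σ < 1 →
    ∀ J : Fin (numDraws N σ) → Fin (numModuli N X (primeModuli N X 0)),
      ((randomRun N k (primeModuli N X) (smallPrimes N X) J f).points.length : ℝ)
        ≤ C * (X * Real.log N ^ 3 * Real.log (N / (1 - σ))) ∧
      ((randomRun N k (primeModuli N X) (smallPrimes N X) J f).val.steps : ℝ)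
        ≤ C * (X * Real.log N ^ 3 * Real.log (N / (1 - σ))) := by
  obtain ⟨c₁, hc₁, ht⟩ := exists_smallPrimes_le
  obtain ⟨c₂, hc₂, hs⟩ := exists_primeModuli_le
  -- The factor 100 lets the same constant serve in `clog_two_le_mul_log` with b = c₁ + c₂.
  set c : ℝ := 100 * (c₁ + c₂) with hc
  have hc1 : 1 ≤ c := by rw [hc]; linarith
  refine ⟨10000 * c ^ 3, by positivity, fun N X k hX hXN σ f hσ0 hσ1 J => ?_⟩
  have hN : 4 < N := by omega
  have hℓ := one_le_log hN
  have hNr : (4 : ℝ) < N := by exact_mod_cast hN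
  have hXr : (4 : ℝ) ≤ X := by exact_mod_cast hX
  have hXNr : (X : ℝ) ≤ N := by exact_mod_cast hXN.le
  obtain ⟨Q, hQ1, hQ, hQs⟩ := hs N X hX hN
  obtain ⟨hr, hT⟩ := ht N X hN
  have hσ : 0 < 1 - σ := by linarith
  set ℓ := Real.log N with hℓdef
  set Λ := Real.log (N / (1 - σ)) with hΛdef
  have hℓΛ : ℓ ≤ Λ := by
    refine Real.log_le_log (by linarith) ?_
    rw [le_div_iff₀ hσ]
    nlinarith
  have hΛ1 : 1 ≤ Λ := hℓ.trans hℓΛ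
  have hℓN : ℓ ≤ N := (Real.log_le_sub_one_of_pos (by linarith)).trans (by linarith)
  set S := selection (primeModuli N X) J with hS
  obtain ⟨hSl, hSK⟩ := selection_length (primeModuli N X) J
  have hl : (numDraws N σ : ℝ) ≤ 22 * Λ := by
    have := (Nat.ceil_lt_add_one (show 0 ≤ 21 * Λ by linarith)).le
    have h2 : numDraws N σ = ⌈21 * Λ⌉₊ := rfl
    rw [h2]
    linarith
  have hl0 : 0 < numDraws N σ := Nat.ceil_pos.2 (show 0 < 21 * Λ by linarith)
  have hd : (S.length : ℝ) ≤ 22 * Λ := le_trans (by exact_mod_cast hSl) hl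
  have hSQ : ∀ sw ∈ S, sw.1 ≤ Q := fun sw hsw => by
    obtain ⟨j, hj⟩ := mem_selection hsw
    rw [hj]
    exact hQs j j.2
  have hQc : (Q : ℝ) ≤ c * (X * ℓ) := by
    refine hQ.trans ?_
    rw [hc]
    gcongr
    linarith
  have hrc : ((smallPrimes N X).length : ℝ) ≤ c * ℓ := by
    refine hr.trans ?_
    rw [hc]
    gcongr
    linarith
  have hTc : ((smallPrimes N X).sum : ℝ) ≤ c * ℓ ^ 2 := by
    refine hT.trans ?_
    rw [hc]
    gcongr
    linarith
  have hlog1 : (Nat.clog 2 (S.length * ((smallPrimes N X).length + 1)) : ℝ) ≤ c * ℓ := by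
    refine clog_two_le_mul_log hN (by linarith) ?_
    -- Here the number of distinct moduli is bounded by K, not by l, since l is unbounded as σ tends
    -- to 1.
    have h1 : (S.length : ℝ) ≤ 15 * (N : ℝ) ^ 2 := by
      have h2 : numModuli N X (primeModuli N X 0) ≤ 15 * (N * N) := by
        unfold numModuli
        have h3 : Nat.log (primeModuli N X 0) N ≤ N := Nat.log_le_self _ _
        have h4 : 14 * X * Nat.log (primeModuli N X 0) N ≤ 14 * N * N := by gcongr
        nlinarith
      rw [pow_two]
      exact_mod_cast hSK.trans h2
    have h2 : ((smallPrimes N X).length : ℝ) + 1 ≤ 2 * (c₁ + c₂) * N := by nlinarith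
    push_cast
    calc (S.length : ℝ) * ((smallPrimes N X).length + 1)
        ≤ (15 * (N : ℝ) ^ 2) * (2 * (c₁ + c₂) * N) := by gcongr
      _ = _ := by ring
  have hlog2 : (Nat.clog 2 (2 * Q) : ℝ) ≤ c * ℓ := by
    refine clog_two_le_mul_log hN (by linarith) ?_
    have h1 : (X : ℝ) * ℓ ≤ N * N := by gcongr
    push_cast
    calc 2 * (Q : ℝ) ≤ 2 * (c₂ * (N * N)) := by
          have := mul_le_mul_of_nonneg_left h1 (show 0 ≤ c₂ by linarith)
          linarith
      _ ≤ 30 * (c₁ + c₂) * (N * N * 1) := by nlinarith [mul_nonneg (by linarith : (0 : ℝ) ≤ N) (by linarith : (0 : ℝ) ≤ N)]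
      _ ≤ 30 * (c₁ + c₂) * (N * N * N) := by gcongr; linarith
      _ = _ := by ring
  constructor
  · have h1 : (randomRun N k (primeModuli N X) (smallPrimes N X) J f).points.length
        ≤ S.length * ((1 + (smallPrimes N X).sum) * Q) := fourierApprox_points _ _ _ _ _ _ _ hSQ
    have h2 : 1 + ((smallPrimes N X).sum : ℝ) ≤ 2 * (c * ℓ ^ 2) := by
      have := one_le_mul_of_one_le_of_one_le hc1 (one_le_pow₀ hℓ (n := 2))
      linarith
    calc ((randomRun N k (primeModuli N X) (smallPrimes N X) J f).points.length : ℝ)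
        ≤ S.length * ((1 + (smallPrimes N X).sum) * Q) := by exact_mod_cast h1
      _ ≤ (22 * Λ) * ((2 * (c * ℓ ^ 2)) * (c * (X * ℓ))) := by gcongr
      _ = 44 * c ^ 2 * (X * ℓ ^ 3 * Λ) := by ring
      _ ≤ 10000 * c ^ 3 * (X * ℓ ^ 3 * Λ) := by
        have : c ^ 2 ≤ c ^ 3 := pow_le_pow_right₀ hc1 (by norm_num)
        gcongr
        linarith
  · have h1 : (randomRun N k (primeModuli N X) (smallPrimes N X) J f).val.steps
        ≤ recoverCost S.length Q (smallPrimes N X).length (smallPrimes N X).sum :=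
      recover_steps _ _ _ _ _ _ _ hSQ (selection_sum_snd _ _) hl0
    refine (Nat.cast_le.2 h1).trans ?_
    exact recoverCost_le hc1 hℓ hΛ1 (by linarith) hd hQc hrc hTc hlog1 hlog2

end SparseFourier

/-! ### The main theorem -/

theorem mainTheorem4 :
    -- the error bound, for all admissible moduli
    (∀ (N k εinv : ℕ) (σ : ℝ) (f : ℝ → ℂ) (s : ℕ → ℕ) (t : List ℕ) (Sk SX : Finset ℤ),
      2 ≤ k → 2 ≤ εinv → k * εinv < N → 2 / 3 ≤ σ → σ < 1 →
      ContinuousOn f (Set.Icc 0 (2 * Real.pi)) → f 0 = f (2 * Real.pi) →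
      Summable (fun ω : ℤ => ‖SparseFourier.fhat f ω‖) →
      SparseFourier.Admissible N (k * εinv) s t →
      SparseFourier.IsOptSupport N k (SparseFourier.fhat f) Sk →
      SparseFourier.IsOptSupport N (k * εinv) (SparseFourier.fhat f) SX →
      σ ≤ (ProbabilityTheory.uniformOn
          (Set.univ : Set (Fin (SparseFourier.numDraws N σ) →
            Fin (SparseFourier.numModuli N (k * εinv) (s 0))))).real
        {J | SparseFourier.norm2 N (fun ω => SparseFourier.fhat f ω -
                SparseFourier.toVector (SparseFourier.randomRun N k s t J f).val.val ω)
            ≤ SparseFourier.norm2 N (fun ω => SparseFourier.fhat f ω -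
                SparseFourier.restrict Sk (SparseFourier.fhat f) ω)
              + 22 * (1 / (εinv : ℝ)) * SparseFourier.norm1 N (fun ω => SparseFourier.fhat f ω -
                SparseFourier.restrict SX (SparseFourier.fhat f) ω) / Real.sqrt k
              + 22 * Real.sqrt k * SparseFourier.outOfBand N f}) ∧
    -- the number of evaluations of `f` and the runtime, for moduli built from primes
    (∃ C : ℝ, 0 < C ∧ ∀ N k εinv : ℕ, 2 ≤ k → 2 ≤ εinv → k * εinv < N →
      SparseFourier.Admissible N (k * εinv) (SparseFourier.primeModuli N (k * εinv))
        (SparseFourier.smallPrimes N (k * εinv)) ∧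
      ∀ (σ : ℝ) (f : ℝ → ℂ), 2 / 3 ≤ σ → σ < 1 →
      ∀ J : Fin (SparseFourier.numDraws N σ) →
          Fin (SparseFourier.numModuli N (k * εinv) (SparseFourier.primeModuli N (k * εinv) 0)),
        ((SparseFourier.randomRun N k (SparseFourier.primeModuli N (k * εinv))
            (SparseFourier.smallPrimes N (k * εinv)) J f).points.length : ℝ)
          ≤ C * ((k * εinv : ℝ) * Real.log N ^ 3 * Real.log (N / (1 - σ))) ∧
        ((SparseFourier.randomRun N k (SparseFourier.primeModuli N (k * εinv))
            (SparseFourier.smallPrimes N (k * εinv)) J f).val.steps : ℝ)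
          ≤ C * ((k * εinv : ℝ) * Real.log N ^ 3 * Real.log (N / (1 - σ)))) := by
  refine ⟨?_, ?_⟩
  · intro N k εinv σ f s t Sk SX hk hε hN hσ0 hσ1 hf hper hsum hadm hSk hSX
    have hX : 0 < k * εinv := Nat.mul_pos (by omega) (by omega)
    refine (SparseFourier.error_bound N k (k * εinv) σ f s t Sk SX (by omega) hX (by linarith) hσ1
      hf hper hsum hadm hSk.1 hSk.2.1 hSX.1 hSX.2.1).trans ?_
    have := ProbabilityTheory.isProbabilityMeasure_uniformOn
      (s := (Set.univ : Set (Fin (SparseFourier.numDraws N σ) →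
        Fin (SparseFourier.numModuli N (k * εinv) (s 0))))) Set.finite_univ
        ⟨fun _ => ⟨0, by rw [SparseFourier.numModuli]; omega⟩, trivial⟩
    refine MeasureTheory.measureReal_mono fun J hJ => ?_
    refine le_trans (Set.mem_ofPred.1 hJ) ?_
    have hk0 : (0 : ℝ) < k := by exact_mod_cast (by omega : 0 < k)
    have hε0 : (0 : ℝ) < εinv := by exact_mod_cast (by omega : 0 < εinv)
    set n₁ := SparseFourier.norm1 N (fun ω => SparseFourier.fhat f ω -
      SparseFourier.restrict SX (SparseFourier.fhat f) ω)
    have hn₁ : 0 ≤ n₁ := Finset.sum_nonneg fun _ _ => norm_nonneg _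
    have ho : 0 ≤ SparseFourier.outOfBand N f := tsum_nonneg fun _ => norm_nonneg _
    have hs0 : 0 < √(k : ℝ) := Real.sqrt_pos.2 hk0
    -- With X = k/ε the factor √k / X is ε/√k; the constant 5 obtained is then relaxed to 22.
    have e1 : √(k : ℝ) * (n₁ / ((k * εinv : ℕ) : ℝ)) = 1 / (εinv : ℝ) * n₁ / √k := by
      have hdiv : √(k : ℝ) / k = 1 / √k := Real.sqrt_div_self'
      calc √(k : ℝ) * (n₁ / ((k * εinv : ℕ) : ℝ)) = √(k : ℝ) / k * (1 / εinv * n₁) := by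
            push_cast; field_simp
        _ = _ := by rw [hdiv]; ring
    have e2 : 0 ≤ 1 / (εinv : ℝ) * n₁ / √k := by positivity
    have e3 : 0 ≤ √(k : ℝ) * SparseFourier.outOfBand N f := by positivity
    have e4 : 22 * (1 / (εinv : ℝ)) * n₁ / √k = 22 * (1 / (εinv : ℝ) * n₁ / √k) := by ring
    rw [mul_add, e1, e4]
    linarith
  · obtain ⟨C, hC, h⟩ := SparseFourier.exists_cost_le
    refine ⟨C, hC, fun N k εinv hk hε hN =>
      ⟨SparseFourier.admissible_primes N (k * εinv), fun σ f hσ0 hσ1 J => ?_⟩⟩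
    have h1 := h N (k * εinv) k (Nat.mul_le_mul hk hε) hN σ f (by linarith) hσ1 J
    push_cast at h1
    exact h1
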